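/- For a matroid $M$ on a finite labelled ground set $N=\{0,\dots,n-1\}$, let $P_M\subseteq[0,1]^N$ be its matroid polytope, i.e., the convex hull of the indicator vectors of the independent sets of $M$. For $x\in P_M$ let $\mathcal D(x)$ be the distribution of the random set that contains each $e\in N$ independently with probability $x_e$. A sample-based online contention resolution scheme (OCRS) for $M$ with $k$ samples is a randomized algorithm that does not know $x$. It is given $n$, an independence oracle for $M$, independent fair coin flips, and $k$ independent samples from $\mathcal D(x)$. An active set $R\sim\mathcal D(x)$ is drawn independently of the samples and the coins, its elements arrive one by one, and upon each arrival the algorithm irrevocably selects or discards the arriving element; the set of selected elements has to be independent in $M$ at all times, for every outcome of the samples and the coins and every sequence of arrivals of distinct elements. The order of the arrivals is chosen by the almighty adversary, that is, as an arbitrary function of $R$ and all the randomness of the algorithm (the samples and all of its coin flips, past and future). The scheme is $c$-selectable for $x$ if, against every such adversary, $\Pr[e \text{ is selected}\mid e\in R]\ge c$ for every $e\in N$ with $x_e>0$. **Theorem.** For every $\varepsilon>0$ there are a single algorithm $A$ (a program for a random access machine with unit-cost addition and subtraction, unit-cost access to the independence oracle, the coins, and single membership bits of the samples), a polynomial $p$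 and a function $k:\mathbb N\to\mathbb N$ with $$k(\rho)=O_\varepsilon\bigl(\log \rho\cdot(\log\log \rho)^2\bigr)\qquad(\rho\to\infty),$$ such that, for every $n$ and every matroid $M$ on $N=\{0,\dots,n-1\}$, the algorithm $A$ with $k(\operatorname{rank}(M))$ samples is a sample-based OCRS for $M$ for which the preprocessing and the handling of each arrival take at most $p(n)$ steps in the worst case, and which is $(\tfrac14-\varepsilon)$-selectable against the almighty adversary for every $x\in P_M$. -/

import Mathlib

open Filter Asymptotics

namespace OCRS

/-! ## Matroid polytope and random sets -/

/-- The rank of a matroid on a finite ground set, as a natural number. -/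
noncomputable def rank {n : ℕ} (M : Matroid (Fin n)) : ℕ := M.eRank.toNat

/-- The matroid polytope: the marginal vectors of distributions over independent sets, that is,
the convex hull of the indicator vectors of the independent sets. -/
def polytope {n : ℕ} (M : Matroid (Fin n)) : Set (Fin n → ℝ) :=
  convexHull ℝ {v | ∃ I : Set (Fin n), M.Indep I ∧ v = I.indicator (fun _ => (1 : ℝ))}

/-- The probability of the set `S` under the product distribution `D(x)`, which contains every
element `e` independently with probability `x e`. -/
def productWeight {n : ℕ} (x : Fin n → ℝ) (S : Finset (Fin n)) : ℝ :=
  ∏ e, if e ∈ S then x e else 1 - x e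

/-- All randomness: the active set `R(x)`, the `k` samples, and `m` coin flips. -/
abbrev Outcome (n k m : ℕ) : Type :=
  Finset (Fin n) × (Fin k → Finset (Fin n)) × (Fin m → Bool)

/-- The active set and the `k` samples are drawn from `D(x)`, the coins are fair, and everything
is independent. -/
noncomputable def weight {n k m : ℕ} (x : Fin n → ℝ) (ω : Outcome n k m) : ℝ :=
  productWeight x ω.1 * (∏ j, productWeight x (ω.2.1 j)) * (1 / 2 : ℝ) ^ m

open Classical in
/-- The probability of an event. -/
noncomputable def prob {n k m : ℕ} (x : Fin n → ℝ) (A : Outcome n k m → Prop) : ℝ :=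
  ∑ ω, if A ω then weight x ω else 0

/-- The conditional probability of `A` given `B` (used only where `B` has positive
probability). -/
noncomputable def condProb {n k m : ℕ} (x : Fin n → ℝ) (A B : Outcome n k m → Prop) : ℝ :=
  prob x (fun ω => A ω ∧ B ω) / prob x B

/-! ## The machine model

Structured programs over natural-number variables and arrays (a random access machine with
addition and subtraction at unit cost, which is polynomially equivalent to Turing machines), with
an independence oracle, read access to the samples, and a source of fair random bits. -/

/-- Arithmetic expressions; subtraction is truncated. -/
inductive Expr : Type where
  | lit (c : ℕ)
  | var (v : ℕ)
  | get (a : ℕ) (i : Expr)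
  | add (e₁ e₂ : Expr)
  | sub (e₁ e₂ : Expr)

/-- Programs. -/
inductive Prog : Type where
  /-- `v := e` -/
  | assign (v : ℕ) (e : Expr)
  /-- `a[i] := e` -/
  | store (a : ℕ) (i e : Expr)
  /-- sequential composition -/
  | seq (p q : Prog)
  /-- `if e ≠ 0 then p else q` -/
  | branch (e : Expr) (p q : Prog)
  /-- `while e ≠ 0 do p` -/
  | loop (e : Expr) (p : Prog)
  /-- `v :=` a fresh random bit -/
  | flip (v : ℕ)
  /-- `v :=` whether the set with characteristic array `a` is independent -/
  | query (v a : ℕ)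
  /-- `v :=` whether the element `e` belongs to the sample with index `j` -/
  | look (v : ℕ) (j e : Expr)

/-- A memory: variables, arrays, and the number of coins used so far. -/
structure Memory : Type where
  var : ℕ → ℕ
  arr : ℕ → ℕ → ℕ
  coinsUsed : ℕ

/-- What a program can access besides its memory. -/
structure Env (n : ℕ) : Type where
  indep : Set (Fin n) → Prop
  sample : ℕ → ℕ → Prop
  coin : ℕ → Bool

/-- The value of an expression. -/
def Expr.eval (s : Memory) : Expr → ℕ
  | .lit c => c
  | .var v => s.var v
  | .get a i => s.arr a (i.eval s)
  | .add e₁ e₂ => e₁.eval s + e₂.eval s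
  | .sub e₁ e₂ => e₁.eval s - e₂.eval s

/-- Write to a variable. -/
def Memory.setVar (s : Memory) (v x : ℕ) : Memory :=
  { s with var := Function.update s.var v x }

/-- Write to an array cell. -/
def Memory.setArr (s : Memory) (a i x : ℕ) : Memory :=
  { s with arr := Function.update s.arr a (Function.update (s.arr a) i x) }

/-- A configuration: the programs that remain to be executed, in order, and the memory. -/
abbrev Config : Type := List Prog × Memory

open Classical in
/-- One step of computation. A configuration with nothing left to execute has halted. -/
noncomputable def step {n : ℕ} (E : Env n) : Config → Config
  | ([], s) => ([], s)
  | (.assign v e :: K, s) => (K, s.setVar v (e.eval s))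
  | (.store a i e :: K, s) => (K, s.setArr a (i.eval s) (e.eval s))
  | (.seq p q :: K, s) => (p :: q :: K, s)
  | (.branch e p q :: K, s) => if e.eval s ≠ 0 then (p :: K, s) else (q :: K, s)
  | (.loop e p :: K, s) => if e.eval s ≠ 0 then (p :: .loop e p :: K, s) else (K, s)
  | (.flip v :: K, s) =>
      (K, { s.setVar v (E.coin s.coinsUsed).toNat with coinsUsed := s.coinsUsed + 1 })
  | (.query v a :: K, s) =>
      (K, s.setVar v (if E.indep {i : Fin n | s.arr a i ≠ 0} then 1 else 0))
  | (.look v j e :: K, s) =>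
      (K, s.setVar v (if E.sample (j.eval s) (e.eval s) then 1 else 0))

/-- The program `p`, started in memory `s`, halts within `T` steps. -/
def HaltsWithin {n : ℕ} (E : Env n) (T : ℕ) (p : Prog) (s : Memory) : Prop :=
  ((step E)^[T] ([p], s)).1 = []

/-- The memory after `T` steps (the final memory if the program halts within `T` steps). -/
noncomputable def run {n : ℕ} (E : Env n) (T : ℕ) (p : Prog) (s : Memory) : Memory :=
  ((step E)^[T] ([p], s)).2

/-! ## Online contention resolution schemes -/

/-- A sample-based online contention resolution algorithm: a program that is run once before the
first arrival, and a program that is run at every arrival of an active element. -/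
structure Scheme : Type where
  setup : Prog
  arrival : Prog

/-- The environment given by a matroid, the samples and the coins. Only `k` samples are
available. -/
def env {n k m : ℕ} (M : Matroid (Fin n)) (S : Fin k → Finset (Fin n)) (c : Fin m → Bool) :
    Env n where
  indep I := M.Indep I
  sample j e := ∃ (hj : j < k) (he : e < n), (⟨e, he⟩ : Fin n) ∈ S ⟨j, hj⟩
  coin i := if hi : i < m then c ⟨i, hi⟩ else false

/-- The input of the algorithm: variable `0` holds the number of elements. Everything else
is `0`. -/
def initial (n : ℕ) : Memory where
  var := fun v => if v = 0 then n else 0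
  arr := fun _ _ => 0
  coinsUsed := 0

/-- Handling one arrival: the index of the arriving element is put into variable `1`, the arrival
program is run, and the element is selected if and only if variable `2` is then nonzero. The
memory is kept for later arrivals. -/
noncomputable def Scheme.handle {n : ℕ} (A : Scheme) (E : Env n) (T : ℕ)
    (st : Memory × Finset (Fin n)) (e : Fin n) : Memory × Finset (Fin n) :=
  let s := run E T A.arrival (st.1.setVar 1 e)
  (s, if s.var 2 ≠ 0 then insert e st.2 else st.2)

/-- The memory and the set of selected elements after the elements of the list `L` have arrived
in this order. -/
noncomputable def Scheme.play {n : ℕ} (A : Scheme) (E : Env n) (T : ℕ) (L : List (Fin n)) :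
    Memory × Finset (Fin n) :=
  L.foldl (A.handle E T) (run E T A.setup (initial n), ∅)

/-- The number of coins that are provided when each of the at most `n + 1` program runs takes at
most `T` steps; the supply cannot run out. -/
def coinSupply (n T : ℕ) : ℕ := T * (n + 1)

/-- Whatever the samples and the coins are, the setup and the handling of each arrival, in any
sequence of arrivals of distinct elements, take at most `T` steps. -/
def Scheme.RunsWithin {n : ℕ} (A : Scheme) (M : Matroid (Fin n)) (k T : ℕ) : Prop :=
  ∀ (S : Fin k → Finset (Fin n)) (c : Fin (coinSupply n T) → Bool),
    HaltsWithin (env M S c) T A.setup (initial n) ∧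
    ∀ (L : List (Fin n)) (e : Fin n), (L ++ [e]).Nodup →
      HaltsWithin (env M S c) T A.arrival ((A.play (env M S c) T L).1.setVar 1 e)

/-- The set of selected elements is independent at all times. -/
def Scheme.Feasible {n : ℕ} (A : Scheme) (M : Matroid (Fin n)) (k T : ℕ) : Prop :=
  ∀ (S : Fin k → Finset (Fin n)) (c : Fin (coinSupply n T) → Bool) (L : List (Fin n)),
    L.Nodup → M.Indep ((A.play (env M S c) T L).2 : Set (Fin n))

/-- The almighty adversary: it orders the active elements knowing the active set and all of the
randomness of the algorithm (samples and coins). -/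
structure AlmightyAdversary (n k m : ℕ) : Type where
  order : Outcome n k m → List (Fin n)
  nodup : ∀ ω, (order ω).Nodup
  mem_iff : ∀ ω e, e ∈ order ω ↔ e ∈ ω.1

/-- The set selected by the algorithm against an adversary. -/
noncomputable def Scheme.selected {n k T : ℕ} (A : Scheme) (M : Matroid (Fin n))
    (σ : AlmightyAdversary n k (coinSupply n T)) (ω : Outcome n k (coinSupply n T)) :
    Finset (Fin n) :=
  (A.play (env M ω.2.1 ω.2.2) T (σ.order ω)).2

/-- `γ`-selectability for `x` against the almighty adversary, with `k` samples from `D(x)`: every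
element that is active with positive probability is selected with conditional probability at
least `γ`, given that it is active. -/
def Scheme.Selectable {n : ℕ} (A : Scheme) (M : Matroid (Fin n)) (k T : ℕ) (x : Fin n → ℝ)
    (γ : ℝ) : Prop :=
  ∀ (σ : AlmightyAdversary n k (coinSupply n T)) (e : Fin n), 0 < x e →
    γ ≤ condProb x (fun ω => e ∈ A.selected M σ ω) (fun ω => e ∈ ω.1)

end OCRS

/-!
The scheme first thins: every element of the active set and of every sample is kept with
probability one half, so that all these random sets have the law `D(x/2)`. From the thinned samples
the setup computes a chain `univ = A₀ ⊇ A₁ ⊇ … ⊇ A_D` of subsets of the ground set. Each layer uses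
`m` fresh samples `T₁, …, T_m` and a random threshold `t`, and `A_{i+1}` is the hull of the layer:
the least set `X` that contains every `e ∈ A_i` which is spanned by `(T_j ∩ A_i ∪ X) \ {e}` for more
than `t` of the indices `j`. The level of an element is the number of layers that it survives.
Arriving elements of level at least `D`, or not kept by their coin, are discarded; any other element
is selected if and only if it is not spanned by the elements of higher levels together with the
selected elements of its own level. The selected elements of each level are thus independent in the
contraction of the elements of higher levels, which makes the selection feasible
(`indep_admitted`). Moreover `e` is selected in any order of the arrivals if it is kept, leaves the
chain at some layer `i < D`, and is not *blocked* there, that is, not spanned by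
`(R ∩ A_i ∪ A_{i+1}) \ {e}`, where `R` is the thinned active set (`mem_admitted`). This criterion
does not mention the order, so the power of the adversary is of no importance.

Three estimates bound the probability of failure.

* The exchange argument (`expect_blocked_le`). In a layer, the set `R` and the `m` samples are
  exchangeable. The hulls of all `m + 1` sets with thresholds `t + 1` and `t` enclose the hull that
  omits one of them. If `e` is outside of the larger one, at most `t` of the `m + 1` sets can block
  it, so that exchangeability gives a factor `t / (m + 1)`. In the remaining case, `t` is the one
  threshold at which `e` leaves the hull of all sets. The threshold is `t₀` plus a truncated
  geometric variable with small success probability, which makes this event unlikely compared to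
  `e` leaving (`LowHazard`). So being blocked is at most about `1/2` times as likely as leaving, when
  `m` is about `2 * t₀`.
* The rank drop (`mul_rk_hull_le`, `expect_rk_layerHull_le`). A potential argument gives
  `t * r(A_{i+1}) ≤ ∑ j, r(T_j ∩ A_i)`, and `E r(T_j ∩ A_i) ≤ x(A_i) / 2 ≤ r(A_i) / 2` for `x` in
  the matroid polytope. So the expected rank decreases by a constant factor `q < 1` in every layer,
  and `D = O(log ρ)` layers suffice to make it unlikely that `e` survives all of them.
* Summation over the layers (`expect_not_succeeds_le`). As `e` leaves at most once, the factors
  `1/2` do not add up over the layers, while the truncation errors of the geometric variables do; a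
  truncation at `K = O(log D)` makes their sum small.

Together, a kept active element is selected with probability at least `1/2 - 2ε`, and being kept
costs a factor `1/2`. The number of samples is `D * m` with `m = O(K)`, which is
`O(log ρ * log log ρ)`, and even less than required.

All probabilities are finite sums; `Push` transports expectations along the map from outcomes to the
thinned sets, and `push_choices` states that the choices of the algorithm are independent. The
program is treated with a small program logic: `Exec` for termination with a time bound, `Frame` for
what a program leaves unchanged, and a rule for loops (`exec_forLoop`). The memory is organized as
follows. Variable `0` is `n`, `1` the arriving element, `2` the answer, `11`, `12` and `13` are the
numbers `D`, `K` and `m`, `14` is the threshold, and `20` the index of the next sample; the others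
are counters and temporary values. Array `0` holds the levels, `1` the coins for the active
elements, `2` the selected elements, `3` and `4` the sets for the oracle, `5` the thinned samples of
a layer, `6` the hull under construction, and `7` the current set of the chain.
-/

namespace OCRS


/-! ### Reasoning about programs -/

@[simp] lemma Memory.setVar_var (s : Memory) (v x w : ℕ) :
    (s.setVar v x).var w = if w = v then x else s.var w := by
  simp [Memory.setVar, Function.update_apply]

@[simp] lemma Memory.setVar_arr (s : Memory) (v x : ℕ) : (s.setVar v x).arr = s.arr := rfl

@[simp] lemma Memory.setVar_coinsUsed (s : Memory) (v x : ℕ) :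
    (s.setVar v x).coinsUsed = s.coinsUsed := rfl

@[simp] lemma Memory.setArr_var (s : Memory) (a i x : ℕ) : (s.setArr a i x).var = s.var := rfl

@[simp] lemma Memory.setArr_coinsUsed (s : Memory) (a i x : ℕ) :
    (s.setArr a i x).coinsUsed = s.coinsUsed := rfl

@[simp] lemma Memory.setArr_arr (s : Memory) (a i x b j : ℕ) :
    (s.setArr a i x).arr b j = if b = a ∧ j = i then x else s.arr b j := by
  by_cases hb : b = a
  · subst hb; simp [Memory.setArr, Function.update_apply]
  · simp [Memory.setArr, hb]

/-- The variables that a program may write. -/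
def Prog.vars : Prog → List ℕ
  | .assign v _ => [v]
  | .store _ _ _ => []
  | .seq p q => p.vars ++ q.vars
  | .branch _ p q => p.vars ++ q.vars
  | .loop _ p => p.vars
  | .flip v => [v]
  | .query v _ => [v]
  | .look v _ _ => [v]

/-- The arrays that a program may write. -/
def Prog.arrs : Prog → List ℕ
  | .assign _ _ => []
  | .store a _ _ => [a]
  | .seq p q => p.arrs ++ q.arrs
  | .branch _ p q => p.arrs ++ q.arrs
  | .loop _ p => p.arrs
  | .flip _ => []
  | .query _ _ => []
  | .look _ _ _ => []

/-- Whether a program may consume coins. -/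
def Prog.flips : Prog → Bool
  | .assign _ _ => false
  | .store _ _ _ => false
  | .seq p q => p.flips || q.flips
  | .branch _ p q => p.flips || q.flips
  | .loop _ p => p.flips
  | .flip _ => true
  | .query _ _ => false
  | .look _ _ _ => false

/-- `s'` agrees with `s` on everything that the program `p` cannot modify. -/
structure Frame (p : Prog) (s s' : Memory) : Prop where
  var : ∀ v, v ∉ p.vars → s'.var v = s.var v
  arr : ∀ a, a ∉ p.arrs → s'.arr a = s.arr a
  coins : p.flips = false → s'.coinsUsed = s.coinsUsed

lemma Frame.trans {p : Prog} {s₁ s₂ s₃ : Memory} (h : Frame p s₁ s₂) (h' : Frame p s₂ s₃) :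
    Frame p s₁ s₃ :=
  ⟨fun v hv => (h'.var v hv).trans (h.var v hv), fun a ha => (h'.arr a ha).trans (h.arr a ha),
    fun hf => (h'.coins hf).trans (h.coins hf)⟩

variable {n : ℕ} {E : Env n}

lemma step_var (v : ℕ) (c : Config) (h : ∀ p ∈ c.1, v ∉ p.vars) :
    (∀ p ∈ (step E c).1, v ∉ p.vars) ∧ (step E c).2.var v = c.2.var v := by
  rcases c with ⟨_ | ⟨p, K⟩, s⟩
  · simp [step]
  · have hK : ∀ q ∈ K, v ∉ q.vars := fun q hq => h q (List.mem_cons_of_mem _ hq)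
    have hp := h p List.mem_cons_self
    cases p <;> simp only [step, Prog.vars, List.mem_append, not_or, List.mem_singleton] at hp ⊢
    case loop e p => split_ifs <;> simp_all [Prog.vars]
    case branch e p q => split_ifs <;> simp_all
    all_goals simp_all

lemma step_arr (a : ℕ) (c : Config) (h : ∀ p ∈ c.1, a ∉ p.arrs) :
    (∀ p ∈ (step E c).1, a ∉ p.arrs) ∧ (step E c).2.arr a = c.2.arr a := by
  rcases c with ⟨_ | ⟨p, K⟩, s⟩
  · simp [step]
  · have hK : ∀ q ∈ K, a ∉ q.arrs := fun q hq => h q (List.mem_cons_of_mem _ hq)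
    have hp := h p List.mem_cons_self
    cases p <;> simp only [step, Prog.arrs, List.mem_append, not_or, List.mem_singleton] at hp ⊢
    case loop e p => split_ifs <;> simp_all [Prog.arrs]
    case branch e p q => split_ifs <;> simp_all
    case store b i e => exact ⟨hK, by funext j; simp [hp]⟩
    all_goals simp_all

lemma step_coins (c : Config) (h : ∀ p ∈ c.1, p.flips = false) :
    (∀ p ∈ (step E c).1, p.flips = false) ∧ (step E c).2.coinsUsed = c.2.coinsUsed := by
  rcases c with ⟨_ | ⟨p, K⟩, s⟩
  · simp [step]
  · have hK : ∀ q ∈ K, q.flips = false := fun q hq => h q (List.mem_cons_of_mem _ hq)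
    have hp := h p List.mem_cons_self
    cases p <;> simp only [step, Prog.flips, Bool.or_eq_false_iff] at hp ⊢
    case loop e p => split_ifs <;> simp_all [Prog.flips]
    case branch e p q => split_ifs <;> simp_all
    all_goals simp_all

lemma iterate_step_var (v t : ℕ) (c : Config) (h : ∀ p ∈ c.1, v ∉ p.vars) :
    ((step E)^[t] c).2.var v = c.2.var v := by
  induction t generalizing c with
  | zero => rfl
  | succ t ih =>
    rw [Function.iterate_succ_apply, ih _ (step_var v c h).1, (step_var v c h).2]

lemma iterate_step_arr (a t : ℕ) (c : Config) (h : ∀ p ∈ c.1, a ∉ p.arrs) :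
    ((step E)^[t] c).2.arr a = c.2.arr a := by
  induction t generalizing c with
  | zero => rfl
  | succ t ih =>
    rw [Function.iterate_succ_apply, ih _ (step_arr a c h).1, (step_arr a c h).2]

lemma iterate_step_coins (t : ℕ) (c : Config) (h : ∀ p ∈ c.1, p.flips = false) :
    ((step E)^[t] c).2.coinsUsed = c.2.coinsUsed := by
  induction t generalizing c with
  | zero => rfl
  | succ t ih =>
    rw [Function.iterate_succ_apply, ih _ (step_coins c h).1, (step_coins c h).2]

/-- The program `p`, started in memory `s`, halts in memory `s'` after at most `T` steps, whatever
remains to be executed afterwards. -/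
def Exec (E : Env n) (p : Prog) (s : Memory) (T : ℕ) (s' : Memory) : Prop :=
  ∃ t ≤ T, ∀ K, (step E)^[t] (p :: K, s) = (K, s')

namespace Exec

variable {p q : Prog} {s s₁ s₂ s' : Memory} {T T₁ T₂ : ℕ}

lemma mono (h : Exec E p s T₁ s') (hT : T₁ ≤ T₂) : Exec E p s T₂ s' :=
  let ⟨t, ht, h⟩ := h
  ⟨t, ht.trans hT, h⟩

lemma frame (h : Exec E p s T s') : Frame p s s' := by
  obtain ⟨t, -, h⟩ := h
  have h := h []
  refine ⟨fun v hv => ?_, fun a ha => ?_, fun hf => ?_⟩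
  · simpa [h] using iterate_step_var (E := E) v t ([p], s) (by simpa using hv)
  · simpa [h] using iterate_step_arr (E := E) a t ([p], s) (by simpa using ha)
  · simpa [h] using iterate_step_coins (E := E) t ([p], s) (by simpa using hf)

lemma iterate_eq (h : Exec E p s T s') : (step E)^[T] ([p], s) = ([], s') := by
  obtain ⟨t, ht, h⟩ := h
  obtain ⟨u, rfl⟩ := Nat.exists_eq_add_of_le' ht
  rw [Function.iterate_add_apply, h]
  exact Function.iterate_fixed rfl u

lemma haltsWithin (h : Exec E p s T s') : HaltsWithin E T p s := by
  simp [HaltsWithin, h.iterate_eq]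

lemma run_eq (h : Exec E p s T s') : run E T p s = s' := by
  simp [run, h.iterate_eq]

lemma assign (v : ℕ) (e : Expr) : Exec E (.assign v e) s 1 (s.setVar v (e.eval s)) :=
  ⟨1, le_rfl, fun _ => rfl⟩

lemma store (a : ℕ) (i e : Expr) : Exec E (.store a i e) s 1 (s.setArr a (i.eval s) (e.eval s)) :=
  ⟨1, le_rfl, fun _ => rfl⟩

lemma flip (v : ℕ) : Exec E (.flip v) s 1
    { s.setVar v (E.coin s.coinsUsed).toNat with coinsUsed := s.coinsUsed + 1 } :=
  ⟨1, le_rfl, fun _ => rfl⟩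

open Classical in
lemma query (v a : ℕ) : Exec E (.query v a) s 1
    (s.setVar v (if E.indep {i : Fin n | s.arr a i ≠ 0} then 1 else 0)) :=
  ⟨1, le_rfl, fun _ => by simp [step]⟩

open Classical in
lemma look (v : ℕ) (j e : Expr) : Exec E (.look v j e) s 1
    (s.setVar v (if E.sample (j.eval s) (e.eval s) then 1 else 0)) :=
  ⟨1, le_rfl, fun _ => by simp [step]⟩

lemma seq (h₁ : Exec E p s T₁ s₁) (h₂ : Exec E q s₁ T₂ s₂) :
    Exec E (.seq p q) s (T₁ + T₂ + 1) s₂ := by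
  obtain ⟨t₁, ht₁, h₁⟩ := h₁
  obtain ⟨t₂, ht₂, h₂⟩ := h₂
  refine ⟨t₂ + (t₁ + 1), by lia, fun K => ?_⟩
  rw [Function.iterate_add_apply, Function.iterate_succ_apply]
  simp only [step, h₁, h₂]

lemma branch_pos {e : Expr} (he : e.eval s ≠ 0) (h : Exec E p s T s') :
    Exec E (.branch e p q) s (T + 1) s' := by
  obtain ⟨t, ht, h⟩ := h
  exact ⟨t + 1, by lia, fun K => by rw [Function.iterate_succ_apply]; simp [step, he, h]⟩

lemma branch_neg {e : Expr} (he : e.eval s = 0) (h : Exec E q s T s') :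
    Exec E (.branch e p q) s (T + 1) s' := by
  obtain ⟨t, ht, h⟩ := h
  exact ⟨t + 1, by lia, fun K => by rw [Function.iterate_succ_apply]; simp [step, he, h]⟩

lemma loop_pos {e : Expr} (he : e.eval s ≠ 0) (h₁ : Exec E p s T₁ s₁)
    (h₂ : Exec E (.loop e p) s₁ T₂ s₂) : Exec E (.loop e p) s (T₁ + T₂ + 1) s₂ := by
  obtain ⟨t₁, ht₁, h₁⟩ := h₁
  obtain ⟨t₂, ht₂, h₂⟩ := h₂
  refine ⟨t₂ + (t₁ + 1), by lia, fun K => ?_⟩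
  rw [Function.iterate_add_apply, Function.iterate_succ_apply]
  simp [step, he, h₁, h₂]

lemma loop_neg {e : Expr} (he : e.eval s = 0) : Exec E (.loop e p) s 1 s :=
  ⟨1, le_rfl, fun _ => by simp [step, he]⟩

end Exec

/-- The program that does nothing of interest: it writes to a scratch variable. -/
def skip : Prog := .assign 9 (.lit 0)

/-- `for v < b do p`, where `b` is an expression that is evaluated again in every round. -/
def forLoop (v : ℕ) (b : Expr) (p : Prog) : Prog :=
  .seq (.assign v (.lit 0))
    (.loop (.sub b (.var v)) (.seq p (.assign v (.add (.var v) (.lit 1)))))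

@[simp] lemma forLoop_vars (v : ℕ) (b : Expr) (p : Prog) :
    (forLoop v b p).vars = [v] ++ (p.vars ++ [v]) := rfl

@[simp] lemma forLoop_arrs (v : ℕ) (b : Expr) (p : Prog) :
    (forLoop v b p).arrs = [] ++ (p.arrs ++ []) := rfl

@[simp] lemma forLoop_flips (v : ℕ) (b : Expr) (p : Prog) :
    (forLoop v b p).flips = (false || (p.flips || false)) := rfl

/-- The rule for `for` loops: the invariant `I i` holds before round `i`. The frame of the
whole loop is available in every round, and the bound has to evaluate to the same number `B` on all
memories that agree with the first one outside of this frame. -/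
theorem exec_forLoop {v : ℕ} {b : Expr} {p : Prog} {s : Memory} {T : ℕ} (B : ℕ)
    (I : ℕ → Memory → Prop) (hv : v ∉ p.vars)
    (hb : ∀ s', Frame (forLoop v b p) s s' → b.eval s' = B)
    (h0 : I 0 (s.setVar v 0))
    (hstep : ∀ i s', i < B → s'.var v = i → Frame (forLoop v b p) s s' → I i s' →
      ∃ s'', Exec E p s' T s'' ∧ I (i + 1) (s''.setVar v (i + 1))) :
    ∃ s', Exec E (forLoop v b p) s (B * (T + 3) + 3) s' ∧ I B s' := by
  have key : ∀ k i s', i + k = B → s'.var v = i → Frame (forLoop v b p) s s' → I i s' →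
      ∃ s'', Exec E (.loop (.sub b (.var v)) (.seq p (.assign v (.add (.var v) (.lit 1))))) s'
        (k * (T + 3) + 1) s'' ∧ I B s'' := by
    intro k
    induction k with
    | zero =>
      intro i s' hi hs hf hI
      refine ⟨s', (Exec.loop_neg ?_).mono (by lia), by simpa [← hi] using hI⟩
      simp [Expr.eval, hb s' hf, hs]; lia
    | succ k ih =>
      intro i s' hi hs hf hI
      obtain ⟨s₁, h₁, hI₁⟩ := hstep i s' (by lia) hs hf hI
      have hv₁ : s₁.var v = i := (h₁.frame.var v hv).trans hs
      have h₂ : Exec E (.seq p (.assign v (.add (.var v) (.lit 1)))) s' (T + 2)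
          (s₁.setVar v (i + 1)) := by
        have := h₁.seq (Exec.assign (E := E) v (.add (.var v) (.lit 1)))
        simpa [Expr.eval, hv₁] using this
      have hf₂ : Frame (forLoop v b p) s' (s₁.setVar v (i + 1)) := by
        refine ⟨fun w hw => h₂.frame.var w ?_, fun a ha => h₂.frame.arr a ?_,
          fun h => h₂.frame.coins ?_⟩
        · simp only [forLoop_vars, List.mem_append, not_or, Prog.vars] at hw ⊢; tauto
        · simpa [Prog.arrs] using ha
        · simpa [Prog.flips] using h
      obtain ⟨s₃, h₃, hI₃⟩ := ih (i + 1) _ (by lia) (by simp) (hf.trans hf₂) hI₁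
      refine ⟨s₃, (Exec.loop_pos ?_ h₂ h₃).mono (by ring_nf; lia), hI₃⟩
      simp [Expr.eval, hb s' hf, hs]; lia
  obtain ⟨s', h', hI⟩ := key B 0 (s.setVar v 0) (by simp) (by simp)
    ⟨fun w hw => by
      have : w ≠ v := by rintro rfl; simp at hw
      simp [this], fun a _ => rfl, fun _ => rfl⟩ h0
  exact ⟨s', ((Exec.assign (E := E) v (.lit 0)).seq h').mono (by lia), hI⟩

/-! ### Hulls with respect to families of sets -/

section Hull

variable {α ι κ : Type*} {M : Matroid α} {A X Y : Set α} {T : ι → Set α} {J J' : Finset ι}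
  {t t' : ℕ} {e : α}

open Classical in
/-- More than `t` of the sets `T j ∩ A`, `j ∈ J`, span `e` together with `X` and without the help
of `e` itself. -/
def Eligible (M : Matroid α) (A : Set α) (T : ι → Set α) (J : Finset ι) (t : ℕ) (X : Set α)
    (e : α) : Prop :=
  t < (J.filter fun j => e ∈ M.closure ((T j ∩ A ∪ X) \ {e})).card

/-- The least set `X` that contains all elements of `A` that are eligible with respect to `X`. -/
def hull (M : Matroid α) (A : Set α) (T : ι → Set α) (J : Finset ι) (t : ℕ) : Set α :=
  ⋂₀ {X | ∀ e ∈ A, Eligible M A T J t X e → e ∈ X}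

lemma Eligible.mono (h : Eligible M A T J t X e) (hXY : X ⊆ Y) : Eligible M A T J t Y e := by
  classical
  refine lt_of_lt_of_le h (Finset.card_le_card fun j => ?_)
  simp only [Finset.mem_filter]
  exact fun hj => ⟨hj.1, M.closure_subset_closure
    (Set.sdiff_subset_sdiff_left (Set.union_subset_union_right _ hXY)) hj.2⟩

lemma Eligible.mono_index (h : Eligible M A T J t X e) (hJ : J ⊆ J') :
    Eligible M A T J' t X e := by
  classical
  exact lt_of_lt_of_le h (Finset.card_le_card (Finset.filter_subset_filter _ hJ))

lemma Eligible.erase [DecidableEq ι] (h : Eligible M A T J (t + 1) X e) (j : ι) :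
    Eligible M A T (J.erase j) t X e := by
  classical
  unfold Eligible at *
  rw [Finset.filter_erase]
  have := Finset.pred_card_le_card_erase (a := j)
    (s := J.filter fun j => e ∈ M.closure ((T j ∩ A ∪ X) \ {e}))
  lia

lemma hull_subset_of_closed (h : ∀ e ∈ A, Eligible M A T J t X e → e ∈ X) :
    hull M A T J t ⊆ X := Set.sInter_subset_of_mem h

lemma hull_subset : hull M A T J t ⊆ A := hull_subset_of_closed fun _ he _ => he

lemma hull_closed (he : e ∈ A) (h : Eligible M A T J t (hull M A T J t) e) :
    e ∈ hull M A T J t :=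
  Set.mem_sInter.2 fun _ hX => hX e he (h.mono (hull_subset_of_closed hX))

lemma hull_mono_index (hJ : J ⊆ J') : hull M A T J t ⊆ hull M A T J' t :=
  hull_subset_of_closed fun _ he h => hull_closed he (h.mono_index hJ)

lemma hull_succ_subset_hull_erase [DecidableEq ι] (j : ι) :
    hull M A T J (t + 1) ⊆ hull M A T (J.erase j) t :=
  hull_subset_of_closed fun _ he h => hull_closed he (h.erase j)

lemma hull_anti (h : t ≤ t') : hull M A T J t' ⊆ hull M A T J t :=
  hull_subset_of_closed fun _ he h' => hull_closed he (lt_of_le_of_lt h h')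

lemma hull_comp (f : κ ↪ ι) (J : Finset κ) :
    hull M A (T ∘ f) J t = hull M A T (J.map f) t := by
  classical
  unfold hull Eligible
  simp only [Finset.filter_map, Finset.card_map]
  rfl

lemma hull_congr {T' : ι → Set α} (h : ∀ j ∈ J, T j ∩ A = T' j ∩ A) :
    hull M A T J t = hull M A T' J t := by
  classical
  have key : ∀ X e, Eligible M A T J t X e ↔ Eligible M A T' J t X e := fun X e => by
    unfold Eligible
    rw [Finset.filter_congr fun j hj => by rw [h j hj]]
  simp only [hull, key]

/-- The rank of a set, as a natural number. -/
noncomputable def rk (M : Matroid α) (X : Set α) : ℕ := (M.eRk X).toNat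

lemma rk_insert_of_mem_closure (h : e ∈ M.closure X) : rk M (insert e X) = rk M X := by
  unfold rk
  rw [← M.eRk_closure_eq (insert e X), M.closure_insert_eq_of_mem_closure h, M.eRk_closure_eq]

section Finite

variable [Finite α]

lemma coe_rk (M : Matroid α) (X : Set α) : (rk M X : ℕ∞) = M.eRk X :=
  ENat.natCast_toNat (M.eRk_ne_top_iff.2 (M.isRkFinite_of_finite X.toFinite))

lemma rk_mono (M : Matroid α) (h : X ⊆ Y) : rk M X ≤ rk M Y := by
  have := M.eRk_mono h
  rw [← coe_rk, ← coe_rk] at this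
  exact_mod_cast this

lemma rk_insert_le (M : Matroid α) (e : α) (X : Set α) : rk M (insert e X) ≤ rk M X + 1 := by
  have := M.eRk_insert_le_add_one e X
  rw [← coe_rk, ← coe_rk] at this
  exact_mod_cast this

lemma rk_insert_of_notMem_closure (hE : e ∈ M.E) (h : e ∉ M.closure X) :
    rk M (insert e X) = rk M X + 1 := by
  have := M.eRk_insert_eq_add_one ⟨hE, h⟩
  rw [← coe_rk, ← coe_rk] at this
  exact_mod_cast this

/-- The potential argument that bounds the rank of the hull: along any sequence of eligible
elements, every unit of rank that is gained by `X` is gained by at most `|J| - t` of the sets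
`T j ∪ X`. -/
lemma mul_rk_hull_le (M : Matroid α) (hE : M.E = Set.univ) (A : Set α) (T : ι → Set α)
    (J : Finset ι) (t : ℕ) :
    t * rk M (hull M A T J t) ≤ ∑ j ∈ J, rk M (T j ∩ A) := by
  classical
  let Good : Set α → Prop := fun X => X ⊆ hull M A T J t ∧
    ∑ j ∈ J, rk M (T j ∩ A ∪ X) + t * rk M X ≤ ∑ j ∈ J, rk M (T j ∩ A) + J.card * rk M X
  have h0 : Good ∅ := ⟨by simp, by simp [rk]⟩
  obtain ⟨X, hX, hmax⟩ := (Set.toFinite {X | Good X}).exists_maximal ⟨∅, h0⟩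
  have hXeq : X = hull M A T J t := by
    refine hX.1.antisymm (hull_subset_of_closed fun e he hel => ?_)
    by_contra heX
    refine heX (hmax (y := insert e X) ⟨?_, ?_⟩ (Set.subset_insert e X) (Set.mem_insert e X))
    · exact Set.insert_subset (hull_closed he (hel.mono hX.1)) hX.1
    by_cases hcl : e ∈ M.closure X
    · have : ∀ j, rk M (T j ∩ A ∪ insert e X) = rk M (T j ∩ A ∪ X) := fun j => by
        rw [Set.union_insert]
        exact rk_insert_of_mem_closure (M.closure_subset_closure Set.subset_union_right hcl)
      simpa only [this, rk_insert_of_mem_closure hcl] using hX.2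
    · rw [rk_insert_of_notMem_closure (by simp [hE]) hcl]
      have hle : ∀ j ∈ J, rk M (T j ∩ A ∪ insert e X) +
          (if e ∈ M.closure ((T j ∩ A ∪ X) \ {e}) then 1 else 0) ≤ rk M (T j ∩ A ∪ X) + 1 := by
        intro j _
        rw [Set.union_insert]
        split_ifs with h
        · rw [rk_insert_of_mem_closure (M.closure_subset_closure Set.sdiff_subset h)]
        · exact rk_insert_le _ _ _
      have hsum := Finset.sum_le_sum hle
      rw [Finset.sum_add_distrib, Finset.sum_add_distrib, Finset.sum_boole] at hsum
      simp only [Finset.sum_const, smul_eq_mul, mul_one, Nat.cast_id] at hsum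
      have hel' : t < (J.filter fun j => e ∈ M.closure ((T j ∩ A ∪ X) \ {e})).card := hel
      have := hX.2
      rw [mul_add, mul_add]
      lia
  rw [← hXeq]
  have h1 : J.card * rk M X ≤ ∑ j ∈ J, rk M (T j ∩ A ∪ X) := by
    rw [← smul_eq_mul, ← Finset.sum_const]
    exact Finset.sum_le_sum fun j _ => rk_mono M Set.subset_union_right
  have := hX.2
  lia

end Finite

end Hull

/-! ### The matroid polytope -/

section Polytope

variable {n : ℕ} {M : Matroid (Fin n)} {x : Fin n → ℝ}

lemma polytope_bounds (hx : x ∈ polytope M) (e : Fin n) : 0 ≤ x e ∧ x e ≤ 1 := by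
  have hconv : Convex ℝ {y : Fin n → ℝ | 0 ≤ y e ∧ y e ≤ 1} := by
    have : Convex ℝ ((LinearMap.proj e : (Fin n → ℝ) →ₗ[ℝ] ℝ) ⁻¹' Set.Icc 0 1) :=
      (convex_Icc (0 : ℝ) 1).linear_preimage _
    exact this
  refine convexHull_min ?_ hconv hx
  rintro _ ⟨I, -, rfl⟩
  by_cases h : e ∈ I <;> simp [h]

lemma sum_le_rk_of_mem_polytope (hx : x ∈ polytope M) (A : Finset (Fin n)) :
    ∑ e ∈ A, x e ≤ rk M A := by
  have hconv : Convex ℝ {y : Fin n → ℝ | ∑ e ∈ A, y e ≤ rk M A} := by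
    have : Convex ℝ ((∑ e ∈ A, LinearMap.proj e : (Fin n → ℝ) →ₗ[ℝ] ℝ) ⁻¹'
        Set.Iic (rk M A : ℝ)) := (convex_Iic _).linear_preimage _
    simpa [Set.preimage, LinearMap.sum_apply] using this
  refine convexHull_min ?_ hconv hx
  rintro _ ⟨I, hI, rfl⟩
  classical
  have h1 : ∑ e ∈ A, I.indicator (fun _ => (1 : ℝ)) e = ((A.filter (· ∈ I)).card : ℝ) := by
    simp [Set.indicator_apply, Finset.sum_boole]
  have h2 := (hI.subset (fun e he => (Finset.mem_filter.1 he).2 :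
    ((A.filter (· ∈ I) : Finset (Fin n)) : Set (Fin n)) ⊆ I)).encard_le_eRk_of_subset
    (X := (A : Set (Fin n))) (by intro e he; simp at he ⊢; exact he.1)
  rw [Set.encard_coe_eq_coe_finsetCard, ← coe_rk] at h2
  simp only [Set.mem_ofPred_eq, h1]
  exact_mod_cast h2

lemma one_le_rk_of_mem (hx : x ∈ polytope M) {e : Fin n} (he : 0 < x e) {A : Set (Fin n)}
    (hA : e ∈ A) : 1 ≤ rk M A := by
  have h := sum_le_rk_of_mem_polytope hx {e}
  have h2 : rk M (({e} : Finset (Fin n)) : Set (Fin n)) ≤ rk M A := rk_mono M (by simpa using hA)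
  have h3 : (0 : ℝ) < rk M A := by
    have : (rk M (({e} : Finset (Fin n)) : Set (Fin n)) : ℝ) ≤ rk M A := by exact_mod_cast h2
    simp only [Finset.sum_singleton] at h
    linarith
  exact_mod_cast h3

end Polytope

/-! ### Expectations over finite probability spaces -/

section Expectation

variable {Ω Ω' Ω'' ι κ : Type*} [Fintype Ω] [Fintype Ω'] [Fintype Ω''] [Fintype ι] [Fintype κ]

/-- Nonnegative weights on a finite type that add up to one. -/
structure IsProb (w : Ω → ℝ) : Prop where
  nonneg : ∀ a, 0 ≤ w a
  sum_eq_one : ∑ a, w a = 1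

/-- The expectation of `f` with respect to the weights `w`. -/
def expect (w : Ω → ℝ) (f : Ω → ℝ) : ℝ := ∑ a, w a * f a

open Classical in
/-- The indicator of a proposition. -/
noncomputable def ind (p : Prop) : ℝ := if p then 1 else 0

/-- The weights of the product of two probability spaces. -/
def prodWeight (w : Ω → ℝ) (w' : Ω' → ℝ) : Ω × Ω' → ℝ := fun a => w a.1 * w' a.2

/-- The weights of a power of a probability space. -/
def powWeight (ι : Type*) [Fintype ι] (w : Ω → ℝ) : (ι → Ω) → ℝ := fun a => ∏ i, w (a i)

lemma ind_nonneg (p : Prop) : 0 ≤ ind p := by unfold ind; split_ifs <;> simp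

lemma ind_le_one (p : Prop) : ind p ≤ 1 := by unfold ind; split_ifs <;> simp

lemma ind_of_true {p : Prop} (h : p) : ind p = 1 := by simp [ind, h]

lemma ind_of_false {p : Prop} (h : ¬p) : ind p = 0 := by simp [ind, h]

lemma ind_mono {p q : Prop} (h : p → q) : ind p ≤ ind q := by
  by_cases hp : p
  · rw [ind_of_true hp, ind_of_true (h hp)]
  · rw [ind_of_false hp]; exact ind_nonneg q

lemma ind_not (p : Prop) : ind (¬p) = 1 - ind p := by
  by_cases hp : p <;> simp [ind, hp]

lemma expect_add (w f g : Ω → ℝ) :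
    expect w (fun a => f a + g a) = expect w f + expect w g := by
  simp [expect, mul_add, Finset.sum_add_distrib]

lemma expect_mul_left (w f : Ω → ℝ) (c : ℝ) :
    expect w (fun a => c * f a) = c * expect w f := by
  simp only [expect, Finset.mul_sum]
  exact Finset.sum_congr rfl fun _ _ => by ring

lemma expect_sum {α : Type*} (w : Ω → ℝ) (s : Finset α) (f : α → Ω → ℝ) :
    expect w (fun a => ∑ i ∈ s, f i a) = ∑ i ∈ s, expect w (f i) := by
  simp only [expect, Finset.mul_sum]
  exact Finset.sum_comm

lemma IsProb.expect_const {w : Ω → ℝ} (hw : IsProb w) (c : ℝ) : expect w (fun _ => c) = c := by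
  rw [expect, ← Finset.sum_mul, hw.sum_eq_one, one_mul]

lemma IsProb.expect_mono {w : Ω → ℝ} (hw : IsProb w) {f g : Ω → ℝ} (h : ∀ a, f a ≤ g a) :
    expect w f ≤ expect w g :=
  Finset.sum_le_sum fun a _ => mul_le_mul_of_nonneg_left (h a) (hw.nonneg a)

lemma IsProb.expect_nonneg {w : Ω → ℝ} (hw : IsProb w) {f : Ω → ℝ} (h : ∀ a, 0 ≤ f a) :
    0 ≤ expect w f := Finset.sum_nonneg fun a _ => mul_nonneg (hw.nonneg a) (h a)

lemma expect_prodWeight (w : Ω → ℝ) (w' : Ω' → ℝ) (f : Ω × Ω' → ℝ) :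
    expect (prodWeight w w') f = expect w fun a => expect w' fun b => f (a, b) := by
  simp only [expect, prodWeight, Fintype.sum_prod_type, Finset.mul_sum, mul_assoc]

lemma expect_comm (w : Ω → ℝ) (w' : Ω' → ℝ) (f : Ω → Ω' → ℝ) :
    expect w (fun a => expect w' fun b => f a b) =
      expect w' fun b => expect w fun a => f a b := by
  simp only [expect, Finset.mul_sum]
  rw [Finset.sum_comm]
  exact Finset.sum_congr rfl fun _ _ => Finset.sum_congr rfl fun _ _ => by ring

lemma IsProb.prod {w : Ω → ℝ} {w' : Ω' → ℝ} (hw : IsProb w) (hw' : IsProb w') :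
    IsProb (prodWeight w w') := by
  refine ⟨fun a => mul_nonneg (hw.nonneg _) (hw'.nonneg _), ?_⟩
  have := expect_prodWeight w w' fun _ => 1
  simpa [expect, ← Finset.mul_sum, hw.sum_eq_one, hw'.sum_eq_one] using this

lemma sum_pi_prod [DecidableEq ι] (f : ι → Ω → ℝ) :
    ∑ a : ι → Ω, ∏ i, f i (a i) = ∏ i, ∑ b, f i b := by
  rw [Finset.prod_univ_sum, Fintype.piFinset_univ]

lemma IsProb.pow [DecidableEq ι] {w : Ω → ℝ} (hw : IsProb w) : IsProb (powWeight ι w) := by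
  refine ⟨fun a => Finset.prod_nonneg fun _ _ => hw.nonneg _, ?_⟩
  simp only [powWeight]
  rw [sum_pi_prod (fun (_ : ι) => w)]
  simp [hw.sum_eq_one]

lemma expect_powWeight_succ {m : ℕ} (w : Ω → ℝ) (f : (Fin (m + 1) → Ω) → ℝ) :
    expect (powWeight (Fin (m + 1)) w) f =
      expect w fun a => expect (powWeight (Fin m) w) fun b => f (Fin.cons a b) := by
  simp only [expect, Finset.mul_sum]
  rw [← (Fin.consEquiv fun _ => Ω).sum_comp, Fintype.sum_prod_type]
  refine Finset.sum_congr rfl fun _ _ => Finset.sum_congr rfl fun _ _ => ?_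
  simp [powWeight, Fin.prod_univ_succ, Fin.consEquiv, mul_assoc]

/-- The image of the weights `w` under `φ` is `w'`. -/
def Push (w : Ω → ℝ) (φ : Ω → Ω') (w' : Ω' → ℝ) : Prop :=
  ∀ f : Ω' → ℝ, expect w (fun a => f (φ a)) = expect w' f

lemma Push.comp {w : Ω → ℝ} {φ : Ω → Ω'} {w' : Ω' → ℝ} {ψ : Ω' → Ω''} {w'' : Ω'' → ℝ}
    (h : Push w φ w') (h' : Push w' ψ w'') : Push w (ψ ∘ φ) w'' := fun f =>
  (h fun b => f (ψ b)).trans (h' f)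

lemma Push.of_equiv (e : Ω ≃ Ω') {w : Ω → ℝ} {w' : Ω' → ℝ} (h : ∀ a, w a = w' (e a)) :
    Push w e w' := fun f => by
  simp only [expect, h]
  exact e.sum_comp fun b => w' b * f b

lemma Push.prodMap {κ κ' : Type*} [Fintype κ] [Fintype κ'] {w : Ω → ℝ} {φ : Ω → Ω'} {w' : Ω' → ℝ}
    {v : κ → ℝ} {ψ : κ → κ'} {v' : κ' → ℝ} (h : Push w φ w') (h' : Push v ψ v') :
    Push (prodWeight w v) (Prod.map φ ψ) (prodWeight w' v') := fun f => by
  rw [expect_prodWeight, expect_prodWeight]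
  simp only [Prod.map]
  rw [← h]
  congr 1
  ext a
  rw [← h']

lemma Push.fst {w : Ω → ℝ} {w' : Ω' → ℝ} (hw' : IsProb w') :
    Push (prodWeight w w') Prod.fst w := fun f => by
  simp only [expect_prodWeight, hw'.expect_const]

lemma Push.pi [DecidableEq ι] {w : ι → Ω → ℝ} {φ : Ω → Ω'} {w' : ι → Ω' → ℝ}
    (h : ∀ i, Push (w i) φ (w' i)) :
    Push (fun a : ι → Ω => ∏ i, w i (a i)) (fun a i => φ (a i)) (fun a => ∏ i, w' i (a i)) := by
  classical
  intro f
  have hfib : ∀ i b, w' i b = ∑ a, w i a * if b = φ a then 1 else 0 := fun i b => by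
    have := h i fun c => if b = c then 1 else 0
    simpa [expect] using this.symm
  simp only [expect, hfib]
  simp only [← sum_pi_prod, Finset.sum_mul]
  rw [Finset.sum_comm]
  refine Finset.sum_congr rfl fun a _ => ?_
  simp only [Finset.prod_mul_distrib]
  rw [Finset.sum_eq_single (fun i => φ (a i))]
  · simp
  · intro b _ hb
    obtain ⟨i, hi⟩ := Function.ne_iff.1 hb
    rw [Finset.prod_eq_zero (f := fun i => if b i = φ (a i) then (1 : ℝ) else 0)
      (Finset.mem_univ i) (by simp [hi])]
    simp
  · simp

lemma Push.pow [DecidableEq ι] {w : Ω → ℝ} {φ : Ω → Ω'} {w' : Ω' → ℝ} (h : Push w φ w') :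
    Push (powWeight ι w) (fun a i => φ (a i)) (powWeight ι w') :=
  Push.pi fun _ => h

/-- Coordinates that are not used can be dropped. -/
lemma Push.restrict [DecidableEq ι] [DecidableEq κ] {w : Ω → ℝ} (hw : IsProb w) {f : ι → κ}
    (hf : Function.Injective f) :
    Push (powWeight κ w) (fun a i => a (f i)) (powWeight ι w) := by
  classical
  intro g
  have h1 : ∀ b : ι → Ω, powWeight ι w b =
      ∑ a : κ → Ω, powWeight κ w a * if (fun i => a (f i)) = b then 1 else 0 := by
    intro b
    have h2 : ∀ a : κ → Ω, (powWeight κ w a * if (fun i => a (f i)) = b then 1 else 0) =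
        ∏ k, (w (a k) * if ∀ i, f i = k → a k = b i then 1 else 0) := by
      intro a
      rw [Finset.prod_mul_distrib, powWeight]
      congr 1
      by_cases h : (fun i => a (f i)) = b
      · rw [if_pos h, Finset.prod_eq_one]
        rintro k -
        rw [if_pos]
        rintro i rfl
        exact congrFun h i
      · rw [if_neg h]
        obtain ⟨i, hi⟩ := Function.ne_iff.1 h
        symm
        apply Finset.prod_eq_zero (Finset.mem_univ (f i))
        rw [if_neg]
        intro hh
        exact hi (hh i rfl)
    simp only [h2]
    rw [sum_pi_prod (fun k c => w c * if ∀ i, f i = k → c = b i then 1 else 0)]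
    refine Fintype.prod_of_injective f hf _ _ ?_ ?_
    · intro k hk
      have : ∀ c, (∀ i, f i = k → c = b i) := fun c i hi => absurd ⟨i, hi⟩ hk
      rw [Finset.sum_congr rfl fun c _ => by rw [if_pos (this c), mul_one], hw.sum_eq_one]
    · intro i
      rw [Finset.sum_eq_single (b i)]
      · simp only [hf.eq_iff]
        rw [if_pos (by rintro j rfl; rfl)]; simp
      · intro c _ hc
        rw [if_neg (by intro h; exact hc (h i rfl))]; simp
      · simp
  simp only [expect, h1, Finset.sum_mul]
  rw [Finset.sum_comm]
  refine Finset.sum_congr rfl fun a _ => ?_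
  simp

end Expectation

/-! ### One layer -/

section Layer

variable {α Ω H : Type*} [Fintype Ω] [Fintype H] {M : Matroid α} {A : Set α} {e : α}

/-- A random natural number `G ≤ K` with hazard rate at most `c`, apart from an additive error
`η`: for every `τ`, the event `G = τ` is unlikely compared to `G > τ`. -/
structure LowHazard (v : H → ℝ) (G : H → ℕ) (K : ℕ) (c η : ℝ) : Prop where
  le : ∀ h, G h ≤ K
  nonneg : 0 ≤ c
  nonneg' : 0 ≤ η
  hazard : ∀ τ, expect v (fun h => ind (G h = τ)) ≤ c * expect v (fun h => ind (τ < G h)) + η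

/-- The thresholds at which a fixed element leaves a decreasing family of sets are rarely hit by
a random threshold of low hazard rate. -/
lemma LowHazard.expect_jump_le {v : H → ℝ} {G : H → ℕ} {K : ℕ} {c η : ℝ} (hv : IsProb v)
    (hG : LowHazard v G K c η) (t₀ : ℕ) (f : ℕ → Prop) (hf : ∀ ⦃s t⦄, s ≤ t → f t → f s) :
    expect v (fun h => ind (f (t₀ + G h) ∧ ¬f (t₀ + G h + 1))) ≤
      c * expect v (fun h => ind (¬f (t₀ + G h))) + η := by
  have hn : 0 ≤ c * expect v (fun h => ind (¬f (t₀ + G h))) :=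
    mul_nonneg hG.nonneg (hv.expect_nonneg fun _ => ind_nonneg _)
  by_cases hex : ∃ τ, f (t₀ + τ) ∧ ¬f (t₀ + τ + 1)
  · obtain ⟨τ, hτ, hτ'⟩ := hex
    calc expect v (fun h => ind (f (t₀ + G h) ∧ ¬f (t₀ + G h + 1)))
        ≤ expect v (fun h => ind (G h = τ)) := by
          refine hv.expect_mono fun h => ind_mono fun ⟨h1, h2⟩ => ?_
          by_contra hne
          rcases lt_or_gt_of_ne hne with hlt | hlt
          · exact h2 (hf (by lia) hτ)
          · exact hτ' (hf (by lia) h1)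
      _ ≤ c * expect v (fun h => ind (τ < G h)) + η := hG.hazard τ
      _ ≤ _ := by
          gcongr
          · exact hG.nonneg
          · refine hv.expect_mono fun h => ind_mono fun hlt hfG => hτ' (hf (by lia) hfG)
  · push Not at hex
    have : ∀ h, ind (f (t₀ + G h) ∧ ¬f (t₀ + G h + 1)) = 0 := fun h =>
      ind_of_false fun ⟨h1, h2⟩ => h2 (hex _ h1)
    simp only [this, hv.expect_const]
    exact add_nonneg hn hG.nonneg'

/-- The set that is computed in a layer with ground set `A` from `m` samples and a threshold. -/
def layerHull (M : Matroid α) (Z : Ω → Set α) (G : H → ℕ) (t₀ : ℕ) {m : ℕ} (A : Set α)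
    (a : (Fin m → Ω) × H) : Set α :=
  hull M A (fun j => Z (a.1 j)) Finset.univ (t₀ + G a.2)

/-- The event that `e` leaves the chain at the layer with ground set `A` and next set `S`, but may
be blocked by the active elements in `R`. -/
def Blocked (M : Matroid α) (e : α) (R A S : Set α) : Prop :=
  e ∉ S ∧ e ∈ M.closure ((R ∩ A ∪ S) \ {e})

/-- The exchange argument. The active set and the `m` samples are exchangeable. The hull computed
from `m` of these `m + 1` sets lies between the hulls computed from all of them with thresholds
`t + 1` and `t`; so either `e` is outside of the latter hull, and then it is spanned by at most `t`
of the `m + 1` sets, or `t` is the threshold at which `e` leaves the hull of all sets. -/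
theorem expect_blocked_le {w : Ω → ℝ} (hw : IsProb w) {v : H → ℝ} (hv : IsProb v) {G : H → ℕ}
    {K : ℕ} {c η : ℝ} (hG : LowHazard v G K c η) (Z : Ω → Set α) (t₀ m : ℕ) (he : e ∈ A) :
    expect (prodWeight (powWeight (Fin m) w) v) (fun a => expect w fun R =>
        ind (Blocked M e (Z R) A (layerHull M Z G t₀ A a))) ≤
      ((t₀ + K : ℝ) / (m + 1) + c) *
        expect (prodWeight (powWeight (Fin m) w) v) (fun a => ind (e ∉ layerHull M Z G t₀ A a))
        + η := by
  classical
  set u := prodWeight (powWeight (Fin (m + 1)) w) v with hu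
  have hu' : IsProb u := hw.pow.prod hv
  let S : (Fin (m + 1) → Ω) → Finset (Fin (m + 1)) → ℕ → Set α := fun U J t =>
    hull M A (fun j => Z (U j)) J t
  let F : Fin (m + 1) → (Fin (m + 1) → Ω) × H → ℝ := fun j a =>
    ind (Blocked M e (Z (a.1 j)) A (S a.1 (Finset.univ.erase j) (t₀ + G a.2)))
  have hS0 : ∀ (R : Ω) (a : (Fin m → Ω) × H),
      S (Fin.cons R a.1) (Finset.univ.erase 0) (t₀ + G a.2) = layerHull M Z G t₀ A a := by
    intro R a
    have h1 : (Finset.univ.erase 0 : Finset (Fin (m + 1))) =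
        Finset.univ.map (Fin.succEmb m) := by
      ext j
      simp only [Finset.mem_erase, Finset.mem_univ, and_true, Finset.mem_map, true_and]
      constructor
      · intro hj; obtain ⟨i, rfl⟩ := Fin.exists_succ_eq.2 hj; exact ⟨i, rfl⟩
      · rintro ⟨i, rfl⟩; exact Fin.succ_ne_zero i
    simp only [S, layerHull]
    rw [h1, ← hull_comp]
    congr 1
  have hcons : ∀ f : (Fin (m + 1) → Ω) × H → ℝ, expect u f =
      expect (prodWeight (powWeight (Fin m) w) v) fun a => expect w fun R =>
        f (Fin.cons R a.1, a.2) := by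
    intro f
    rw [hu, expect_prodWeight, expect_powWeight_succ, expect_comm, expect_prodWeight]
    simp only [expect_comm w v]
  have hF0 : expect (prodWeight (powWeight (Fin m) w) v) (fun a => expect w fun R =>
      ind (Blocked M e (Z R) A (layerHull M Z G t₀ A a))) = expect u (F 0) := by
    rw [hcons]
    simp only [F, hS0, Fin.cons_zero]
  have hP0 : expect (prodWeight (powWeight (Fin m) w) v)
      (fun a => ind (e ∉ layerHull M Z G t₀ A a)) =
      expect u fun a => ind (e ∉ S a.1 (Finset.univ.erase 0) (t₀ + G a.2)) := by
    rw [hcons]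
    simp only [hS0, hw.expect_const]
  rw [hF0, hP0]
  -- all samples play the same role
  have hswap : ∀ j, expect u (F j) = expect u (F 0) := by
    intro j
    let σ : ((Fin (m + 1) → Ω) × H) ≃ ((Fin (m + 1) → Ω) × H) :=
      Equiv.prodCongr ((Equiv.swap 0 j).arrowCongr (Equiv.refl Ω)) (Equiv.refl H)
    have hpush : Push u σ u := Push.of_equiv σ fun a => by
      simp only [hu, prodWeight, powWeight, σ, Equiv.prodCongr_apply, Prod.map,
        Equiv.arrowCongr_apply, Equiv.coe_refl, Function.comp, id]
      rw [← Equiv.prod_comp (Equiv.swap 0 j).symm fun i => w (a.1 i)]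
    rw [← hpush (F 0)]
    congr 1
    ext a
    have h1 : (Finset.univ.erase j : Finset (Fin (m + 1))) =
        (Finset.univ.erase 0).map (Equiv.swap 0 j).toEmbedding := by
      rw [Finset.map_erase]; simp
    have h2 : S a.1 (Finset.univ.erase j) (t₀ + G a.2) =
        S (σ a).1 (Finset.univ.erase 0) (t₀ + G (σ a).2) := by
      simp only [S]
      rw [h1, ← hull_comp]
      congr 1
    simp only [F, h2]
    simp [σ]
  have hpoint : ∀ a : (Fin (m + 1) → Ω) × H, ∑ j, F j a ≤
      (t₀ + K) * ind (e ∉ S a.1 Finset.univ (t₀ + G a.2)) +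
      (m + 1) * ind (e ∈ S a.1 Finset.univ (t₀ + G a.2) ∧
        e ∉ S a.1 Finset.univ (t₀ + G a.2 + 1)) := by
    intro a
    set t := t₀ + G a.2 with ht
    have htK : (t : ℝ) ≤ t₀ + K := by
      rw [ht]; push_cast; gcongr; exact_mod_cast hG.le a.2
    by_cases h1 : e ∈ S a.1 Finset.univ t
    · rw [ind_of_false (p := e ∉ _) (by simpa using h1), mul_zero, zero_add]
      by_cases h2 : e ∈ S a.1 Finset.univ (t + 1)
      · have : ∀ j, F j a = 0 := fun j => ind_of_false fun h =>
          h.1 (hull_succ_subset_hull_erase j h2)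
        simp only [this, Finset.sum_const_zero]
        exact mul_nonneg (by positivity) (ind_nonneg _)
      · rw [ind_of_true ⟨h1, h2⟩]
        calc ∑ j, F j a ≤ ∑ j : Fin (m + 1), (1 : ℝ) :=
              Finset.sum_le_sum fun j _ => ind_le_one _
          _ = _ := by simp
    · rw [ind_of_true h1]
      have h3 : ¬Eligible M A (fun j => Z (a.1 j)) Finset.univ t (S a.1 Finset.univ t) e :=
        fun h => h1 (hull_closed he h)
      have h4 : ∑ j, F j a ≤ t := by
        calc ∑ j, F j a ≤ ∑ j : Fin (m + 1),
              ind (e ∈ M.closure ((Z (a.1 j) ∩ A ∪ S a.1 Finset.univ t) \ {e})) := by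
              refine Finset.sum_le_sum fun j _ => ind_mono fun h => ?_
              exact M.closure_subset_closure (Set.sdiff_subset_sdiff_left
                (Set.union_subset_union_right _ (hull_mono_index (Finset.erase_subset _ _)))) h.2
          _ ≤ t := by
              simp only [ind, Finset.sum_boole]
              unfold Eligible at h3
              exact_mod_cast not_lt.1 h3
      have h5 : 0 ≤ ((m : ℝ) + 1) * ind (e ∈ S a.1 Finset.univ t ∧
        e ∉ S a.1 Finset.univ (t + 1)) := mul_nonneg (by positivity) (ind_nonneg _)
      linarith
  have hjump : expect u (fun a => ind (e ∈ S a.1 Finset.univ (t₀ + G a.2) ∧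
        e ∉ S a.1 Finset.univ (t₀ + G a.2 + 1))) ≤
      c * expect u (fun a => ind (e ∉ S a.1 Finset.univ (t₀ + G a.2))) + η := by
    rw [hu, expect_prodWeight, expect_prodWeight, ← expect_mul_left,
      ← (hw.pow (ι := Fin (m + 1))).expect_const η, ← expect_add]
    refine hw.pow.expect_mono fun U => ?_
    exact hG.expect_jump_le hv t₀ (fun t => e ∈ S U Finset.univ t)
      fun s t hst h => hull_anti hst h
  have hsum : (m + 1) * expect u (F 0) = expect u (fun a => ∑ j, F j a) := by
    rw [expect_sum]
    simp [hswap]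
  have hmono : expect u (fun a => ind (e ∉ S a.1 Finset.univ (t₀ + G a.2))) ≤
      expect u (fun a => ind (e ∉ S a.1 (Finset.univ.erase 0) (t₀ + G a.2))) :=
    hu'.expect_mono fun a => ind_mono fun h h' =>
      h (hull_mono_index (Finset.erase_subset _ _) h')
  have hmain : (m + 1) * expect u (F 0) ≤
      (t₀ + K) * expect u (fun a => ind (e ∉ S a.1 Finset.univ (t₀ + G a.2))) +
      (m + 1) * (c * expect u (fun a => ind (e ∉ S a.1 Finset.univ (t₀ + G a.2))) + η) := by
    rw [hsum]
    refine (hu'.expect_mono hpoint).trans ?_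
    rw [expect_add, expect_mul_left, expect_mul_left]
    gcongr
  set P := expect u (fun a => ind (e ∉ S a.1 Finset.univ (t₀ + G a.2)))
  have hm : (0 : ℝ) < m + 1 := by positivity
  have : expect u (F 0) ≤ ((t₀ + K : ℝ) / (m + 1) + c) * P + η := by
    refine le_of_mul_le_mul_left (hmain.trans_eq ?_) hm
    field_simp
    ring
  refine this.trans ?_
  gcongr
  exact add_nonneg (by positivity) hG.nonneg

/-- On average, the rank of the chain drops by a constant factor in every layer. -/
theorem expect_rk_layerHull_le [Fintype α] (hE : M.E = Set.univ) {w : Ω → ℝ} (hw : IsProb w)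
    {v : H → ℝ} (hv : IsProb v) (G : H → ℕ) (Z : Ω → Set α) (t₀ m : ℕ) (A : Set α) {r : ℝ}
    (hr : expect w (fun a => (rk M (Z a ∩ A) : ℝ)) ≤ r) :
    t₀ * expect (prodWeight (powWeight (Fin m) w) v)
      (fun a => (rk M (layerHull M Z G t₀ A a) : ℝ)) ≤ m * r := by
  classical
  rw [← expect_mul_left]
  calc expect (prodWeight (powWeight (Fin m) w) v)
        (fun a => t₀ * (rk M (layerHull M Z G t₀ A a) : ℝ))
      ≤ expect (prodWeight (powWeight (Fin m) w) v)
        (fun a => ∑ j : Fin m, (rk M (Z (a.1 j) ∩ A) : ℝ)) := by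
        refine (hw.pow.prod hv).expect_mono fun a => ?_
        have h1 := mul_rk_hull_le M hE A (fun j => Z (a.1 j)) Finset.univ (t₀ + G a.2)
        have h2 : t₀ * rk M (layerHull M Z G t₀ A a) ≤ ∑ j : Fin m, rk M (Z (a.1 j) ∩ A) :=
          (Nat.mul_le_mul_right _ (Nat.le_add_right _ _)).trans h1
        exact_mod_cast h2
    _ = ∑ j : Fin m, expect w (fun b => (rk M (Z b ∩ A) : ℝ)) := by
        rw [expect_sum]
        refine Finset.sum_congr rfl fun j _ => ?_
        have h1 : Push (powWeight (Fin m) w) (fun a (_ : Unit) => a j) (powWeight Unit w) :=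
          Push.restrict hw fun _ _ _ => rfl
        have h2 : Push (powWeight Unit w) (fun a => a ()) w :=
          Push.of_equiv (Equiv.funUnique Unit Ω) fun a => by simp [powWeight]
        exact ((Push.fst hv).comp (h1.comp h2)) fun b => (rk M (Z b ∩ A) : ℝ)
    _ ≤ ∑ j : Fin m, r := Finset.sum_le_sum fun _ _ => hr
    _ = m * r := by simp

end Layer

/-! ### The chain -/

section Chain

variable {α : Type*} {M : Matroid α}

/-- The sets that arise from `A` by applying the maps `f 0`, `f 1`, … in turn. -/
def chain (f : ℕ → Set α → Set α) (A : Set α) : ℕ → Set α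
  | 0 => A
  | i + 1 => f i (chain f A i)

lemma chain_succ' (f : ℕ → Set α → Set α) (A : Set α) (i : ℕ) :
    chain f A (i + 1) = chain (fun j => f (j + 1)) (f 0 A) i := by
  induction i with
  | zero => rfl
  | succ i ih => rw [chain, ih, chain]

/-- The element `e` leaves the chain within `D` layers, and at this layer it cannot be blocked by
the elements in `R`. -/
def Succeeds (M : Matroid α) (e : α) (R : Set α) (f : ℕ → Set α → Set α) (D : ℕ) (A : Set α) :
    Prop :=
  ∃ i < D, e ∈ chain f A i ∧ e ∉ chain f A (i + 1) ∧
    ¬Blocked M e R (chain f A i) (chain f A (i + 1))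

lemma not_succeeds_succ {e : α} {R A : Set α} {f : ℕ → Set α → Set α} {D : ℕ} (he : e ∈ A)
    (h : ¬Succeeds M e R f (D + 1) A) :
    Blocked M e R A (f 0 A) ∨ e ∈ f 0 A ∧ ¬Succeeds M e R (fun j => f (j + 1)) D (f 0 A) := by
  by_cases h0 : e ∈ f 0 A
  · refine .inr ⟨h0, fun ⟨i, hi, h1, h2, h3⟩ => h ⟨i + 1, by lia, ?_, ?_, ?_⟩⟩
    · rwa [chain_succ']
    · rwa [chain_succ']
    · rwa [chain_succ', chain_succ']
  · by_contra! hb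
    exact h ⟨0, by lia, he, h0, hb.1⟩

/-- The maps given by the layers, extended by the identity. -/
def layers {Ξ : Type*} (F : Ξ → Set α → Set α) {D : ℕ} (ξ : Fin D → Ξ) (i : ℕ) (A : Set α) :
    Set α :=
  if h : i < D then F (ξ ⟨i, h⟩) A else A

lemma layers_cons_zero {Ξ : Type*} (F : Ξ → Set α → Set α) {D : ℕ} (a : Ξ) (ξ : Fin D → Ξ) :
    layers F (Fin.cons a ξ : Fin (D + 1) → Ξ) 0 = F a := by
  funext A
  simp [layers, show (⟨0, Nat.succ_pos D⟩ : Fin (D + 1)) = 0 from rfl]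

lemma layers_cons_succ {Ξ : Type*} (F : Ξ → Set α → Set α) {D : ℕ} (a : Ξ) (ξ : Fin D → Ξ) :
    (fun j => layers F (Fin.cons a ξ : Fin (D + 1) → Ξ) (j + 1)) = layers F ξ := by
  funext j A
  by_cases h : j < D
  · simp only [layers, h, Nat.succ_lt_succ h, dite_true]
    rw [show (⟨j + 1, Nat.succ_lt_succ h⟩ : Fin (D + 1)) = Fin.succ ⟨j, h⟩ from rfl, Fin.cons_succ]
  · simp [layers, h]

/-- If in every layer the probability of being blocked is at most `lam` times the probability of
leaving, up to an error `η`, and the rank drops by a factor `q` on average, then failure has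
probability at most `lam` up to small errors. -/
theorem expect_not_succeeds_le {Ω Ξ : Type*} [Fintype Ω] [Fintype Ξ] {w : Ω → ℝ} (hw : IsProb w)
    {v : Ξ → ℝ} (hv : IsProb v) (Z : Ω → Set α) (F : Ξ → Set α → Set α) {e : α} {lam η q : ℝ}
    (hlam : 0 ≤ lam) (hη : 0 ≤ η) (hq : 0 ≤ q)
    (hblock : ∀ A, e ∈ A → expect v (fun a => expect w fun R =>
      ind (Blocked M e (Z R) A (F a A))) ≤ lam * expect v (fun a => ind (e ∉ F a A)) + η)
    (hdrop : ∀ A, expect v (fun a => (rk M (F a A) : ℝ)) ≤ q * rk M A)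
    (hrk : ∀ A, e ∈ A → 1 ≤ rk M A) (D : ℕ) (A : Set α) (he : e ∈ A) :
    expect w (fun R => expect (powWeight (Fin D) v) fun ξ =>
      ind (¬Succeeds M e (Z R) (layers F ξ) D A)) ≤ lam + D * η + q ^ D * rk M A := by
  classical
  induction D generalizing A with
  | zero =>
    have h1 : (1 : ℝ) ≤ rk M A := by exact_mod_cast hrk A he
    calc _ ≤ expect w (fun R => expect (powWeight (Fin 0) v) fun ξ => (1 : ℝ)) :=
          hw.expect_mono fun _ => hv.pow.expect_mono fun _ => ind_le_one _
      _ = 1 := by rw [hv.pow.expect_const, hw.expect_const]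
      _ ≤ _ := by simp; linarith
  | succ D ih =>
    calc expect w (fun R => expect (powWeight (Fin (D + 1)) v) fun ξ =>
          ind (¬Succeeds M e (Z R) (layers F ξ) (D + 1) A))
        = expect v (fun a => expect w fun R => expect (powWeight (Fin D) v) fun ξ =>
          ind (¬Succeeds M e (Z R) (layers F (Fin.cons a ξ : Fin (D + 1) → Ξ)) (D + 1) A)) := by
          simp only [expect_powWeight_succ]
          rw [expect_comm]
      _ ≤ expect v (fun a => expect w (fun R => ind (Blocked M e (Z R) A (F a A))) +
          ind (e ∈ F a A) * (lam + D * η + q ^ D * rk M (F a A))) := by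
          refine hv.expect_mono fun a => ?_
          calc _ ≤ expect w (fun R => ind (Blocked M e (Z R) A (F a A)) +
                ind (e ∈ F a A) * expect (powWeight (Fin D) v) fun ξ =>
                  ind (¬Succeeds M e (Z R) (layers F ξ) D (F a A))) := by
                refine hw.expect_mono fun R => ?_
                rw [← expect_mul_left, ← (hv.pow (ι := Fin D)).expect_const (ind (Blocked _ _ _ _ _)),
                  ← expect_add]
                refine hv.pow.expect_mono fun ξ => ?_
                by_cases h : Succeeds M e (Z R) (layers F (Fin.cons a ξ : Fin (D + 1) → Ξ)) (D + 1) A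
                · rw [ind_of_false (not_not.2 h)]
                  exact add_nonneg (ind_nonneg _) (mul_nonneg (ind_nonneg _) (ind_nonneg _))
                · have h' := not_succeeds_succ he h
                  rw [layers_cons_zero, layers_cons_succ] at h'
                  rw [ind_of_true h]
                  rcases h' with h' | ⟨h1, h2⟩
                  · rw [ind_of_true h']
                    exact le_add_of_nonneg_right (mul_nonneg (ind_nonneg _) (ind_nonneg _))
                  · rw [ind_of_true h1, ind_of_true h2, one_mul]
                    exact le_add_of_nonneg_left (ind_nonneg _)
            _ ≤ _ := by
                rw [expect_add, expect_mul_left]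
                by_cases h : e ∈ F a A
                · rw [ind_of_true h, one_mul, one_mul]; gcongr; exact ih _ h
                · rw [ind_of_false h, zero_mul, zero_mul]
      _ ≤ expect v (fun a => expect w (fun R => ind (Blocked M e (Z R) A (F a A))) +
          (lam * ind (e ∈ F a A) + (D * η + q ^ D * rk M (F a A)))) := by
          refine hv.expect_mono fun a => ?_
          have h1 : 0 ≤ D * η + q ^ D * rk M (F a A) := by positivity
          have h2 := mul_le_mul_of_nonneg_right (ind_le_one (e ∈ F a A)) h1
          gcongr
          linarith
      _ = expect v (fun a => expect w (fun R => ind (Blocked M e (Z R) A (F a A)))) +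
          (lam * (1 - expect v (fun a => ind (e ∉ F a A))) +
            (D * η + q ^ D * expect v (fun a => (rk M (F a A) : ℝ)))) := by
          rw [expect_add, expect_add, expect_add, expect_mul_left, expect_mul_left v (fun a => (rk M (F a A) : ℝ)),
            hv.expect_const]
          have : expect v (fun a => ind (e ∉ F a A)) = 1 - expect v (fun a => ind (e ∈ F a A)) := by
            simp only [ind_not, sub_eq_add_neg]
            rw [expect_add, hv.expect_const]
            congr 1
            simpa using expect_mul_left v (fun a => ind (e ∈ F a A)) (-1)
          rw [this]
          ring
      _ ≤ (lam * expect v (fun a => ind (e ∉ F a A)) + η) +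
          (lam * (1 - expect v (fun a => ind (e ∉ F a A))) + (D * η + q ^ D * (q * rk M A))) := by
          gcongr
          · exact hblock A he
          · exact hdrop A
      _ = _ := by push_cast; ring

end Chain

/-! ### Random sets and coins -/

section RandomSets

variable {n : ℕ}

/-- The weights of a fair coin. -/
noncomputable def coinWeight : Bool → ℝ := fun _ => 1 / 2

lemma isProb_coinWeight : IsProb coinWeight := ⟨fun _ => by simp [coinWeight], by simp [coinWeight]⟩

/-- The weights of a coin that shows `true` with probability `y`. -/
def biasedWeight (y : ℝ) : Bool → ℝ := fun b => if b then y else 1 - y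

/-- Bit vectors as sets. -/
def bitsEquiv (n : ℕ) : (Fin n → Bool) ≃ Finset (Fin n) where
  toFun b := Finset.univ.filter fun e => b e = true
  invFun S e := decide (e ∈ S)
  left_inv b := by funext e; simp
  right_inv S := by ext e; simp

lemma push_bitsEquiv (y : Fin n → ℝ) :
    Push (fun b : Fin n → Bool => ∏ e, biasedWeight (y e) (b e)) (bitsEquiv n)
      (productWeight y) :=
  Push.of_equiv _ fun b => Finset.prod_congr rfl fun e _ => by simp [biasedWeight, bitsEquiv]

lemma isProb_productWeight {y : Fin n → ℝ} (hy : ∀ e, 0 ≤ y e ∧ y e ≤ 1) :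
    IsProb (productWeight y) := by
  refine ⟨fun S => Finset.prod_nonneg fun e _ => ?_, ?_⟩
  · split_ifs
    · exact (hy e).1
    · linarith [(hy e).2]
  · have := push_bitsEquiv y fun _ => 1
    simp only [expect, mul_one] at this
    rw [← this, sum_pi_prod fun e b => biasedWeight (y e) b]
    simp [biasedWeight]

/-- The elements of a set that are kept by the coins `c`. -/
def thin (S : Finset (Fin n)) (c : Fin n → Bool) : Finset (Fin n) := S.filter fun e => c e = true

/-- Discarding every element with probability one half halves all marginals. -/
lemma push_thin (x : Fin n → ℝ) :
    Push (prodWeight (productWeight x) (powWeight (Fin n) coinWeight)) (fun a => thin a.1 a.2)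
      (productWeight fun e => x e / 2) := by
  let w : Fin n → Bool × Bool → ℝ := fun e => prodWeight (biasedWeight (x e)) coinWeight
  have h1 : Push (prodWeight (productWeight x) (powWeight (Fin n) coinWeight))
      (((bitsEquiv n).symm.prodCongr (Equiv.refl _)).trans
        (Equiv.arrowProdEquivProdArrow (Fin n) (fun _ => Bool) (fun _ => Bool)).symm)
      (fun b => ∏ e, w e (b e)) := Push.of_equiv _ fun a => by
    simp only [w, prodWeight, Finset.prod_mul_distrib, powWeight, productWeight]
    congr 1
    refine Finset.prod_congr rfl fun e _ => ?_
    simp [biasedWeight, bitsEquiv, Equiv.arrowProdEquivProdArrow]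
  have h2 : Push (fun b : Fin n → Bool × Bool => ∏ e, w e (b e)) (fun b e => (b e).1 && (b e).2)
      (fun b => ∏ e, biasedWeight (x e / 2) (b e)) := by
    refine Push.pi (φ := fun b : Bool × Bool => b.1 && b.2) fun e f => ?_
    simp [expect, w, prodWeight, biasedWeight, coinWeight, Fintype.sum_prod_type]
    ring
  have h3 := (h1.comp h2).comp (push_bitsEquiv fun e => x e / 2)
  convert h3 using 1
  funext a
  ext e
  simp [thin, bitsEquiv, Equiv.arrowProdEquivProdArrow]

/-- Whether `e` belongs to the random set is independent of its other elements. -/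
lemma expect_mem_mul (y : Fin n → ℝ) (e : Fin n) (f : Finset (Fin n) → ℝ)
    (hf : ∀ S, f (insert e S) = f S) :
    expect (productWeight y) (fun S => ind (e ∈ S) * f S) = y e * expect (productWeight y) f := by
  classical
  have hsplit : ∀ g : Finset (Fin n) → ℝ, ∑ S, g S =
      ∑ S ∈ (Finset.univ.erase e).powerset, (g S + g (insert e S)) := fun g => by
    rw [Finset.sum_add_distrib, ← Finset.sum_powerset_insert (Finset.notMem_erase e _),
      Finset.insert_erase (Finset.mem_univ e), Finset.powerset_univ]
  simp only [expect]
  rw [hsplit, hsplit, Finset.mul_sum]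
  refine Finset.sum_congr rfl fun S hS => ?_
  have heS : e ∉ S := fun h => by simpa using Finset.mem_powerset.1 hS h
  have h0 : ∀ S : Finset (Fin n), productWeight y S = (if e ∈ S then y e else 1 - y e) *
      ∏ i ∈ Finset.univ.erase e, if i ∈ S then y i else 1 - y i := fun S =>
    (Finset.mul_prod_erase Finset.univ _ (Finset.mem_univ e)).symm
  have h1 : ∏ i ∈ Finset.univ.erase e, (if i ∈ insert e S then y i else 1 - y i) =
      ∏ i ∈ Finset.univ.erase e, if i ∈ S then y i else 1 - y i :=
    Finset.prod_congr rfl fun i hi => by simp [Finset.ne_of_mem_erase hi]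
  rw [h0 S, h0 (insert e S), h1, hf, ind_of_false heS, ind_of_true (Finset.mem_insert_self e S),
    if_neg heS, if_pos (Finset.mem_insert_self e S)]
  ring

lemma expect_mem {y : Fin n → ℝ} (hy : ∀ e, 0 ≤ y e ∧ y e ≤ 1) (e : Fin n) :
    expect (productWeight y) (fun S => ind (e ∈ S)) = y e := by
  have := expect_mem_mul y e (fun _ => 1) fun _ => rfl
  simpa [(isProb_productWeight hy).expect_const] using this

lemma expect_rk_le {M : Matroid (Fin n)} {x : Fin n → ℝ} (hx : x ∈ polytope M)
    (A : Set (Fin n)) :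
    expect (productWeight fun e => x e / 2) (fun S => (rk M ((S : Set (Fin n)) ∩ A) : ℝ)) ≤
      rk M A / 2 := by
  classical
  have hy : ∀ e, 0 ≤ x e / 2 ∧ x e / 2 ≤ 1 := fun e => by
    have := polytope_bounds hx e
    constructor <;> linarith
  calc _ ≤ expect (productWeight fun e => x e / 2) (fun S => ∑ e ∈ A.toFinset, ind (e ∈ S)) := by
        refine (isProb_productWeight hy).expect_mono fun S => ?_
        have h1 := M.eRk_le_encard (((S ∩ A.toFinset : Finset (Fin n))) : Set (Fin n))
        rw [← coe_rk, Set.encard_coe_eq_coe_finsetCard] at h1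
        have h2 : ((S ∩ A.toFinset : Finset (Fin n)) : Set (Fin n)) = (S : Set (Fin n)) ∩ A := by
          simp
        rw [h2] at h1
        have h3 : ∑ e ∈ A.toFinset, ind (e ∈ S) = ((S ∩ A.toFinset).card : ℝ) := by
          rw [Finset.inter_comm, ← Finset.filter_mem_eq_inter]
          simp only [ind, Finset.card_filter, Nat.cast_sum, Nat.cast_ite, Nat.cast_one,
            Nat.cast_zero]
          exact Finset.sum_congr rfl fun _ _ => by congr
        rw [h3]
        exact_mod_cast h1
    _ = ∑ e ∈ A.toFinset, x e / 2 := by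
        rw [expect_sum]
        exact Finset.sum_congr rfl fun e _ => expect_mem hy e
    _ ≤ _ := by
        rw [← Finset.sum_div]
        have := sum_le_rk_of_mem_polytope hx A.toFinset
        rw [Set.coe_toFinset] at this
        linarith

end RandomSets

/-! ### The random threshold -/

section Threshold

open Classical in
/-- The number of indices before the first failure of `c`, among the first `K` indices. -/
noncomputable def lead (c : ℕ → Prop) : ℕ → ℕ
  | 0 => 0
  | i + 1 => if ∀ l ≤ i, c l then i + 1 else lead c i

lemma le_lead_iff (c : ℕ → Prop) (K τ : ℕ) : τ ≤ lead c K ↔ τ ≤ K ∧ ∀ l < τ, c l := by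
  induction K with
  | zero =>
    simp only [lead, Nat.le_zero]
    exact ⟨by rintro rfl; simp, fun h => h.1⟩
  | succ K ih =>
    rw [lead]
    split_ifs with h
    · exact ⟨fun h' => ⟨h', fun l hl => h l (by lia)⟩, fun h' => h'.1⟩
    · rw [ih]
      refine ⟨fun h' => ⟨by lia, h'.2⟩, fun h' => ⟨?_, h'.2⟩⟩
      by_contra hK
      exact h fun l hl => h'.2 l (by lia)

lemma lead_eq_self {c : ℕ → Prop} {K : ℕ} (h : ∀ l < K, c l) : lead c K = K :=
  le_antisymm ((le_lead_iff c K _).1 le_rfl).1 ((le_lead_iff c K K).2 ⟨le_rfl, h⟩)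

/-- The number of blocks before the first block without a `true`. -/
noncomputable def delay {K g : ℕ} (h : Fin K → Fin g → Bool) : ℕ :=
  lead (fun l => ∃ (hl : l < K) (a : Fin g), h ⟨l, hl⟩ a = true) K

lemma expect_le_delay {K g τ : ℕ} (hτ : τ ≤ K) :
    expect (powWeight (Fin K) (powWeight (Fin g) coinWeight)) (fun h => ind (τ ≤ delay h)) =
      (1 - (1 / 2) ^ g) ^ τ := by
  classical
  have hb : ∑ b : Fin g → Bool, powWeight (Fin g) coinWeight b * ind (∃ a, b a = true) =
      1 - (1 / 2) ^ g := by
    have h1 : ∀ b : Fin g → Bool, ind (∃ a, b a = true) = 1 - if b = (fun _ => false) then 1 else 0 := by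
      intro b
      by_cases hb : b = fun _ => false
      · rw [ind_of_false (by simp [hb]), if_pos hb, sub_self]
      · obtain ⟨a, ha⟩ := Function.ne_iff.1 hb
        rw [ind_of_true ⟨a, by simpa using ha⟩, if_neg hb, sub_zero]
    simp only [h1, mul_sub, mul_one, Finset.sum_sub_distrib,
      (isProb_coinWeight.pow (ι := Fin g)).sum_eq_one]
    simp [powWeight, coinWeight]
  have h2 : ∀ h : Fin K → Fin g → Bool, powWeight (Fin K) (powWeight (Fin g) coinWeight) h *
      ind (τ ≤ delay h) = ∏ l : Fin K, (powWeight (Fin g) coinWeight (h l) *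
        if (l : ℕ) < τ then ind (∃ a, h l a = true) else 1) := by
    intro h
    rw [Finset.prod_mul_distrib, powWeight]
    congr 1
    rw [delay, le_lead_iff]
    by_cases hall : ∀ l : Fin K, (l : ℕ) < τ → ∃ a, h l a = true
    · rw [ind_of_true ⟨hτ, fun l hl => ⟨hl.trans_le hτ, hall _ hl⟩⟩, Finset.prod_eq_one]
      intro l _
      split_ifs with hl
      · exact ind_of_true (hall l hl)
      · rfl
    · rw [ind_of_false fun h' => hall fun l hl => (h'.2 l hl).2]
      push Not at hall
      obtain ⟨l, hl, hl'⟩ := hall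
      refine (Finset.prod_eq_zero (Finset.mem_univ l) ?_).symm
      rw [if_pos hl, ind_of_false (by simpa using hl')]
  simp only [expect, h2]
  rw [sum_pi_prod fun (l : Fin K) b => powWeight (Fin g) coinWeight b *
        if (l : ℕ) < τ then ind (∃ a, b a = true) else 1]
  have h3 : ∀ l : Fin K, (∑ b : Fin g → Bool, powWeight (Fin g) coinWeight b *
      if (l : ℕ) < τ then ind (∃ a, b a = true) else 1) =
      if (l : ℕ) < τ then 1 - (1 / 2) ^ g else 1 := by
    intro l
    split_ifs
    · exact hb
    · simpa using (isProb_coinWeight.pow (ι := Fin g)).sum_eq_one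
  simp only [h3]
  rw [Finset.prod_ite, Finset.prod_const, Finset.prod_const_one, mul_one]
  congr 1
  rw [← Finset.card_map Fin.valEmbedding]
  conv_rhs => rw [← Finset.card_range τ]
  congr 1
  ext l
  simp only [Finset.mem_map, Finset.mem_filter, Finset.mem_univ, true_and, Finset.mem_range,
    Fin.valEmbedding_apply]
  exact ⟨by rintro ⟨l, hl, rfl⟩; exact hl, fun hl => ⟨⟨l, hl.trans_le hτ⟩, hl, rfl⟩⟩

lemma lowHazard_delay (K : ℕ) {g : ℕ} (hg : 1 ≤ g) :
    LowHazard (powWeight (Fin K) (powWeight (Fin g) coinWeight)) delay K (2 * (1 / 2) ^ g)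
      ((1 - (1 / 2) ^ g) ^ K) := by
  set p : ℝ := (1 / 2) ^ g with hp
  have hp0 : 0 < p := by positivity
  have hp1 : p ≤ 1 / 2 := by
    calc p ≤ (1 / 2) ^ 1 := pow_le_pow_of_le_one (by norm_num) (by norm_num) hg
      _ = 1 / 2 := by norm_num
  have hv := (isProb_coinWeight.pow (ι := Fin g)).pow (ι := Fin K)
  have hle : ∀ h : Fin K → Fin g → Bool, delay h ≤ K := fun h => ((le_lead_iff _ _ _).1 le_rfl).1
  have hK : (0 : ℝ) ≤ (1 - p) ^ K := pow_nonneg (by linarith) K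
  refine ⟨hle, by positivity, hK, fun τ => ?_⟩
  have hnn : 0 ≤ expect (powWeight (Fin K) (powWeight (Fin g) coinWeight))
      (fun h => ind (τ < delay h)) := hv.expect_nonneg fun _ => ind_nonneg _
  rcases lt_trichotomy τ K with h | h | h
  · have h1 : expect (powWeight (Fin K) (powWeight (Fin g) coinWeight))
        (fun h => ind (delay h = τ)) + expect (powWeight (Fin K) (powWeight (Fin g) coinWeight))
        (fun h => ind (τ < delay h)) = (1 - p) ^ τ := by
      rw [← expect_le_delay h.le, ← expect_add]
      congr 1
      funext h
      rcases lt_trichotomy τ (delay h) with h | h | h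
      · rw [ind_of_true h, ind_of_true h.le, ind_of_false h.ne', zero_add]
      · rw [ind_of_true h.symm, ind_of_true h.le, ind_of_false h.not_lt, add_zero]
      · rw [ind_of_false h.ne, ind_of_false h.not_ge, ind_of_false h.le.not_gt, add_zero]
    have h2 : expect (powWeight (Fin K) (powWeight (Fin g) coinWeight))
        (fun h => ind (τ < delay h)) = (1 - p) ^ (τ + 1) := expect_le_delay h
    rw [h2] at h1 ⊢
    have h3 : (0 : ℝ) ≤ (1 - p) ^ τ := pow_nonneg (by linarith) τ
    rw [pow_succ] at h1 ⊢
    nlinarith [mul_nonneg (mul_nonneg hp0.le h3) (show (0 : ℝ) ≤ 1 - 2 * p by linarith)]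
  · subst h
    have : expect (powWeight (Fin τ) (powWeight (Fin g) coinWeight))
        (fun h => ind (delay h = τ)) ≤ (1 - p) ^ τ := by
      rw [hp, ← expect_le_delay le_rfl]
      exact hv.expect_mono fun h => ind_mono fun h' => h'.ge
    have := mul_nonneg (mul_nonneg zero_le_two hp0.le) hnn
    linarith
  · have : expect (powWeight (Fin K) (powWeight (Fin g) coinWeight))
        (fun h => ind (delay h = τ)) = 0 := by
      rw [← hv.expect_const 0]
      congr 1
      funext h'
      exact ind_of_false fun h'' => absurd (hle h') (by lia)
    have := mul_nonneg (mul_nonneg zero_le_two hp0.le) hnn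
    linarith

end Threshold

/-! ### The random choices of the algorithm -/

section Choices

variable {n k m D K g B : ℕ}

/-- The coins that the algorithm uses: one for every element of the active set, and for every
layer one for every element of every sample, as well as `K` blocks of `g` coins. -/
abbrev CoinIndex (n D m K g : ℕ) : Type :=
  Fin n ⊕ Fin D × (Fin m × Fin n ⊕ Fin K × Fin g)

/-- The number of coins that are used in a layer. -/
def layerCoins (n m K g : ℕ) : ℕ := m * n + K * g

/-- The positions of the coins, in the order of their use. -/
def coinPos : CoinIndex n D m K g → ℕ
  | .inl e => e
  | .inr (i, .inl (j, e)) => n + i * layerCoins n m K g + (j * n + e)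
  | .inr (i, .inr (l, a)) => n + i * layerCoins n m K g + (m * n + (l * g + a))

lemma mul_add_lt {a b c d : ℕ} (h : a < b) (h' : c < d) : a * d + c < b * d :=
  calc a * d + c < a * d + d := by lia
    _ = (a + 1) * d := by ring
    _ ≤ b * d := Nat.mul_le_mul_right d h

lemma mul_add_inj {a b c c' d : ℕ} (h : c < d) (h' : c' < d) (heq : a * d + c = b * d + c') :
    a = b ∧ c = c' := by
  have h1 : a = b := by
    have := congrArg (· / d) heq
    have hd : 0 < d := by lia
    simpa [Nat.add_div_of_dvd_right, Nat.mul_div_cancel _ hd, Nat.div_eq_of_lt h,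
      Nat.div_eq_of_lt h'] using this
  subst h1
  exact ⟨rfl, by lia⟩

lemma coinPos_lt (c : CoinIndex n D m K g) : coinPos c < n + D * layerCoins n m K g := by
  rcases c with e | ⟨i, ⟨j, e⟩ | ⟨l, a⟩⟩
  · simp only [coinPos]; lia
  · have h1 := mul_add_lt j.2 e.2
    have h2 := mul_add_lt i.2 (show (j : ℕ) * n + e < layerCoins n m K g by
      unfold layerCoins; lia)
    simp only [coinPos]; lia
  · have h1 := mul_add_lt l.2 a.2
    have h2 := mul_add_lt i.2 (show m * n + ((l : ℕ) * g + a) < layerCoins n m K g by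
      unfold layerCoins; lia)
    simp only [coinPos]; lia

lemma coinPos_injective : Function.Injective (coinPos : CoinIndex n D m K g → ℕ) := by
  have h1 : ∀ (j : Fin m) (e : Fin n), (j : ℕ) * n + e < m * n := fun j e => mul_add_lt j.2 e.2
  have h2 : ∀ (l : Fin K) (a : Fin g), m * n + ((l : ℕ) * g + a) < layerCoins n m K g :=
    fun l a => Nat.add_lt_add_left (mul_add_lt l.2 a.2) _
  have h3 : ∀ (j : Fin m) (e : Fin n), (j : ℕ) * n + e < layerCoins n m K g :=
    fun j e => (h1 j e).trans_le (Nat.le_add_right _ _)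
  rintro (e | ⟨i, ⟨j, e⟩ | ⟨l, a⟩⟩) (e' | ⟨i', ⟨j', e'⟩ | ⟨l', a'⟩⟩) h <;>
    simp only [coinPos] at h
  · rw [Fin.ext h]
  · omega
  · omega
  · omega
  · obtain ⟨h4, h5⟩ := mul_add_inj (a := i) (b := i') (h3 j e) (h3 j' e') (by omega)
    obtain ⟨h6, h7⟩ := mul_add_inj e.2 e'.2 h5
    rw [Fin.ext h4, Fin.ext h6, Fin.ext h7]
  · obtain ⟨h4, h5⟩ := mul_add_inj (a := i) (b := i') (h3 j e) (h2 l' a') (by omega)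
    have := h1 j e
    omega
  · omega
  · obtain ⟨h4, h5⟩ := mul_add_inj (a := i) (b := i') (h2 l a) (h3 j' e') (by omega)
    have := h1 j' e'
    omega
  · obtain ⟨h4, h5⟩ := mul_add_inj (a := i) (b := i') (h2 l a) (h2 l' a') (by omega)
    obtain ⟨h6, h7⟩ := mul_add_inj (a := l) (b := l') a.2 a'.2 (by omega)
    rw [Fin.ext h4, Fin.ext h6, Fin.ext h7]

/-- The coins that the algorithm uses, in terms of a supply of `B` coins. -/
def coinEmb (hB : n + D * layerCoins n m K g ≤ B) (c : CoinIndex n D m K g) : Fin B :=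
  ⟨coinPos c, (coinPos_lt c).trans_le hB⟩

/-- The random choices of a layer: `m` thinned samples and the coins for the threshold. -/
abbrev LayerChoice (n m K g : ℕ) : Type := (Fin m → Finset (Fin n)) × (Fin K → Fin g → Bool)

/-- The distribution of the random choices of a layer. -/
noncomputable def layerWeight (y : Fin n → ℝ) : LayerChoice n m K g → ℝ :=
  prodWeight (powWeight (Fin m) (productWeight y)) (powWeight (Fin K) (powWeight (Fin g) coinWeight))

/-- The thinned active set and the random choices of all layers. -/
def choices (hB : n + D * layerCoins n m K g ≤ B) (ω : Outcome n (D * m) B) :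
    Finset (Fin n) × (Fin D → LayerChoice n m K g) :=
  (thin ω.1 fun e => ω.2.2 (coinEmb hB (.inl e)),
    fun i => (fun j => thin (ω.2.1 (finProdFinEquiv (i, j))) fun e =>
        ω.2.2 (coinEmb hB (.inr (i, .inl (j, e)))),
      fun l a => ω.2.2 (coinEmb hB (.inr (i, .inr (l, a))))))

/-- Samples and coins, sorted by layers and samples. -/
def sortEquiv : (Finset (Fin n) × (Fin D × Fin m → Finset (Fin n)) × (CoinIndex n D m K g → Bool)) ≃
    (Finset (Fin n) × (Fin n → Bool)) ×
      (Fin D → (Fin m → Finset (Fin n) × (Fin n → Bool)) × (Fin K → Fin g → Bool)) where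
  toFun ω := ((ω.1, fun e => ω.2.2 (.inl e)), fun i =>
    (fun j => (ω.2.1 (i, j), fun e => ω.2.2 (.inr (i, .inl (j, e)))),
      fun l a => ω.2.2 (.inr (i, .inr (l, a)))))
  invFun ω := (ω.1.1, fun p => ((ω.2 p.1).1 p.2).1, fun c => match c with
    | .inl e => ω.1.2 e
    | .inr (i, .inl (j, e)) => ((ω.2 i).1 j).2 e
    | .inr (i, .inr (l, a)) => (ω.2 i).2 l a)
  left_inv ω := by
    refine Prod.ext rfl (Prod.ext rfl ?_)
    funext c
    rcases c with e | ⟨i, ⟨j, e⟩ | ⟨l, a⟩⟩ <;> rfl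
  right_inv ω := rfl

lemma weight_eq (x : Fin n → ℝ) : weight (n := n) (k := k) (m := B) x =
    prodWeight (productWeight x)
      (prodWeight (powWeight (Fin k) (productWeight x)) (powWeight (Fin B) coinWeight)) := by
  funext ω
  simp [weight, prodWeight, powWeight, coinWeight, mul_assoc]

/-- The choices of the algorithm are independent: the thinned active set and all thinned samples
have distribution `D(x/2)`, and the coins for the thresholds are fair. -/
theorem push_choices (x : Fin n → ℝ) (hB : n + D * layerCoins n m K g ≤ B) :
    Push (weight (n := n) (k := D * m) (m := B) x) (choices hB)
      (prodWeight (productWeight fun e => x e / 2)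
        (powWeight (Fin D) (layerWeight (m := m) (K := K) (g := g) fun e => x e / 2))) := by
  have h2 : Push (powWeight (Fin B) coinWeight)
      (fun c (i : CoinIndex n D m K g) => c (coinEmb hB i)) (powWeight _ coinWeight) :=
    Push.restrict isProb_coinWeight fun a b hab => coinPos_injective (by simpa [coinEmb] using hab)
  have h3 : Push (powWeight (Fin (D * m)) (productWeight x))
      (finProdFinEquiv.symm.arrowCongr (Equiv.refl (Finset (Fin n))))
      (powWeight (Fin D × Fin m) (productWeight x)) := Push.of_equiv _ fun a => by
    simp only [powWeight]
    rw [← finProdFinEquiv.prod_comp]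
    rfl
  have h0 : Push (productWeight x) id (productWeight x) := fun f => rfl
  have h4 := h0.prodMap (h3.prodMap h2)
  have h5 : Push (prodWeight (productWeight x) (prodWeight
      (powWeight (Fin D × Fin m) (productWeight x)) (powWeight (CoinIndex n D m K g) coinWeight)))
      sortEquiv (prodWeight (prodWeight (productWeight x) (powWeight (Fin n) coinWeight))
        (powWeight (Fin D) (prodWeight
          (powWeight (Fin m) (prodWeight (productWeight x) (powWeight (Fin n) coinWeight)))
          (powWeight (Fin K) (powWeight (Fin g) coinWeight))))) := Push.of_equiv _ fun a => by
    simp only [prodWeight, powWeight, sortEquiv, Fintype.prod_sum_type, Fintype.prod_prod_type,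
      Finset.prod_mul_distrib, Equiv.coe_fn_mk]
    ring
  have h6 := (push_thin x).prodMap (Push.pow (ι := Fin D) (((push_thin x).pow (ι := Fin m)).prodMap
    (show Push (powWeight (Fin K) (powWeight (Fin g) coinWeight)) id _ from fun f => rfl)))
  rw [weight_eq]
  exact (h4.comp h5).comp h6

end Choices

/-! ### The probability of selection -/

section Selection

variable {n k m D K g B : ℕ} {M : Matroid (Fin n)} {x : Fin n → ℝ} {e : Fin n}

lemma prob_eq_expect (x : Fin n → ℝ) (P : Outcome n k m → Prop) :
    prob x P = expect (weight x) fun ω => ind (P ω) := by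
  unfold prob expect ind
  exact Finset.sum_congr rfl fun ω _ => by split_ifs <;> simp_all

lemma isProb_weight (hx : ∀ e, 0 ≤ x e ∧ x e ≤ 1) :
    IsProb (weight (n := n) (k := k) (m := m) x) := by
  rw [weight_eq]
  exact (isProb_productWeight hx).prod ((isProb_productWeight hx).pow.prod isProb_coinWeight.pow)

lemma prob_active (hx : ∀ e, 0 ≤ x e ∧ x e ≤ 1) (e : Fin n) :
    prob x (fun ω : Outcome n k m => e ∈ ω.1) = x e := by
  rw [prob_eq_expect, weight_eq, ← expect_mem hx e]
  exact Push.fst ((isProb_productWeight hx).pow.prod isProb_coinWeight.pow)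
    fun S => ind (e ∈ S)

lemma blocked_insert {α : Type*} {M : Matroid α} {e : α} {R A S : Set α} :
    Blocked M e (insert e R) A S ↔ Blocked M e R A S := by
  have : (insert e R ∩ A ∪ S) \ {e} = (R ∩ A ∪ S) \ {e} := by
    ext f
    simp only [Set.mem_sdiff, Set.mem_union, Set.mem_inter_iff, Set.mem_insert_iff,
      Set.mem_singleton_iff]
    tauto
  simp only [Blocked, this]

lemma succeeds_insert {α : Type*} {M : Matroid α} {e : α} {R A : Set α}
    {f : ℕ → Set α → Set α} :
    Succeeds M e (insert e R) f D A ↔ Succeeds M e R f D A := by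
  simp only [Succeeds, blocked_insert]

/-- The step of the chain in terms of the random choices of a layer. -/
noncomputable def layerStep (M : Matroid (Fin n)) (t₀ : ℕ) (a : LayerChoice n m K g)
    (A : Set (Fin n)) : Set (Fin n) :=
  layerHull M (fun S : Finset (Fin n) => (S : Set (Fin n))) delay t₀ A a

/-- The bound of the chain argument for the whole ground set. Being in the thinned active set has
probability `x e / 2` and is independent of success, which does not depend on whether `e` itself is
active. -/
theorem le_expect_succeeds (hE : M.E = Set.univ) (hx : x ∈ polytope M) (he : 0 < x e)
    (hg : 1 ≤ g) (t₀ m D K : ℕ) {q : ℝ} (ht : 0 < t₀) (hq : (m : ℝ) / (2 * t₀) ≤ q) :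
    x e / 2 * (1 - ((t₀ + K : ℝ) / (m + 1) + 2 * (1 / 2) ^ g + D * (1 - (1 / 2) ^ g) ^ K +
        q ^ D * rank M)) ≤
      expect (prodWeight (productWeight fun e => x e / 2)
        (powWeight (Fin D) (layerWeight (m := m) (K := K) (g := g) fun e => x e / 2)))
      fun c => ind (e ∈ c.1 ∧
        Succeeds M e (c.1 : Set (Fin n)) (layers (layerStep M t₀) c.2) D Set.univ) := by
  classical
  set y : Fin n → ℝ := fun e => x e / 2 with hy
  have hyb : ∀ e, 0 ≤ y e ∧ y e ≤ 1 := fun e => by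
    have := polytope_bounds hx e
    constructor <;> simp only [hy] <;> linarith
  have hw := isProb_productWeight hyb
  have hv : IsProb (powWeight (Fin K) (powWeight (Fin g) coinWeight)) := isProb_coinWeight.pow.pow
  have hl : IsProb (layerWeight (m := m) (K := K) (g := g) y) := hw.pow.prod hv
  have hhaz := lowHazard_delay K hg
  have hq0 : 0 ≤ q := le_trans (by positivity) hq
  have ht' : (0 : ℝ) < t₀ := by exact_mod_cast ht
  have hfail := expect_not_succeeds_le (M := M) (e := e) (η := (1 - (1 / 2) ^ g) ^ K) (q := q)
    (lam := (t₀ + K : ℝ) / (m + 1) + 2 * (1 / 2) ^ g) hw hl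
    (fun S : Finset (Fin n) => (S : Set (Fin n))) (layerStep M t₀) (by positivity) hhaz.nonneg' hq0
    (fun A hA => expect_blocked_le hw hv hhaz _ t₀ m hA)
    (fun A => by
      have h1 := expect_rk_layerHull_le hE hw hv delay (fun S : Finset (Fin n) => (S : Set (Fin n)))
        t₀ m A (expect_rk_le hx A)
      set P := expect (prodWeight (powWeight (Fin m) (productWeight y))
        (powWeight (Fin K) (powWeight (Fin g) coinWeight))) fun a =>
          (rk M (layerHull M (fun S : Finset (Fin n) => (S : Set (Fin n))) delay t₀ A a) : ℝ)
      change P ≤ _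
      calc P ≤ (m : ℝ) / (2 * t₀) * rk M A := by
            rw [div_mul_eq_mul_div, le_div_iff₀ (by positivity)]
            linarith
        _ ≤ q * rk M A := by gcongr)
    (fun A hA => one_le_rk_of_mem hx he hA) D Set.univ (Set.mem_univ e)
  have hrank : rk M Set.univ = rank M := by rw [rk, rank, ← M.eRk_univ_eq]
  rw [hrank] at hfail
  rw [expect_prodWeight]
  have h1 : ∀ R : Finset (Fin n), (expect (powWeight (Fin D) (layerWeight (m := m) (K := K) (g := g) y)) fun ξ =>
      ind (e ∈ R ∧ Succeeds M e (R : Set (Fin n)) (layers (layerStep M t₀) ξ) D Set.univ)) =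
      ind (e ∈ R) * expect (powWeight (Fin D) (layerWeight (m := m) (K := K) (g := g) y)) fun ξ =>
      ind (Succeeds M e (R : Set (Fin n)) (layers (layerStep M t₀) ξ) D Set.univ) := by
    intro R
    rw [← expect_mul_left]
    congr 1
    funext ξ
    by_cases h : e ∈ R
    · simp only [h, true_and, ind_of_true, one_mul]
    · simp only [h, false_and, ind_of_false, not_false_eq_true, zero_mul]
  simp only [h1]
  rw [expect_mem_mul y e _ fun S => by simp only [Finset.coe_insert, succeeds_insert]]
  refine mul_le_mul_of_nonneg_left ?_ (hyb e).1
  have h2 : ∀ p : Prop, ind p = 1 - ind (¬p) := fun p => by rw [ind_not]; ring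
  have h3 : (expect (productWeight y) fun R => expect (powWeight (Fin D) (layerWeight (m := m) (K := K) (g := g) y))
      fun ξ => ind (Succeeds M e (R : Set (Fin n)) (layers (layerStep M t₀) ξ) D Set.univ)) +
      (expect (productWeight y) fun R => expect (powWeight (Fin D) (layerWeight (m := m) (K := K) (g := g) y))
      fun ξ => ind (¬Succeeds M e (R : Set (Fin n)) (layers (layerStep M t₀) ξ) D Set.univ)) = 1 := by
    rw [← expect_add]
    simp only [← expect_add, ind_not, add_sub_cancel, (hl.pow (ι := Fin D)).expect_const,
      hw.expect_const]
  linarith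

/-- A scheme that selects `e` whenever the thinned active set contains `e` and `e` leaves the chain
at a layer where it cannot be blocked selects `e` with the stated probability. -/
theorem le_condProb (hE : M.E = Set.univ) (hx : x ∈ polytope M) (he : 0 < x e)
    (hg : 1 ≤ g) {t₀ m D K : ℕ} {q : ℝ} (ht : 0 < t₀) (hq : (m : ℝ) / (2 * t₀) ≤ q)
    (hB : n + D * layerCoins n m K g ≤ B) (P : Outcome n (D * m) B → Prop)
    (hP : ∀ ω, e ∈ (choices hB ω).1 → Succeeds M e ((choices hB ω).1 : Set (Fin n))
      (layers (layerStep M t₀) (choices hB ω).2) D Set.univ → P ω) :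
    1 / 2 * (1 - ((t₀ + K : ℝ) / (m + 1) + 2 * (1 / 2) ^ g + D * (1 - (1 / 2) ^ g) ^ K +
        q ^ D * rank M)) ≤ condProb x P fun ω => e ∈ ω.1 := by
  have hxb := polytope_bounds hx
  rw [condProb, prob_active hxb, le_div_iff₀ he, prob_eq_expect]
  refine le_trans (le_of_eq (by ring)) ((le_expect_succeeds hE hx he hg t₀ m D K ht hq).trans ?_)
  rw [← push_choices x hB]
  refine (isProb_weight hxb).expect_mono fun ω => ind_mono fun ⟨h1, h2⟩ => ⟨hP ω h1 h2, ?_⟩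
  exact (Finset.mem_filter.1 h1).1

end Selection

/-! ### Subroutines: bases, spans and binary lengths -/

/-- A fixed multiple of an expression. -/
def Expr.times : ℕ → Expr → Expr
  | 0, _ => .lit 0
  | c + 1, e => .add (Expr.times c e) e

@[simp] lemma Expr.eval_times (s : Memory) (c : ℕ) (e : Expr) :
    (Expr.times c e).eval s = c * e.eval s := by
  induction c with
  | zero => simp [Expr.times, Expr.eval]
  | succ c ih => simp [Expr.times, Expr.eval, ih]; ring

/-- `a[·] := c`, on the ground set -/
def fill (a c : ℕ) : Prog := forLoop 4 (.var 0) (.store a (.var 4) (.lit c))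

/-- Add the element in variable `4` to the set in array `4` if it belongs to the set in array `3`
and independence is kept. -/
def greedyStep : Prog :=
  .branch (.get 3 (.var 4))
    (.seq (.store 4 (.var 4) (.lit 1))
      (.seq (.query 6 4) (.branch (.var 6) skip (.store 4 (.var 4) (.lit 0))))) skip

/-- Compute in array `4` a basis of the set in array `3`. -/
def greedy : Prog := .seq (fill 4 0) (forLoop 4 (.var 0) greedyStep)

/-- Set variable `5` to `0` if the element in variable `3` is spanned by the other elements of the
set in array `3`, and to `1` otherwise: the element is queried together with a basis of the
others. -/
def spanTest : Prog :=
  .seq (.store 3 (.var 3) (.lit 0)) (.seq greedy (.seq (.store 4 (.var 3) (.lit 1)) (.query 5 4)))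

/-- Compute in variable `8` the length of the binary representation of variable `27`. Variable `19`
is doubled until it exceeds variable `27`. -/
def binaryLength : Prog :=
  .seq (.assign 19 (.lit 1)) (.seq (.assign 8 (.lit 0))
    (forLoop 4 (.var 27) (.branch (.sub (.add (.var 27) (.lit 1)) (.var 19))
      (.seq (.assign 19 (.add (.var 19) (.var 19))) (.assign 8 (.add (.var 8) (.lit 1)))) skip)))

/-- Compute in variable `27` the rank of the matroid. -/
def rankProg : Prog :=
  .seq (fill 3 1) (.seq greedy (.seq (.assign 27 (.lit 0))
    (forLoop 4 (.var 0) (.assign 27 (.add (.var 27) (.get 4 (.var 4)))))))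

/-- The set that is stored in an array, as a characteristic function. -/
def supp {n : ℕ} (s : Memory) (a : ℕ) : Set (Fin n) := {i | s.arr a i ≠ 0}

section

variable {n : ℕ} {E : Env n} {M : Matroid (Fin n)} {s s' : Memory}

@[simp] lemma mem_supp {a : ℕ} {i : Fin n} : i ∈ (supp s a : Set (Fin n)) ↔ s.arr a i ≠ 0 :=
  Iff.rfl

lemma supp_congr {a b : ℕ} (h : s'.arr a = s.arr b) : (supp s' a : Set (Fin n)) = supp s b := by
  ext i; simp [h]

lemma supp_setVar (v x a : ℕ) : (supp (s.setVar v x) a : Set (Fin n)) = supp s a := rfl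

lemma supp_setArr_zero (a : ℕ) (i : Fin n) :
    (supp (s.setArr a i 0) a : Set (Fin n)) = supp s a \ {i} := by
  ext j
  by_cases h : j = i <;> simp [h, Fin.val_inj]

lemma supp_setArr_one (a : ℕ) (i : Fin n) :
    (supp (s.setArr a i 1) a : Set (Fin n)) = insert i (supp s a) := by
  ext j
  by_cases h : j = i <;> simp [h, Fin.val_inj]

lemma exec_skip (E : Env n) (s : Memory) : Exec E skip s 1 (s.setVar 9 0) := Exec.assign _ _

lemma exec_fill (E : Env n) (s : Memory) (hs : s.var 0 = n) (a c : ℕ) :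
    ∃ s', Exec E (fill a c) s (4 * n + 3) s' ∧ ∀ i < n, s'.arr a i = c := by
  obtain ⟨s', h, hI⟩ := exec_forLoop (E := E) (v := 4) (b := .var 0)
    (p := .store a (.var 4) (.lit c)) (s := s) (T := 1) n
    (fun i s' => ∀ j < i, s'.arr a j = c) (by simp [Prog.vars])
    (fun s' hf => (hf.var 0 (by simp [Prog.vars])).trans hs) (by simp)
    (fun i s' _ hv _ hI => ⟨_, Exec.store _ _ _, fun j hj => by
      by_cases hji : j = i
      · simp [Expr.eval, hv, hji]
      · simp [Expr.eval, hv, hji, hI j (by lia)]⟩)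
  exact ⟨s', h.mono (by lia), hI⟩

lemma exec_greedyStep (hE : E.indep = M.Indep) {f : Fin n} (hs : s.var 4 = f) (hf : s.arr 4 f = 0) :
    ∃ s', Exec E greedyStep s 7 s' ∧
      (s'.arr 4 = s.arr 4 ∧ (f ∈ (supp s 3 : Set (Fin n)) → ¬M.Indep (insert f (supp s 4))) ∨
        s'.arr 4 = (s.setArr 4 f 1).arr 4 ∧ f ∈ (supp s 3 : Set (Fin n)) ∧
          M.Indep (insert f (supp s 4))) := by
  classical
  by_cases h : s.arr 3 f = 0
  · refine ⟨_, (Exec.branch_neg (by simp [Expr.eval, hs, h]) (exec_skip E s)).mono (by lia), .inl ?_⟩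
    simp [h]
  · set s₁ := s.setArr 4 f 1 with hs₁
    have h₁ : Exec E (.store 4 (.var 4) (.lit 1)) s 1 s₁ := by
      simpa [Expr.eval, hs] using Exec.store (E := E) (s := s) 4 (.var 4) (.lit 1)
    have h₂ := Exec.query (E := E) (s := s₁) 6 4
    have hq : {i : Fin n | s₁.arr 4 i ≠ 0} = insert f (supp s 4) := supp_setArr_one 4 f
    rw [hE, hq] at h₂
    by_cases hi : M.Indep (insert f (supp s 4))
    · rw [if_pos hi] at h₂
      refine ⟨_, (Exec.branch_pos (by simpa [Expr.eval, hs] using h) (h₁.seq (h₂.seq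
        (Exec.branch_pos (by simp [Expr.eval]) (exec_skip E _))))).mono (by lia), .inr ⟨rfl, h, hi⟩⟩
    · rw [if_neg hi] at h₂
      refine ⟨_, (Exec.branch_pos (by simpa [Expr.eval, hs] using h) (h₁.seq (h₂.seq
        (Exec.branch_neg (by simp [Expr.eval]) (Exec.store _ _ _))))).mono (by lia),
        .inl ⟨?_, fun _ => hi⟩⟩
      funext j
      by_cases hj : j = f
      · subst hj; simp [Expr.eval, hs₁, hs, hf]
      · simp [Expr.eval, hs₁, hs, hj]

/-- The greedy algorithm computes a basis. -/
lemma exec_greedy (hE : E.indep = M.Indep) (hM : M.E = Set.univ) (hs : s.var 0 = n) :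
    ∃ s', Exec E greedy s (14 * n + 7) s' ∧ M.IsBasis (supp s' 4) (supp s 3) ∧
      ∀ i < n, s'.arr 4 i ≤ 1 := by
  obtain ⟨s₁, h₁, hz⟩ := exec_fill E s hs 4 0
  have h3 : s₁.arr 3 = s.arr 3 := h₁.frame.arr 3 (by decide)
  obtain ⟨s₂, h₂, hI₁, hI₂, hI₃, hI₄, hI₅⟩ := exec_forLoop (E := E) (v := 4) (b := .var 0)
    (p := greedyStep) (s := s₁) (T := 7) n
    (fun f s' => M.Indep (supp s' 4) ∧ (supp s' 4 : Set (Fin n)) ⊆ {i | i ∈ supp s 3 ∧ (i : ℕ) < f} ∧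
      {i | i ∈ (supp s 3 : Set (Fin n)) ∧ (i : ℕ) < f} ⊆ M.closure (supp s' 4) ∧
      (∀ i < n, s'.arr 4 i ≤ 1) ∧ ∀ i < n, f ≤ i → s'.arr 4 i = 0) (by decide)
    (fun s' hf => (hf.var 0 (by decide)).trans
      ((h₁.frame.var 0 (by decide)).trans hs))
    (by
      have h0 : (supp (s₁.setVar 4 0) 4 : Set (Fin n)) = ∅ := by
        ext i; simp [hz i i.2]
      rw [h0]
      refine ⟨M.empty_indep, by simp, by simp, fun i hi => ?_, fun i hi _ => ?_⟩ <;>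
        simp [hz i hi])
    (fun f s' hf hv hfr ⟨hI₁, hI₂, hI₃, hI₄, hI₅⟩ => by
      have hs3 : (supp s' 3 : Set (Fin n)) = supp s 3 :=
        supp_congr ((hfr.arr 3 (by decide)).trans h3)
      obtain ⟨s'', h, hcase⟩ := exec_greedyStep (s := s') hE (f := ⟨f, hf⟩) hv (hI₅ f hf le_rfl)
      have hsplit : ∀ i : Fin n, (i : ℕ) < f + 1 ↔ (i : ℕ) < f ∨ i = ⟨f, hf⟩ := fun i => by
        rw [Fin.ext_iff]; lia
      refine ⟨s'', h, ?_⟩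
      rw [supp_setVar]
      rcases hcase with ⟨harr, hni⟩ | ⟨harr, hmem, hi⟩
      · rw [supp_congr harr]
        refine ⟨hI₁, fun i hi => ⟨(hI₂ hi).1, by have := (hI₂ hi).2; lia⟩, ?_, ?_, ?_⟩
        · rintro i ⟨hi3, hi⟩
          rcases (hsplit i).1 hi with hlt | rfl
          · exact hI₃ ⟨hi3, hlt⟩
          · by_contra hcl
            rw [← hs3] at hi3
            exact hni hi3 (hI₁.insert_indep_iff.2 (.inl ⟨by simp [hM], hcl⟩))
        · intro i hi; simpa [harr] using hI₄ i hi
        · intro i hi hfi; simpa [harr] using hI₅ i hi (by lia)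
      · rw [supp_congr harr, supp_setArr_one 4 (⟨f, hf⟩ : Fin n)]
        refine ⟨hi, ?_, ?_, ?_, ?_⟩
        · refine Set.insert_subset ⟨hs3 ▸ hmem, by simp⟩ fun i hi => ⟨(hI₂ hi).1, ?_⟩
          have := (hI₂ hi).2; lia
        · rintro i ⟨hi3, hi'⟩
          rcases (hsplit i).1 hi' with hlt | rfl
          · exact M.closure_subset_closure (Set.subset_insert _ _) (hI₃ ⟨hi3, hlt⟩)
          · exact M.mem_closure_of_mem (Set.mem_insert _ _)
        · intro i hi
          by_cases h : i = f
          · simp [harr, h]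
          · simpa [harr, h] using hI₄ i hi
        · intro i hi hfi
          have : i ≠ f := by lia
          simpa [harr, this] using hI₅ i hi (by lia))
  have hset : {i | i ∈ (supp s 3 : Set (Fin n)) ∧ (i : ℕ) < n} = supp s 3 := by
    ext i; simp
  rw [hset] at hI₂ hI₃
  exact ⟨s₂, (h₁.seq h₂).mono (by lia), hI₁.isBasis_of_subset_of_subset_closure hI₂ hI₃, hI₄⟩

open Classical in
lemma exec_spanTest (hE : E.indep = M.Indep) (hM : M.E = Set.univ) (hs : s.var 0 = n) {e : Fin n}
    (he : s.var 3 = e) :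
    ∃ s', Exec E spanTest s (14 * n + 13) s' ∧
      s'.var 5 = if e ∈ M.closure (supp s 3 \ {e}) then 0 else 1 := by
  set s₁ := s.setArr 3 e 0
  have h₁ : Exec E (.store 3 (.var 3) (.lit 0)) s 1 s₁ := by
    simpa [Expr.eval, he] using Exec.store (E := E) (s := s) 3 (.var 3) (.lit 0)
  obtain ⟨s₂, h₂, hb, -⟩ := exec_greedy (s := s₁) hE hM hs
  have he₂ : s₂.var 3 = e := (h₂.frame.var 3 (by decide)).trans he
  set s₃ := s₂.setArr 4 e 1
  have h₃ : Exec E (.store 4 (.var 3) (.lit 1)) s₂ 1 s₃ := by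
    simpa [Expr.eval, he₂] using Exec.store (E := E) (s := s₂) 4 (.var 3) (.lit 1)
  have h₄ := Exec.query (E := E) (s := s₃) 5 4
  refine ⟨_, (h₁.seq (h₂.seq (h₃.seq h₄))).mono (by lia), ?_⟩
  have hq : {i : Fin n | s₃.arr 4 i ≠ 0} = insert e (supp s₂ 4) := supp_setArr_one 4 e
  have hs₁ : (supp s₁ 3 : Set (Fin n)) = supp s 3 \ {e} := supp_setArr_zero 3 e
  rw [hs₁] at hb
  have heb : e ∉ (supp s₂ 4 : Set (Fin n)) := fun h => (hb.subset h).2 rfl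
  have hiff : M.Indep (insert e (supp s₂ 4)) ↔ e ∉ M.closure (supp s 3 \ {e}) := by
    rw [hb.indep.insert_indep_iff_of_notMem heb, hM, hb.closure_eq_closure]
    simp
  rw [hE, hq]
  by_cases h : e ∈ M.closure (supp s 3 \ {e}) <;> simp [hiff, h]

lemma exec_binaryLength (E : Env n) (s : Memory) :
    ∃ s', Exec E binaryLength s (7 * s.var 27 + 7) s' ∧ s'.var 8 = (s.var 27).size := by
  have h₁ := Exec.assign (E := E) (s := s) 19 (.lit 1)
  have h₂ := Exec.assign (E := E) (s := s.setVar 19 1) 8 (.lit 0)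
  set s₂ := (s.setVar 19 1).setVar 8 0 with hs₂
  obtain ⟨s₃, h₃, hI₁, hI₂, hI₃⟩ := exec_forLoop (E := E) (v := 4) (b := .var 27)
    (p := .branch (.sub (.add (.var 27) (.lit 1)) (.var 19))
      (.seq (.assign 19 (.add (.var 19) (.var 19))) (.assign 8 (.add (.var 8) (.lit 1)))) skip)
    (s := s₂) (T := 4) (s.var 27)
    (fun i s' => s'.var 19 = 2 ^ s'.var 8 ∧ s'.var 8 ≤ (s.var 27).size ∧
      (s'.var 8 = i ∨ s'.var 8 = (s.var 27).size)) (by decide)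
    (fun s' hf => (hf.var 27 (by decide)).trans (by simp [hs₂]))
    (by simp [hs₂])
    (fun i s' hi hv hfr ⟨hI₁, hI₂, hI₃⟩ => by
      have h27 : s'.var 27 = s.var 27 := (hfr.var 27 (by decide)).trans (by simp [hs₂])
      by_cases hlt : s'.var 8 < (s.var 27).size
      · have hle := Nat.lt_size.1 hlt
        refine ⟨_, Exec.branch_pos (by simp [Expr.eval, h27, hI₁]; lia)
          ((Exec.assign _ _).seq (Exec.assign _ _)), ?_, ?_, ?_⟩
        · simp [Expr.eval, hI₁, pow_succ]; ring
        · simpa [Expr.eval] using hlt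
        · left; simp [Expr.eval]; lia
      · have heq : s'.var 8 = (s.var 27).size := by lia
        have hle := Nat.size_le.1 heq.ge
        refine ⟨_, (Exec.branch_neg (by simp [Expr.eval, h27, hI₁]; lia)
          (exec_skip E _)).mono (by lia), ?_, ?_, ?_⟩
        · simpa using hI₁
        · simpa using hI₂
        · right; simpa using heq)
  refine ⟨s₃, (h₁.seq (h₂.seq h₃)).mono (by lia), ?_⟩
  rcases hI₃ with h | h
  · have : (s.var 27).size ≤ s.var 27 := Nat.size_le.2 Nat.lt_two_pow_self
    lia
  · exact h

lemma exec_rankProg (hE : E.indep = M.Indep) (hM : M.E = Set.univ) (hs : s.var 0 = n) :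
    ∃ s', Exec E rankProg s (22 * n + 17) s' ∧ s'.var 27 = rank M := by
  obtain ⟨s₁, h₁, h1⟩ := exec_fill E s hs 3 1
  have hn₁ : s₁.var 0 = n := (h₁.frame.var 0 (by decide)).trans hs
  obtain ⟨s₂, h₂, hb, hle⟩ := exec_greedy (s := s₁) hE hM hn₁
  have hn₂ : s₂.var 0 = n := (h₂.frame.var 0 (by decide)).trans hn₁
  have h₃ := Exec.assign (E := E) (s := s₂) 27 (.lit 0)
  obtain ⟨s₄, h₄, hI⟩ := exec_forLoop (E := E) (v := 4) (b := .var 0)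
    (p := .assign 27 (.add (.var 27) (.get 4 (.var 4)))) (s := s₂.setVar 27 0) (T := 1) n
    (fun i s' => s'.var 27 = ∑ j ∈ Finset.range i, s₂.arr 4 j) (by decide)
    (fun s' hf => (hf.var 0 (by decide)).trans (by simpa using hn₂)) (by simp)
    (fun i s' _ hv hfr hI => ⟨_, Exec.assign _ _, by
      have : s'.arr 4 = s₂.arr 4 := (hfr.arr 4 (by decide)).trans rfl
      simp [Expr.eval, hI, hv, this, Finset.sum_range_succ]⟩)
  refine ⟨s₄, (h₁.seq (h₂.seq (h₃.seq h₄))).mono (by lia), ?_⟩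
  classical
  have huniv : (supp s₁ 3 : Set (Fin n)) = M.E := by
    rw [hM]; ext i; simp [h1 i i.2]
  rw [huniv] at hb
  have hbase := (Matroid.isBasis_ground_iff.1 hb).encard_eq_eRank
  rw [hI, rank, ← hbase, Finset.sum_range, Set.encard_eq_coe_toFinset_card, ENat.toNat_natCast,
    Finset.card_eq_sum_ones, ← Finset.sum_subset (Finset.subset_univ (supp s₂ 4).toFinset)]
  · refine Finset.sum_congr rfl fun i hi => ?_
    have h1 := hle i i.2
    have h2 : s₂.arr 4 i ≠ 0 := by simpa using hi
    lia
  · intro i _ hi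
    simpa using hi

end

/-! ### The layers of the setup -/

/-- Draw the thinned samples of a layer, restricted to the set in array `7`, into array `5`.
Membership in all three sets is the sum of three bits, minus two. -/
def sampling : Prog :=
  .seq (.assign 16 (.lit 0)) (forLoop 15 (.var 13) (.seq
    (forLoop 3 (.var 0) (.seq (.flip 23) (.seq (.look 24 (.var 20) (.var 3)) (.seq
      (.store 5 (.var 16) (.sub (.add (.add (.var 23) (.var 24)) (.get 7 (.var 3))) (.lit 2)))
      (.assign 16 (.add (.var 16) (.lit 1)))))))
    (.assign 20 (.add (.var 20) (.lit 1)))))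

/-- Flip a block of `g` coins; variable `22` counts how many of them show `true`. -/
def coinBlock (g : ℕ) : Prog :=
  .seq (.assign 22 (.lit 0)) (forLoop 26 (.lit g)
    (.seq (.flip 23) (.assign 22 (.add (.var 22) (.var 23)))))

/-- Draw the threshold of a layer into variable `14`. -/
def threshold (a g : ℕ) : Prog :=
  .seq (.assign 14 (.times (a + 1) (.var 12))) (.seq (.assign 21 (.lit 1))
    (forLoop 25 (.var 12) (.seq (coinBlock g) (.seq (.branch (.var 22) skip (.assign 21 (.lit 0)))
      (.assign 14 (.add (.var 14) (.var 21)))))))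

/-- Store in array `3` the union of the set in array `6` and of the sample in array `5` that starts
at position `16`, and advance this position to the next sample. -/
def loadSample : Prog :=
  forLoop 4 (.var 0) (.seq (.store 3 (.var 4) (.add (.get 5 (.var 16)) (.get 6 (.var 4))))
    (.assign 16 (.add (.var 16) (.lit 1))))

/-- Add the element in variable `3` to the set in array `6` if it is eligible. Variable `17` counts
the samples that span it. -/
def eligibleTest : Prog :=
  .seq (.assign 17 (.lit 0)) (.seq (.assign 16 (.lit 0)) (.seq
    (forLoop 15 (.var 13) (.seq loadSample (.seq spanTest
      (.assign 17 (.add (.var 17) (.sub (.lit 1) (.var 5)))))))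
    (.branch (.sub (.var 17) (.var 14)) (.store 6 (.var 3) (.lit 1)) skip)))

/-- Test all elements once. -/
def sweep : Prog := forLoop 3 (.var 0) (.branch (.get 7 (.var 3)) eligibleTest skip)

/-- Compute the hull in array `6`. -/
def hullProg : Prog := .seq (fill 6 0) (forLoop 18 (.var 0) sweep)

/-- Replace the set in array `7` by the one in array `6`, and count in array `0` for every element
the layers that it survives. -/
def advance : Prog :=
  forLoop 3 (.var 0) (.seq (.store 0 (.var 3) (.add (.get 0 (.var 3)) (.get 6 (.var 3))))
    (.store 7 (.var 3) (.get 6 (.var 3))))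

/-- A layer of the setup. -/
def layerProg (a g : ℕ) : Prog :=
  .seq sampling (.seq (threshold a g) (.seq hullProg advance))

section

variable {n m K : ℕ} {E : Env n} {M : Matroid (Fin n)} {s s' : Memory}

/-- The set of elements that are kept in a sample, given the positions of the sample and of the
coins. -/
def keptSet (E : Env n) (b c : ℕ) : Set (Fin n) := {e | E.sample b e ∧ E.coin (c + e) = true}

lemma exec_sampling (hn : s.var 0 = n) (hm : s.var 13 = m) (h7 : ∀ e < n, s.arr 7 e ≤ 1) :
    ∃ s', Exec E sampling s (m * (10 * n + 8) + 5) s' ∧ s'.var 20 = s.var 20 + m ∧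
      s'.coinsUsed = s.coinsUsed + m * n ∧ ∀ j < m, ∀ e : Fin n, s'.arr 5 (j * n + e) ≠ 0 ↔
        e ∈ (supp s 7 : Set (Fin n)) ∧ e ∈ keptSet E (s.var 20 + j) (s.coinsUsed + j * n) := by
  classical
  let val : ℕ → ℕ → ℕ := fun j e => (E.coin (s.coinsUsed + (j * n + e))).toNat +
    (if E.sample (s.var 20 + j) e then 1 else 0) + s.arr 7 e - 2
  have h₁ := Exec.assign (E := E) (s := s) 16 (.lit 0)
  obtain ⟨s₂, h₂, hI₁, hI₂, hI₃, hI₄⟩ := exec_forLoop (E := E) (v := 15) (b := .var 13)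
    (p := .seq
      (forLoop 3 (.var 0) (.seq (.flip 23) (.seq (.look 24 (.var 20) (.var 3)) (.seq
        (.store 5 (.var 16) (.sub (.add (.add (.var 23) (.var 24)) (.get 7 (.var 3))) (.lit 2)))
        (.assign 16 (.add (.var 16) (.lit 1)))))))
      (.assign 20 (.add (.var 20) (.lit 1)))) (s := s.setVar 16 0) (T := n * 10 + 5) m
    (fun j s' => s'.var 16 = j * n ∧ s'.var 20 = s.var 20 + j ∧
      s'.coinsUsed = s.coinsUsed + j * n ∧
      ∀ j' e', e' < n → j' * n + e' < j * n → s'.arr 5 (j' * n + e') = val j' e') (by decide)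
    (fun s' hf => (hf.var 13 (by decide)).trans (by simpa using hm)) (by simp)
    (fun j s' hj hv hfr ⟨hI₁, hI₂, hI₃, hI₄⟩ => by
      have hn' : s'.var 0 = n := (hfr.var 0 (by decide)).trans (by simpa using hn)
      have h7' : s'.arr 7 = s.arr 7 := (hfr.arr 7 (by decide)).trans rfl
      obtain ⟨s'', h, hJ₁, hJ₂, hJ₃⟩ := exec_forLoop (E := E) (v := 3) (b := .var 0)
        (p := .seq (.flip 23) (.seq (.look 24 (.var 20) (.var 3)) (.seq
          (.store 5 (.var 16) (.sub (.add (.add (.var 23) (.var 24)) (.get 7 (.var 3))) (.lit 2)))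
          (.assign 16 (.add (.var 16) (.lit 1)))))) (s := s') (T := 7) n
        (fun e s'' => s''.var 16 = j * n + e ∧ s''.coinsUsed = s.coinsUsed + (j * n + e) ∧
          ∀ j' e', e' < n → j' * n + e' < j * n + e → s''.arr 5 (j' * n + e') = val j' e')
        (by decide) (fun s'' hf => (hf.var 0 (by decide)).trans hn')
        (by simpa [hI₁, hI₃] using hI₄)
        (fun e s'' he hv' hfr' ⟨hJ₁, hJ₂, hJ₃⟩ => by
          have h20 : s''.var 20 = s.var 20 + j := (hfr'.var 20 (by decide)).trans hI₂
          have h7'' : s''.arr 7 = s.arr 7 := (hfr'.arr 7 (by decide)).trans h7'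
          refine ⟨_, ((Exec.flip _).seq ((Exec.look _ _ _).seq ((Exec.store _ _ _).seq
            (Exec.assign _ _)))).mono (by lia), ?_, ?_, ?_⟩
          · simp [Expr.eval, hJ₁]; ring
          · simp [hJ₂]; ring
          · intro j' e' he' hlt
            by_cases heq : j' * n + e' = j * n + e
            · obtain ⟨rfl, rfl⟩ := mul_add_inj he' he heq
              simp [Expr.eval, hJ₁, hJ₂, hv', h20, h7'', val]
            · simp [Expr.eval, hJ₁, heq, hJ₃ j' e' he' (by lia)])
      have h20 : s''.var 20 = s.var 20 + j := (h.frame.var 20 (by decide)).trans hI₂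
      refine ⟨_, (h.seq (Exec.assign _ _)).mono (by lia), ?_, ?_, ?_, ?_⟩
      · simp [hJ₁]; ring
      · simp [Expr.eval, h20]; ring
      · simp [hJ₂]; ring
      · intro j' e' he' hlt
        simp [hJ₃ j' e' he' (by rw [add_mul] at hlt; lia)])
  refine ⟨s₂, (h₁.seq h₂).mono (by ring_nf; lia), hI₂, hI₃, fun j hj e => ?_⟩
  rw [hI₄ j e e.2 (mul_add_lt hj e.2)]
  have := h7 e e.2
  simp only [val, mem_supp, keptSet, Set.mem_ofPred_eq, ← add_assoc]
  rcases Bool.eq_false_or_eq_true (E.coin (s.coinsUsed + j * n + e)) with hc | hc <;>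
    by_cases hs : E.sample (s.var 20 + j) e <;> simp [hc, hs] <;> lia

lemma exec_coinBlock (g : ℕ) :
    ∃ s', Exec E (coinBlock g) s (6 * g + 5) s' ∧ s'.coinsUsed = s.coinsUsed + g ∧
      (s'.var 22 ≠ 0 ↔ ∃ x : Fin g, E.coin (s.coinsUsed + x) = true) := by
  have h₁ := Exec.assign (E := E) (s := s) 22 (.lit 0)
  obtain ⟨s₂, h₂, hI₁, hI₂⟩ := exec_forLoop (E := E) (v := 26) (b := .lit g)
    (p := .seq (.flip 23) (.assign 22 (.add (.var 22) (.var 23)))) (s := s.setVar 22 0) (T := 3) g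
    (fun x s' => s'.coinsUsed = s.coinsUsed + x ∧
      (s'.var 22 ≠ 0 ↔ ∃ x' < x, E.coin (s.coinsUsed + x') = true))
    (by decide) (fun s' _ => rfl) (by simp)
    (fun x s' hx hv hfr ⟨hI₁, hI₂⟩ => by
      refine ⟨_, ((Exec.flip _).seq (Exec.assign _ _)).mono (by lia), ?_, ?_⟩
      · simp [hI₁]; ring
      · have h3 : (∃ x' < x + 1, E.coin (s.coinsUsed + x') = true) ↔
            (∃ x' < x, E.coin (s.coinsUsed + x') = true) ∨ E.coin (s.coinsUsed + x) = true := by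
          constructor
          · rintro ⟨x', hlt, h⟩
            rcases Nat.lt_succ_iff_lt_or_eq.1 hlt with hlt | rfl
            · exact .inl ⟨x', hlt, h⟩
            · exact .inr h
          · rintro (⟨x', hlt, h⟩ | h)
            · exact ⟨x', by lia, h⟩
            · exact ⟨x, by lia, h⟩
        rw [h3, ← hI₂]
        rcases Bool.eq_false_or_eq_true (E.coin (s.coinsUsed + x)) with hc | hc <;>
          simp [Expr.eval, hI₁, hc])
  refine ⟨s₂, (h₁.seq h₂).mono (by lia), hI₁, hI₂.trans ?_⟩
  exact ⟨fun ⟨x, hx, h⟩ => ⟨⟨x, hx⟩, h⟩, fun ⟨x, h⟩ => ⟨x, x.2, h⟩⟩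

lemma coinBlock_vars (g : ℕ) : (coinBlock g).vars = [22, 26, 23, 22, 26] := rfl

lemma exec_threshold (a g : ℕ) (hK : s.var 12 = K) :
    ∃ s', Exec E (threshold a g) s (K * (6 * g + 13) + 7) s' ∧
      s'.coinsUsed = s.coinsUsed + K * g ∧ s'.var 14 = (a + 1) * K +
        lead (fun l => ∃ x : Fin g, E.coin (s.coinsUsed + l * g + x) = true) K := by
  classical
  set c : ℕ → Prop := fun l => ∃ x : Fin g, E.coin (s.coinsUsed + l * g + x) = true
  have h₁ := Exec.assign (E := E) (s := s) 14 (.times (a + 1) (.var 12))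
  have h₂ := Exec.assign (E := E) (s := s.setVar 14 ((Expr.times (a + 1) (.var 12)).eval s)) 21
    (.lit 1)
  obtain ⟨s₃, h₃, hI₁, hI₂, -⟩ := exec_forLoop (E := E) (v := 25) (b := .var 12)
    (p := .seq (coinBlock g) (.seq (.branch (.var 22) skip (.assign 21 (.lit 0)))
      (.assign 14 (.add (.var 14) (.var 21)))))
    (s := (s.setVar 14 ((Expr.times (a + 1) (.var 12)).eval s)).setVar 21 1) (T := 6 * g + 10) K
    (fun l s' => s'.coinsUsed = s.coinsUsed + l * g ∧ s'.var 14 = (a + 1) * K + lead c l ∧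
      s'.var 21 = if ∀ l' < l, c l' then 1 else 0)
    (by simp [Prog.vars, coinBlock_vars, skip])
    (fun s' hf => (hf.var 12 (by simp [Prog.vars, coinBlock_vars, skip])).trans (by simpa using hK))
    (by simp [lead, Expr.eval, hK])
    (fun l s' hl hv hfr ⟨hI₁, hI₂, hI₃⟩ => by
      obtain ⟨s₁, h₁, hc₁, hz⟩ := exec_coinBlock (E := E) (s := s') g
      rw [hI₁] at hz
      have h14 : s₁.var 14 = (a + 1) * K + lead c l :=
        (h₁.frame.var 14 (by simp [coinBlock_vars])).trans hI₂
      have h21 : s₁.var 21 = if ∀ l' < l, c l' then 1 else 0 :=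
        (h₁.frame.var 21 (by simp [coinBlock_vars])).trans hI₃
      have hcz : s₁.var 22 ≠ 0 ↔ c l := hz
      have hall : (∀ l' < l + 1, c l') ↔ (∀ l' < l, c l') ∧ c l := by
        simp only [Nat.lt_succ_iff_lt_or_eq]
        exact ⟨fun h => ⟨fun l' h' => h l' (.inl h'), h l (.inr rfl)⟩,
          fun h l' h' => h'.elim (h.1 l') fun h' => h' ▸ h.2⟩
      have hlead : lead c (l + 1) = lead c l + if ∀ l' < l + 1, c l' then 1 else 0 := by
        rw [lead]
        simp only [← Nat.lt_succ_iff, Nat.succ_eq_add_one]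
        split_ifs with h
        · rw [lead_eq_self (hall.1 h).1]
        · rfl
      by_cases hcl : c l
      · have hgo : (if ∀ l' < l + 1, c l' then 1 else 0) = if ∀ l' < l, c l' then 1 else 0 := by
          simp only [hall, hcl, and_true]
        refine ⟨_, (h₁.seq ((Exec.branch_pos (by simpa [Expr.eval] using hcz.2 hcl)
          (exec_skip E _)).seq (Exec.assign _ _))).mono (by lia), ?_, ?_, ?_⟩
        · simp [hc₁, hI₁]; ring
        · rw [hlead, hgo]
          simp [Expr.eval, h14, h21, add_assoc]
        · rw [hgo]
          simp [h21]
      · have hgo : (if ∀ l' < l + 1, c l' then 1 else 0) = 0 := by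
          simp only [hall, hcl, and_false, if_false]
        refine ⟨_, (h₁.seq ((Exec.branch_neg (by simpa [Expr.eval, hcl] using hcz)
          (Exec.assign _ _)).seq (Exec.assign _ _))).mono (by lia), ?_, ?_, ?_⟩
        · simp [hc₁, hI₁]; ring
        · rw [hlead, hgo]
          simp [Expr.eval, h14]
        · rw [hgo]
          simp [Expr.eval])
  exact ⟨s₃, (h₁.seq (h₂.seq h₃)).mono (by ring_nf; lia), hI₁, hI₂⟩

/-- The sample with index `j` that is stored in array `5`. -/
def storedSample (n : ℕ) (s : Memory) (j : ℕ) : Set (Fin n) := {e | s.arr 5 (j * n + e) ≠ 0}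

lemma exec_loadSample (hn : s.var 0 = n) {j : ℕ} (hq : s.var 16 = j * n) :
    ∃ s', Exec E loadSample s (6 * n + 3) s' ∧ s'.var 16 = (j + 1) * n ∧
      (supp s' 3 : Set (Fin n)) = storedSample n s j ∪ supp s 6 := by
  obtain ⟨s₁, h₁, hI₁, hI₂⟩ := exec_forLoop (E := E) (v := 4) (b := .var 0)
    (p := .seq (.store 3 (.var 4) (.add (.get 5 (.var 16)) (.get 6 (.var 4))))
      (.assign 16 (.add (.var 16) (.lit 1)))) (s := s) (T := 3) n
    (fun f s' => s'.var 16 = j * n + f ∧ ∀ f' < f, s'.arr 3 f' = s.arr 5 (j * n + f') + s.arr 6 f')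
    (by decide) (fun s' hf => (hf.var 0 (by decide)).trans hn) (by simp [hq])
    (fun f s' hf hv hfr ⟨hI₁, hI₂⟩ => by
      have h5 : s'.arr 5 = s.arr 5 := hfr.arr 5 (by decide)
      have h6 : s'.arr 6 = s.arr 6 := hfr.arr 6 (by decide)
      refine ⟨_, (Exec.store _ _ _).seq (Exec.assign _ _), ?_, fun f' hf' => ?_⟩
      · simp [Expr.eval, hI₁]; ring
      · by_cases h : f' = f
        · simp [Expr.eval, hI₁, hv, h5, h6, h]
        · simp [Expr.eval, hv, h, hI₂ f' (by lia)])
  refine ⟨s₁, h₁.mono (by lia), by rw [hI₁]; ring, ?_⟩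
  ext f
  simp only [mem_supp, hI₂ f f.2, storedSample, Set.mem_union, Set.mem_ofPred_eq]
  lia

open Classical in
lemma exec_eligibleTest (hE : E.indep = M.Indep) (hM : M.E = Set.univ) (hn : s.var 0 = n)
    (hm : s.var 13 = m) {e : Fin n} (he : s.var 3 = e)
    (hsub : ∀ j < m, storedSample n s j ⊆ supp s 7) :
    ∃ s', Exec E eligibleTest s (m * (20 * n + 22) + 10) s' ∧
      s'.arr 6 = if Eligible M (supp s 7) (storedSample n s) (Finset.range m) (s.var 14)
        (supp s 6) e then (s.setArr 6 e 1).arr 6 else s.arr 6 := by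
  let P : ℕ → Prop := fun j =>
    e ∈ M.closure ((storedSample n s j ∩ supp s 7 ∪ supp s 6) \ {e})
  have h₁ := Exec.assign (E := E) (s := s) 17 (.lit 0)
  have h₂ := Exec.assign (E := E) (s := s.setVar 17 0) 16 (.lit 0)
  obtain ⟨s₃, h₃, -, hI⟩ := exec_forLoop (E := E) (v := 15) (b := .var 13)
    (p := .seq loadSample (.seq spanTest (.assign 17 (.add (.var 17) (.sub (.lit 1) (.var 5))))))
    (s := (s.setVar 17 0).setVar 16 0) (T := 20 * n + 19) m
    (fun j s' => s'.var 16 = j * n ∧ s'.var 17 = ((Finset.range j).filter P).card)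
    (by decide) (fun s' hf => (hf.var 13 (by decide)).trans (by simpa using hm)) (by simp)
    (fun j s' hj hv hfr ⟨hI₁, hI₂⟩ => by
      have hn' : s'.var 0 = n := (hfr.var 0 (by decide)).trans (by simpa using hn)
      have h5 : s'.arr 5 = s.arr 5 := hfr.arr 5 (by decide)
      have h6 : s'.arr 6 = s.arr 6 := hfr.arr 6 (by decide)
      have h3 : s'.var 3 = e := (hfr.var 3 (by decide)).trans (by simpa using he)
      obtain ⟨s₁, h₁, hq, hsup⟩ := exec_loadSample (E := E) (s := s') hn' hI₁
      have hn₁ : s₁.var 0 = n := (h₁.frame.var 0 (by decide)).trans hn'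
      have h31 : s₁.var 3 = e := (h₁.frame.var 3 (by decide)).trans h3
      obtain ⟨s₂, h₂, hr⟩ := exec_spanTest (s := s₁) hE hM hn₁ h31
      have h17 : s₂.var 17 = s'.var 17 :=
        (h₂.frame.var 17 (by decide)).trans (h₁.frame.var 17 (by decide))
      have h16 : s₂.var 16 = (j + 1) * n := (h₂.frame.var 16 (by decide)).trans hq
      have hset : (supp s₁ 3 : Set (Fin n)) = storedSample n s j ∩ supp s 7 ∪ supp s 6 := by
        rw [hsup, supp_congr h6, Set.inter_eq_left.2 (hsub j hj)]
        simp only [storedSample, h5]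
      rw [hset] at hr
      refine ⟨_, (h₁.seq (h₂.seq (Exec.assign _ _))).mono (by lia), by simpa using h16, ?_⟩
      rw [Finset.range_add_one, Finset.filter_insert]
      by_cases hP : P j
      · rw [if_pos hP, Finset.card_insert_of_notMem (by simp)]
        rw [if_pos hP] at hr
        simp [Expr.eval, h17, hI₂, hr]
      · rw [if_neg hP]
        rw [if_neg hP] at hr
        simp [Expr.eval, h17, hI₂, hr])
  have hfr : ∀ a, a ∉ (forLoop 15 (.var 13) (.seq loadSample (.seq spanTest
      (.assign 17 (.add (.var 17) (.sub (.lit 1) (.var 5))))))).arrs → s₃.arr a = s.arr a :=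
    fun a ha => (h₃.frame.arr a ha).trans rfl
  have h14 : s₃.var 14 = s.var 14 := (h₃.frame.var 14 (by decide)).trans (by simp)
  have h3 : s₃.var 3 = e := (h₃.frame.var 3 (by decide)).trans (by simpa using he)
  have hiff : Eligible M (supp s 7) (storedSample n s) (Finset.range m) (s.var 14) (supp s 6) e ↔
      s.var 14 < s₃.var 17 := by
    rw [hI]
    unfold Eligible
    exact Iff.of_eq (by congr)
  by_cases hel : s.var 14 < s₃.var 17
  · rw [if_pos (hiff.2 hel)]
    refine ⟨_, (h₁.seq (h₂.seq (h₃.seq (Exec.branch_pos (by simp [Expr.eval, h14]; lia)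
      (Exec.store _ _ _))))).mono (by ring_nf; lia), ?_⟩
    funext i
    simp [Expr.eval, h3, hfr 6 (by decide)]
  · rw [if_neg (mt hiff.1 hel)]
    refine ⟨_, (h₁.seq (h₂.seq (h₃.seq (Exec.branch_neg (by simp [Expr.eval, h14]; lia)
      (exec_skip E _))))).mono (by ring_nf; lia), ?_⟩
    simp [hfr 6 (by decide)]

/-- After a sweep, the set in array `6` still lies in the hull. Either it has grown, or it is
closed. -/
lemma exec_sweep (hE : E.indep = M.Indep) (hM : M.E = Set.univ) (hn : s.var 0 = n)
    (hm : s.var 13 = m) (hsub : ∀ j < m, storedSample n s j ⊆ supp s 7)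
    (hX : supp s 6 ⊆ hull M (supp s 7) (storedSample n s) (Finset.range m) (s.var 14))
    (hle : ∀ i < n, s.arr 6 i ≤ 1) :
    ∃ s', Exec E sweep s (n * (m * (20 * n + 22) + 14) + 3) s' ∧
      supp s' 6 ⊆ hull M (supp s 7) (storedSample n s) (Finset.range m) (s.var 14) ∧
      (∀ i < n, s'.arr 6 i ≤ 1) ∧ (supp s 6 : Set (Fin n)) ⊆ supp s' 6 ∧
      ((supp s' 6 : Set (Fin n)) = supp s 6 → ∀ e : Fin n, e ∈ (supp s 7 : Set (Fin n)) →
        Eligible M (supp s 7) (storedSample n s) (Finset.range m) (s.var 14) (supp s 6) e →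
          e ∈ (supp s 6 : Set (Fin n))) := by
  classical
  obtain ⟨s₁, h₁, hI₁, hI₂, hI₃, hI₄⟩ := exec_forLoop (E := E) (v := 3) (b := .var 0)
    (p := .branch (.get 7 (.var 3)) eligibleTest skip) (s := s)
    (T := m * (20 * n + 22) + 11) n
    (fun f s' => supp s' 6 ⊆ hull M (supp s 7) (storedSample n s) (Finset.range m) (s.var 14) ∧
      (∀ i < n, s'.arr 6 i ≤ 1) ∧ (supp s 6 : Set (Fin n)) ⊆ supp s' 6 ∧
      ((supp s' 6 : Set (Fin n)) = supp s 6 → ∀ e : Fin n, (e : ℕ) < f →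
        e ∈ (supp s 7 : Set (Fin n)) →
        Eligible M (supp s 7) (storedSample n s) (Finset.range m) (s.var 14) (supp s 6) e →
          e ∈ (supp s 6 : Set (Fin n)))) (by decide)
    (fun s' hf => (hf.var 0 (by decide)).trans hn)
    ⟨hX, hle, subset_rfl, by simp⟩
    (fun f s' hf hv hfr ⟨hI₁, hI₂, hI₃, hI₄⟩ => by
      have hn' : s'.var 0 = n := (hfr.var 0 (by decide)).trans hn
      have hm' : s'.var 13 = m := (hfr.var 13 (by decide)).trans hm
      have h14 : s'.var 14 = s.var 14 := hfr.var 14 (by decide)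
      have h5 : s'.arr 5 = s.arr 5 := hfr.arr 5 (by decide)
      have h7 : s'.arr 7 = s.arr 7 := hfr.arr 7 (by decide)
      have hT : storedSample n s' = storedSample n s := by
        funext j; simp only [storedSample, h5]
      have hsplit : ∀ i : Fin n, (i : ℕ) < f + 1 ↔ (i : ℕ) < f ∨ i = ⟨f, hf⟩ := fun i => by
        rw [Fin.ext_iff]; lia
      by_cases h7f : s.arr 7 f = 0
      · refine ⟨_, (Exec.branch_neg (by simpa [Expr.eval, hv, h7] using h7f)
          (exec_skip E _)).mono (by lia), hI₁, hI₂, hI₃, fun heq e hlt he hel => ?_⟩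
        rcases (hsplit e).1 hlt with hlt | rfl
        · exact hI₄ heq e hlt he hel
        · exact absurd h7f he
      · obtain ⟨s'', h, h6⟩ := exec_eligibleTest (s := s') hE hM hn' hm' (e := ⟨f, hf⟩) hv
          (by rw [hT, supp_congr h7]; exact hsub)
        rw [hT, supp_congr h7, h14] at h6
        refine ⟨s'', Exec.branch_pos (by simpa [Expr.eval, hv, h7] using h7f) h, ?_⟩
        rw [supp_setVar]
        by_cases hel : Eligible M (supp s 7) (storedSample n s) (Finset.range m) (s.var 14)
            (supp s' 6) ⟨f, hf⟩
        · rw [if_pos hel] at h6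
          rw [supp_congr h6, supp_setArr_one 6 (⟨f, hf⟩ : Fin n)]
          refine ⟨Set.insert_subset (hull_closed h7f (hel.mono hI₁)) hI₁, fun i hi => ?_,
            hI₃.trans (Set.subset_insert _ _), fun heq e hlt he hel' => ?_⟩
          · by_cases hif : i = f
            · simp [h6, hif]
            · simpa [h6, hif] using hI₂ i hi
          · have heq' : (supp s' 6 : Set (Fin n)) = supp s 6 :=
              ((Set.subset_insert _ _).trans heq.le).antisymm hI₃
            rcases (hsplit e).1 hlt with hlt | rfl
            · exact hI₄ heq' e hlt he hel'
            · exact heq ▸ Set.mem_insert _ _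
        · rw [if_neg hel] at h6
          rw [supp_congr h6]
          refine ⟨hI₁, fun i hi => by simpa [h6] using hI₂ i hi, hI₃, fun heq e hlt he hel' => ?_⟩
          rcases (hsplit e).1 hlt with hlt | rfl
          · exact hI₄ heq e hlt he hel'
          · rw [heq] at hel
            exact absurd hel' hel)
  exact ⟨s₁, h₁.mono (by lia), hI₁, hI₂, hI₃, fun heq e he hel => hI₄ heq e e.2 he hel⟩

/-- The running time of the computation of a hull. -/
def hullCost {R : Type*} [CommSemiring R] (n m : R) : R :=
  4 * n + n * (n * (m * (20 * n + 22) + 14) + 6) + 7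

/-- As long as the set in array `6` is not closed, it grows in every sweep. Hence it is closed after
`n` sweeps. -/
lemma exec_hullProg (hE : E.indep = M.Indep) (hM : M.E = Set.univ) (hn : s.var 0 = n)
    (hm : s.var 13 = m) (hsub : ∀ j < m, storedSample n s j ⊆ supp s 7) :
    ∃ s', Exec E hullProg s (hullCost n m) s' ∧
      supp s' 6 = hull M (supp s 7) (storedSample n s) (Finset.range m) (s.var 14) ∧
      ∀ i < n, s'.arr 6 i ≤ 1 := by
  obtain ⟨s₁, h₁, hz⟩ := exec_fill E s hn 6 0
  have hn₁ : s₁.var 0 = n := (h₁.frame.var 0 (by decide)).trans hn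
  have hm₁ : s₁.var 13 = m := (h₁.frame.var 13 (by decide)).trans hm
  have h14₁ : s₁.var 14 = s.var 14 := h₁.frame.var 14 (by decide)
  have h5₁ : s₁.arr 5 = s.arr 5 := h₁.frame.arr 5 (by decide)
  have h7₁ : s₁.arr 7 = s.arr 7 := h₁.frame.arr 7 (by decide)
  obtain ⟨s₂, h₂, hI₁, hI₂, hI₃⟩ := exec_forLoop (E := E) (v := 18) (b := .var 0)
    (p := sweep) (s := s₁) (T := n * (m * (20 * n + 22) + 14) + 3) n
    (fun r s' => supp s' 6 ⊆ hull M (supp s 7) (storedSample n s) (Finset.range m) (s.var 14) ∧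
      (∀ i < n, s'.arr 6 i ≤ 1) ∧ (r ≤ (supp s' 6 : Set (Fin n)).ncard ∨
      ∀ e : Fin n, e ∈ (supp s 7 : Set (Fin n)) →
        Eligible M (supp s 7) (storedSample n s) (Finset.range m) (s.var 14) (supp s' 6) e →
          e ∈ (supp s' 6 : Set (Fin n)))) (by decide)
    (fun s' hf => (hf.var 0 (by decide)).trans hn₁)
    ⟨fun e he => absurd (hz e e.2) he, fun i hi => by simp [hz i hi], .inl (Nat.zero_le _)⟩
    (fun r s' _ hv hfr ⟨hI₁, hI₂, hI₃⟩ => by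
      have hn' : s'.var 0 = n := (hfr.var 0 (by decide)).trans hn₁
      have hm' : s'.var 13 = m := (hfr.var 13 (by decide)).trans hm₁
      have h14 : s'.var 14 = s.var 14 := (hfr.var 14 (by decide)).trans h14₁
      have h5 : s'.arr 5 = s.arr 5 := (hfr.arr 5 (by decide)).trans h5₁
      have h7 : s'.arr 7 = s.arr 7 := (hfr.arr 7 (by decide)).trans h7₁
      have hT : storedSample n s' = storedSample n s := by
        funext j; simp only [storedSample, h5]
      obtain ⟨s'', h, hJ₁, hJ₂, hJ₃, hJ₄⟩ := exec_sweep (s := s') hE hM hn' hm'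
        (by rw [hT, supp_congr h7]; exact hsub) (by rw [hT, supp_congr h7, h14]; exact hI₁) hI₂
      rw [hT, supp_congr h7, h14] at hJ₁ hJ₄
      refine ⟨s'', h, hJ₁, hJ₂, ?_⟩
      rw [supp_setVar]
      by_cases heq : (supp s'' 6 : Set (Fin n)) = supp s' 6
      · rw [heq]
        exact .inr (hJ₄ heq)
      · rcases hI₃ with hcard | hclosed
        · left
          have := Set.ncard_lt_ncard (hJ₃.ssubset_of_ne (Ne.symm heq)) (Set.toFinite _)
          lia
        · exact absurd ((hJ₁.trans (hull_subset_of_closed hclosed)).antisymm hJ₃) heq)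
  refine ⟨s₂, (h₁.seq h₂).mono (by simp only [hullCost]; lia), ?_, hI₂⟩
  refine hI₁.antisymm (hull_subset_of_closed fun e he hel => ?_)
  rcases hI₃ with hcard | hclosed
  · have : (supp s₂ 6 : Set (Fin n)) = Set.univ :=
      Set.eq_of_subset_of_ncard_le (Set.subset_univ _) (by simpa [Set.ncard_univ] using hcard)
    rw [this]
    exact Set.mem_univ e
  · exact hclosed e he hel

lemma exec_advance (hn : s.var 0 = n) :
    ∃ s', Exec E advance s (6 * n + 3) s' ∧
      ∀ i < n, s'.arr 0 i = s.arr 0 i + s.arr 6 i ∧ s'.arr 7 i = s.arr 6 i := by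
  obtain ⟨s₁, h₁, hI₁, -⟩ := exec_forLoop (E := E) (v := 3) (b := .var 0)
    (p := .seq (.store 0 (.var 3) (.add (.get 0 (.var 3)) (.get 6 (.var 3))))
      (.store 7 (.var 3) (.get 6 (.var 3)))) (s := s) (T := 3) n
    (fun f s' => (∀ i < f, s'.arr 0 i = s.arr 0 i + s.arr 6 i ∧ s'.arr 7 i = s.arr 6 i) ∧
      ∀ i ≥ f, s'.arr 0 i = s.arr 0 i) (by decide)
    (fun s' hf => (hf.var 0 (by decide)).trans hn) (by simp)
    (fun f s' hf hv hfr ⟨hI₁, hI₂⟩ => by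
      have h6 : s'.arr 6 = s.arr 6 := hfr.arr 6 (by decide)
      refine ⟨_, (Exec.store _ _ _).seq (Exec.store _ _ _), fun i hi => ?_, fun i hi => ?_⟩
      · by_cases h : i = f
        · simp [Expr.eval, hv, h, h6, hI₂ f le_rfl]
        · simpa [Expr.eval, hv, h] using hI₁ i (by lia)
      · have : i ≠ f := by lia
        simpa [Expr.eval, hv, this] using hI₂ i (by lia))
  exact ⟨s₁, h₁.mono (by lia), hI₁⟩

end

/-! ### The setup -/

/-- The number of layers, as a function of the rank. -/
def layerNum (d r : ℕ) : ℕ := d * (r.size + 1)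

/-- The number of blocks of coins in a layer, as a function of the number of layers. -/
def blockNum (κ D : ℕ) : ℕ := κ * (D.size + 1)

/-- Flip the coins for the active elements. -/
def thinProg : Prog := forLoop 3 (.var 0) (.seq (.flip 23) (.store 1 (.var 3) (.var 23)))

/-- Compute the number of layers, the number of blocks and the number of samples in a layer. -/
def parameterProg (a d κ : ℕ) : Prog :=
  .seq rankProg (.seq binaryLength (.seq (.assign 11 (.times d (.add (.var 8) (.lit 1))))
    (.seq (.assign 27 (.var 11)) (.seq binaryLength
      (.seq (.assign 12 (.times κ (.add (.var 8) (.lit 1)))) (.assign 13 (.times (2 * a) (.var 12))))))))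

/-- The program that is run before the first arrival. -/
def setupProg (a g d κ : ℕ) : Prog :=
  .seq (parameterProg a d κ) (.seq thinProg (.seq (fill 7 1) (.seq (.assign 20 (.lit 0))
    (forLoop 10 (.var 11) (layerProg a g)))))

/-- The running time of a layer of the setup. -/
def layerCost {R : Type*} [CommSemiring R] (g : R) (n m K : R) : R :=
  m * (10 * n + 8) + K * (6 * g + 13) + hullCost n m + 6 * n + 18

/-- The running time of the setup. -/
def setupCost {R : Type*} [CommSemiring R] (g : R) (n D m K : R) : R :=
  39 * n + 7 * D + D * (layerCost g n m K + 3) + 60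

section

variable {n m K : ℕ} {E : Env n} {M : Matroid (Fin n)} {s s' : Memory}

/-- The step of the chain that the layer with index `i` of the setup performs. -/
noncomputable def envStep (M : Matroid (Fin n)) (E : Env n) (a g m K i : ℕ) (A : Set (Fin n)) :
    Set (Fin n) :=
  hull M A (fun j => keptSet E (i * m + j) (n + i * layerCoins n m K g + j * n)) (Finset.range m)
    ((a + 1) * K + lead (fun l => ∃ x : Fin g,
      E.coin (n + i * layerCoins n m K g + m * n + l * g + x) = true) K)

lemma threshold_vars (a g : ℕ) :
    (threshold a g).vars = [14, 21, 25, 22, 26, 23, 22, 26, 9, 21, 14, 25] := rfl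

lemma threshold_arrs (a g : ℕ) : (threshold a g).arrs = [] := rfl

lemma layerProg_vars (a g : ℕ) : (layerProg a g).vars =
    sampling.vars ++ ((threshold a g).vars ++ (hullProg.vars ++ advance.vars)) := rfl

lemma exec_layerProg (hE : E.indep = M.Indep) (hM : M.E = Set.univ) (hn : s.var 0 = n)
    (hK : s.var 12 = K) (hm : s.var 13 = m) (a g i : ℕ) (hb : s.var 20 = i * m)
    (hc : s.coinsUsed = n + i * layerCoins n m K g) (h7 : ∀ e < n, s.arr 7 e ≤ 1) :
    ∃ s', Exec E (layerProg a g) s (layerCost g n m K) s' ∧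
      supp s' 7 = envStep M E a g m K i (supp s 7) ∧ s'.var 20 = (i + 1) * m ∧
      s'.coinsUsed = n + (i + 1) * layerCoins n m K g ∧ (∀ e < n, s'.arr 7 e ≤ 1) ∧
      ∀ e < n, s'.arr 0 e = s.arr 0 e + s'.arr 7 e := by
  obtain ⟨s₁, h₁, hb₁, hc₁, hT₁⟩ := exec_sampling (E := E) hn hm h7
  have h7₁ : s₁.arr 7 = s.arr 7 := h₁.frame.arr 7 (by decide)
  have h0₁ : s₁.arr 0 = s.arr 0 := h₁.frame.arr 0 (by decide)
  obtain ⟨s₂, h₂, hc₂, ht₂⟩ := exec_threshold (E := E) (s := s₁) (K := K) a g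
    ((h₁.frame.var 12 (by decide)).trans hK)
  have harr₂ : ∀ b, s₂.arr b = s₁.arr b := fun b => h₂.frame.arr b (by simp [threshold_arrs])
  have hn₂ : s₂.var 0 = n := (h₂.frame.var 0 (by simp [threshold_vars])).trans
    ((h₁.frame.var 0 (by decide)).trans hn)
  have hm₂ : s₂.var 13 = m := (h₂.frame.var 13 (by simp [threshold_vars])).trans
    ((h₁.frame.var 13 (by decide)).trans hm)
  have hT₂ : ∀ j < m, storedSample n s₂ j =
      keptSet E (i * m + j) (n + i * layerCoins n m K g + j * n) ∩ supp s 7 := by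
    intro j hj
    ext e
    rw [storedSample, Set.mem_ofPred_eq, harr₂, hT₁ j hj e, hb, hc, Set.mem_inter_iff, and_comm]
  have h7₂ : (supp s₂ 7 : Set (Fin n)) = supp s 7 := supp_congr ((harr₂ 7).trans h7₁)
  obtain ⟨s₃, h₃, hS₃, hle₃⟩ := exec_hullProg (s := s₂) hE hM hn₂ hm₂
    (fun j hj => by rw [hT₂ j hj, h7₂]; exact Set.inter_subset_right)
  have h0₃ : s₃.arr 0 = s.arr 0 :=
    (h₃.frame.arr 0 (by decide)).trans ((harr₂ 0).trans h0₁)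
  obtain ⟨s₄, h₄, hadv⟩ := exec_advance (E := E) (s := s₃) ((h₃.frame.var 0 (by decide)).trans hn₂)
  have hS₄ : (supp s₄ 7 : Set (Fin n)) = supp s₃ 6 := by
    ext e; simp [(hadv e e.2).2]
  refine ⟨s₄, (h₁.seq (h₂.seq (h₃.seq h₄))).mono (by simp only [layerCost]; lia),
    ?_, ?_, ?_, fun e he => ?_, fun e he => ?_⟩
  · rw [hS₄, hS₃, h7₂, ht₂, hc₁, hc, envStep]
    exact hull_congr fun j hj => by
      rw [hT₂ j (Finset.mem_range.1 hj), Set.inter_assoc, Set.inter_self]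
  · rw [h₄.frame.var 20 (by decide), h₃.frame.var 20 (by decide),
      h₂.frame.var 20 (by simp [threshold_vars]), hb₁, hb]
    ring
  · rw [h₄.frame.coins (by decide), h₃.frame.coins (by decide), hc₂, hc₁, hc, layerCoins]
    ring
  · rw [(hadv e he).2]; exact hle₃ e he
  · rw [(hadv e he).1, (hadv e he).2, h0₃]

/-- The level of an element is the number of layers that it survives. -/
def IsLevel (f : ℕ → Set (Fin n) → Set (Fin n)) (D : ℕ) (lev : Fin n → ℕ) : Prop :=
  ∀ e, lev e ≤ D ∧ ∀ i ≤ D, e ∈ chain f Set.univ i ↔ i ≤ lev e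

lemma exec_layers (hE : E.indep = M.Indep) (hM : M.E = Set.univ) (hn : s.var 0 = n)
    (hK : s.var 12 = K) (hm : s.var 13 = m) (a g : ℕ) {D : ℕ} (hD : s.var 11 = D)
    (hb : s.var 20 = 0) (hc : s.coinsUsed = n) (h7 : ∀ e < n, s.arr 7 e = 1)
    (h0 : ∀ e < n, s.arr 0 e = 0) :
    ∃ s', Exec E (forLoop 10 (.var 11) (layerProg a g)) s (D * (layerCost g n m K + 3) + 3) s' ∧
      IsLevel (envStep M E a g m K) D fun e => s'.arr 0 e := by
  obtain ⟨s₁, h₁, -, -, -, -, hI⟩ := exec_forLoop (E := E) (v := 10) (b := .var 11)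
    (p := layerProg a g) (s := s) (T := layerCost g n m K) D
    (fun i s' => supp s' 7 = chain (envStep M E a g m K) Set.univ i ∧ s'.var 20 = i * m ∧
      s'.coinsUsed = n + i * layerCoins n m K g ∧ (∀ e < n, s'.arr 7 e ≤ 1) ∧
      IsLevel (envStep M E a g m K) i fun e => s'.arr 0 e)
    (by rw [layerProg_vars, threshold_vars]; decide)
    (fun s' hf => (hf.var 11 (by rw [forLoop_vars, layerProg_vars, threshold_vars]; decide)).trans hD)
    (by
      refine ⟨?_, by simp [hb], by simp [hc], fun e he => by simp [h7 e he], fun e => ?_⟩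
      · ext e; simp [h7 e e.2, chain]
      · refine ⟨by simp [h0 e e.2], fun i hi => ?_⟩
        obtain rfl := Nat.le_zero.1 hi
        simp [chain])
    (fun i s' hi hv hfr ⟨hI₁, hI₂, hI₃, hI₄, hI₅⟩ => by
      have hvar : ∀ v, v ∉ (forLoop 10 (.var 11) (layerProg a g)).vars → s'.var v = s.var v :=
        hfr.var
      rw [forLoop_vars, layerProg_vars, threshold_vars] at hvar
      obtain ⟨s'', h, hJ₁, hJ₂, hJ₃, hJ₄, hJ₅⟩ := exec_layerProg (s := s') hE hM
        ((hvar 0 (by decide)).trans hn) ((hvar 12 (by decide)).trans hK)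
        ((hvar 13 (by decide)).trans hm) a g i hI₂ hI₃ hI₄
      refine ⟨s'', h, by rw [supp_setVar, hJ₁, hI₁, chain], by simpa using hJ₂, by simpa using hJ₃,
        by simpa using hJ₄, fun e => ?_⟩
      have hlev := hJ₅ e e.2
      obtain ⟨hle, hiff⟩ := hI₅ e
      have hmem : e ∈ chain (envStep M E a g m K) Set.univ (i + 1) ↔ s''.arr 7 e ≠ 0 := by
        rw [chain, ← hI₁, ← hJ₁, mem_supp]
      have h7e := hJ₄ e e.2
      simp only [Memory.setVar_arr, hlev]
      by_cases hin : s''.arr 7 e = 0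
      · refine ⟨by lia, fun i' hi' => ?_⟩
        rcases Nat.le_succ_iff.1 hi' with h | rfl
        · rw [hiff i' h, hin]; lia
        · simp only [hmem]; lia
      · have hprev : e ∈ chain (envStep M E a g m K) Set.univ i := by
          have := hmem.2 hin
          rw [chain] at this
          exact hull_subset this
        have := (hiff i le_rfl).1 hprev
        refine ⟨by lia, fun i' hi' => ?_⟩
        rcases Nat.le_succ_iff.1 hi' with h | rfl
        · rw [hiff i' h]; lia
        · simp only [hmem]; lia)
  exact ⟨s₁, h₁, hI⟩

lemma exec_thinProg (hn : s.var 0 = n) :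
    ∃ s', Exec E thinProg s (6 * n + 3) s' ∧ s'.coinsUsed = s.coinsUsed + n ∧
      ∀ e < n, s'.arr 1 e = (E.coin (s.coinsUsed + e)).toNat := by
  obtain ⟨s₁, h₁, hI₁, hI₂⟩ := exec_forLoop (E := E) (v := 3) (b := .var 0)
    (p := .seq (.flip 23) (.store 1 (.var 3) (.var 23))) (s := s) (T := 3) n
    (fun e s' => s'.coinsUsed = s.coinsUsed + e ∧
      ∀ e' < e, s'.arr 1 e' = (E.coin (s.coinsUsed + e')).toNat)
    (by decide) (fun s' hf => (hf.var 0 (by decide)).trans hn) (by simp)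
    (fun e s' he hv hfr ⟨hI₁, hI₂⟩ => by
      refine ⟨_, (Exec.flip _).seq (Exec.store _ _ _), ?_, fun e' he' => ?_⟩
      · simp [hI₁]; ring
      · by_cases h : e' = e
        · simp [Expr.eval, hv, hI₁, h]
        · simpa [Expr.eval, hv, h] using hI₂ e' (by lia))
  exact ⟨s₁, h₁.mono (by lia), hI₁, hI₂⟩

lemma rank_le (M : Matroid (Fin n)) : rank M ≤ n := by
  have h : M.eRank ≤ (n : ℕ∞) := by
    refine M.eRank_le_encard_ground.trans ((Set.encard_le_encard (Set.subset_univ _)).trans ?_)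
    simp [Set.encard_univ]
  exact ENat.toNat_le_of_le_natCast h

lemma parameterProg_vars (a d κ : ℕ) : (parameterProg a d κ).vars =
    rankProg.vars ++ (binaryLength.vars ++ ([11] ++ ([27] ++ (binaryLength.vars ++ [12, 13])))) :=
  rfl

lemma parameterProg_arrs (a d κ : ℕ) : (parameterProg a d κ).arrs =
    rankProg.arrs ++ (binaryLength.arrs ++ ([] ++ ([] ++ (binaryLength.arrs ++ [])))) := rfl

lemma exec_parameterProg (hE : E.indep = M.Indep) (hM : M.E = Set.univ) (hn : s.var 0 = n)
    (a d κ : ℕ) : ∃ s', Exec E (parameterProg a d κ) s (29 * n + 7 * layerNum d (rank M) + 41) s' ∧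
      s'.var 11 = layerNum d (rank M) ∧ s'.var 12 = blockNum κ (layerNum d (rank M)) ∧
      s'.var 13 = 2 * a * blockNum κ (layerNum d (rank M)) := by
  obtain ⟨s₁, h₁, hr⟩ := exec_rankProg (E := E) hE hM hn
  obtain ⟨s₂, h₂, hl⟩ := exec_binaryLength E s₁
  have h₃ := Exec.assign (E := E) (s := s₂) 11 (.times d (.add (.var 8) (.lit 1)))
  set s₃ := s₂.setVar 11 ((Expr.times d (.add (.var 8) (.lit 1))).eval s₂) with hs₃
  have h11 : s₃.var 11 = layerNum d (rank M) := by
    simp [hs₃, Expr.eval, hl, hr, layerNum]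
  have h₄ := Exec.assign (E := E) (s := s₃) 27 (.var 11)
  set s₄ := s₃.setVar 27 ((Expr.var 11).eval s₃) with hs₄
  have h27 : s₄.var 27 = layerNum d (rank M) := by simp [hs₄, Expr.eval, h11]
  obtain ⟨s₅, h₅, hl₅⟩ := exec_binaryLength E s₄
  have h₆ := Exec.assign (E := E) (s := s₅) 12 (.times κ (.add (.var 8) (.lit 1)))
  set s₆ := s₅.setVar 12 ((Expr.times κ (.add (.var 8) (.lit 1))).eval s₅) with hs₆
  have h12 : s₆.var 12 = blockNum κ (layerNum d (rank M)) := by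
    simp [hs₆, Expr.eval, hl₅, h27, blockNum]
  have h₇ := Exec.assign (E := E) (s := s₆) 13 (.times (2 * a) (.var 12))
  have hr' := rank_le M
  refine ⟨_, (h₁.seq (h₂.seq (h₃.seq (h₄.seq (h₅.seq (h₆.seq h₇)))))).mono ?_, ?_, ?_, ?_⟩
  · rw [hr, h27]; lia
  · have : s₅.var 11 = s₄.var 11 := h₅.frame.var 11 (by decide)
    simp [hs₆, this, hs₄, h11]
  · simp [h12]
  · simp [Expr.eval, h12]

/-- After the setup, array `0` holds the levels, array `1` the coins for the active elements and
array `2`, which is meant for the selected elements, is empty. -/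
lemma exec_setupProg (hE : E.indep = M.Indep) (hM : M.E = Set.univ) (a g d κ : ℕ) {D : ℕ}
    (hD : layerNum d (rank M) = D) (hK : blockNum κ D = K) (hm : 2 * a * K = m) :
    ∃ s', Exec E (setupProg a g d κ) (initial n) (setupCost g n D m K) s' ∧
      s'.var 0 = n ∧ s'.var 11 = D ∧ IsLevel (envStep M E a g m K) D (fun e => s'.arr 0 e) ∧
      (∀ e : Fin n, s'.arr 1 e = (E.coin e).toNat) ∧ ∀ e : Fin n, s'.arr 2 e = 0 := by
  obtain ⟨s₁, h₁, hD₁, hK₁, hm₁⟩ := exec_parameterProg (s := initial n) hE hM (by simp [initial])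
    a d κ
  rw [hD] at hD₁ hK₁ hm₁
  rw [hK] at hK₁ hm₁
  rw [hm] at hm₁
  have hfr₁ := h₁.frame
  have hn₁ : s₁.var 0 = n :=
    (hfr₁.var 0 (by rw [parameterProg_vars]; decide)).trans (by simp [initial])
  have hc₁ : s₁.coinsUsed = 0 := (hfr₁.coins rfl).trans rfl
  have harr₁ : ∀ b ∈ [0, 2], s₁.arr b = fun _ => 0 := fun b hb =>
    (hfr₁.arr b (by
      rw [parameterProg_arrs]
      revert b
      decide)).trans rfl
  obtain ⟨s₂, h₂, hc₂, hth⟩ := exec_thinProg (E := E) (s := s₁) hn₁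
  rw [hc₁] at hc₂ hth
  have hn₂ : s₂.var 0 = n := (h₂.frame.var 0 (by decide)).trans hn₁
  obtain ⟨s₃, h₃, h7⟩ := exec_fill E s₂ hn₂ 7 1
  have hn₃ : s₃.var 0 = n := (h₃.frame.var 0 (by decide)).trans hn₂
  have h₄ := Exec.assign (E := E) (s := s₃) 20 (.lit 0)
  set s₄ := s₃.setVar 20 ((Expr.lit 0).eval s₃) with hs₄
  have hvar₄ : ∀ v ∈ [11, 12, 13], s₄.var v = s₁.var v := fun v hv => by
    have h1 : s₄.var v = s₃.var v := by
      rw [hs₄, Memory.setVar_var, if_neg]; rintro rfl; simp at hv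
    rw [h1, h₃.frame.var v (by clear h1; revert v; decide),
      h₂.frame.var v (by clear h1; revert v; decide)]
  have harr₄ : ∀ b ∈ [0, 2], s₄.arr b = fun _ => 0 := fun b hb => by
    rw [hs₄, Memory.setVar_arr, h₃.frame.arr b (by revert b; decide),
      h₂.frame.arr b (by revert b; decide), harr₁ b hb]
  have hD₄ : s₄.var 11 = D := (hvar₄ 11 (by decide)).trans hD₁
  obtain ⟨s₅, h₅, hlev⟩ := exec_layers (s := s₄) (M := M) hE hM (by simpa [hs₄] using hn₃)
    ((hvar₄ 12 (by decide)).trans hK₁) ((hvar₄ 13 (by decide)).trans hm₁) a g hD₄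
    (by simp [hs₄, Expr.eval])
    ((h₃.frame.coins (by decide)).trans (by simpa using hc₂)) h7
    (fun e _ => by rw [harr₄ 0 (by decide)])
  have hvars : (forLoop 10 (.var 11) (layerProg a g)).vars = [10] ++ ((sampling.vars ++
    ([14, 21, 25, 22, 26, 23, 22, 26, 9, 21, 14, 25] ++ (hullProg.vars ++ advance.vars))) ++ [10]) :=
    rfl
  have harrs : (forLoop 10 (.var 11) (layerProg a g)).arrs =
    [] ++ ((sampling.arrs ++ ([] ++ (hullProg.arrs ++ advance.arrs))) ++ []) := rfl
  refine ⟨s₅, (h₁.seq (h₂.seq (h₃.seq (h₄.seq h₅)))).mono ?_, ?_, ?_, hlev, fun e => ?_,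
    fun e => ?_⟩
  · rw [hD]
    simp only [setupCost]
    lia
  · exact (h₅.frame.var 0 (by rw [hvars]; decide)).trans (by simpa [hs₄] using hn₃)
  · exact (h₅.frame.var 11 (by rw [hvars]; decide)).trans hD₄
  · rw [h₅.frame.arr 1 (by rw [harrs]; decide), hs₄, Memory.setVar_arr,
      h₃.frame.arr 1 (by decide), hth e e.2, zero_add]
  · rw [h₅.frame.arr 2 (by rw [harrs]; decide), harr₄ 2 (by decide)]

end

/-! ### Greedy selection along the levels -/

section Greedy

variable {n : ℕ} {M : Matroid (Fin n)} {lev : Fin n → ℕ} {kept : Fin n → Prop} {D : ℕ}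
  {e : Fin n}

/-- The arriving element `e` is selected if its coin keeps it, if it leaves the chain, and if it is
not spanned by the elements of higher levels and the selected elements of its own level. -/
def Admits (M : Matroid (Fin n)) (lev : Fin n → ℕ) (kept : Fin n → Prop) (D : ℕ)
    (X : Finset (Fin n)) (e : Fin n) : Prop :=
  kept e ∧ lev e < D ∧ e ∉ M.closure ({f | lev e < lev f ∨ f ∈ X ∧ lev e ≤ lev f} \ {e})

open Classical in
/-- The selected elements after the elements of a list have arrived. -/
noncomputable def admitted (M : Matroid (Fin n)) (lev : Fin n → ℕ) (kept : Fin n → Prop) (D : ℕ)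
    (L : List (Fin n)) : Finset (Fin n) :=
  L.foldl (fun X e => if Admits M lev kept D X e then insert e X else X) ∅

open Classical in
lemma admitted_concat (L : List (Fin n)) (e : Fin n) :
    admitted M lev kept D (L ++ [e]) = if Admits M lev kept D (admitted M lev kept D L) e then
      insert e (admitted M lev kept D L) else admitted M lev kept D L := by
  rw [admitted, List.foldl_append]
  rfl

lemma admitted_subset_concat (L : List (Fin n)) (e : Fin n) :
    admitted M lev kept D L ⊆ admitted M lev kept D (L ++ [e]) := by
  classical
  rw [admitted_concat]
  split_ifs
  · exact Finset.subset_insert _ _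
  · rfl

lemma admitted_subset_append (L L' : List (Fin n)) :
    admitted M lev kept D L ⊆ admitted M lev kept D (L ++ L') := by
  induction L' using List.reverseRecOn with
  | nil => simp
  | append_singleton L' e ih =>
    rw [← List.append_assoc]
    exact ih.trans (admitted_subset_concat _ _)

lemma mem_and_kept_of_mem_admitted {L : List (Fin n)} (h : e ∈ admitted M lev kept D L) :
    e ∈ L ∧ kept e := by
  classical
  induction L using List.reverseRecOn with
  | nil => simp [admitted] at h
  | append_singleton L f ih =>
    rw [admitted_concat] at h
    split_ifs at h with hf
    · rcases Finset.mem_insert.1 h with rfl | h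
      · exact ⟨by simp, hf.1⟩
      · exact ⟨List.mem_append_left _ (ih h).1, (ih h).2⟩
    · exact ⟨List.mem_append_left _ (ih h).1, (ih h).2⟩

/-- The selected elements of each level are independent in the contraction of the elements of
higher levels. -/
lemma indep_union_admitted (hM : M.E = Set.univ) (L : List (Fin n)) :
    (∀ f ∈ admitted M lev kept D L, lev f < D) ∧
    ∀ i (I : Set (Fin n)), (∀ f ∈ I, i < lev f) → M.Indep I →
      M.Indep (I ∪ {f | f ∈ admitted M lev kept D L ∧ lev f = i}) := by
  classical
  induction L using List.reverseRecOn with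
  | nil => simp [admitted]
  | append_singleton L e ih =>
    rw [admitted_concat]
    split_ifs with he
    swap; · exact ih
    refine ⟨fun f hf => ?_, fun i I hI hind => ?_⟩
    · rcases Finset.mem_insert.1 hf with rfl | hf
      · exact he.2.1
      · exact ih.1 f hf
    have hJ := ih.2 i I hI hind
    set J := I ∪ {f | f ∈ admitted M lev kept D L ∧ lev f = i} with hJdef
    by_cases hi : lev e = i
    · have hins : I ∪ {f | f ∈ insert e (admitted M lev kept D L) ∧ lev f = i} = insert e J := by
        ext f
        simp only [hJdef, Set.mem_union, Set.mem_ofPred_eq, Finset.mem_insert, Set.mem_insert_iff]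
        constructor
        · rintro (h | ⟨rfl | h, h'⟩)
          · exact .inr (.inl h)
          · exact .inl rfl
          · exact .inr (.inr ⟨h, h'⟩)
        · rintro (rfl | h | ⟨h, h'⟩)
          · exact .inr ⟨.inl rfl, hi⟩
          · exact .inl h
          · exact .inr ⟨.inr h, h'⟩
      rw [hins, hJ.insert_indep_iff]
      by_cases heJ : e ∈ J
      · exact .inr heJ
      refine .inl ⟨by simp [hM], fun hcl => he.2.2 (M.closure_subset_closure ?_ hcl)⟩
      rintro f (hf | ⟨hf, hf'⟩)
      · exact ⟨.inl (hi ▸ hI f hf), fun h => heJ (h ▸ .inl hf)⟩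
      · exact ⟨.inr ⟨hf, by lia⟩, fun h => heJ (h ▸ .inr ⟨hf, hf'⟩)⟩
    · have hsame : {f | f ∈ insert e (admitted M lev kept D L) ∧ lev f = i} =
          {f | f ∈ admitted M lev kept D L ∧ lev f = i} := by
        ext f
        simp only [Set.mem_ofPred_eq, Finset.mem_insert]
        constructor
        · rintro ⟨rfl | h, h'⟩
          · exact absurd h' hi
          · exact ⟨h, h'⟩
        · exact fun h => ⟨.inr h.1, h.2⟩
      rw [hsame]
      exact hJ

lemma indep_admitted (hM : M.E = Set.univ) (L : List (Fin n)) :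
    M.Indep (admitted M lev kept D L : Set (Fin n)) := by
  obtain ⟨hD, h⟩ := indep_union_admitted (M := M) (lev := lev) (kept := kept) (D := D) hM L
  have key : ∀ k i, i + k = D → M.Indep {f | f ∈ admitted M lev kept D L ∧ i ≤ lev f} := by
    intro k
    induction k with
    | zero =>
      intro i hi
      convert M.empty_indep
      ext f
      simp only [Set.mem_ofPred_eq, Set.mem_empty_iff_false, iff_false, not_and]
      intro hf
      have := hD f hf
      lia
    | succ k ih =>
      intro i hi
      convert h i _ (fun f hf => hf.2) (ih (i + 1) (by lia)) using 1
      ext f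
      simp only [Set.mem_ofPred_eq, Set.mem_union, ← and_or_left]
      exact and_congr_right fun _ => by lia
  simpa using key D 0 (by simp)

/-- An element is selected, whatever the order of the arrivals, if it is not even spanned by the
elements of higher levels and all active elements of its level that their coins keep. -/
lemma mem_admitted {L : List (Fin n)} (heL : e ∈ L) (hkept : kept e) (hlev : lev e < D)
    (hcl : e ∉ M.closure ({f | lev e < lev f ∨ (f ∈ L ∧ kept f) ∧ lev e ≤ lev f} \ {e})) :
    e ∈ admitted M lev kept D L := by
  classical
  obtain ⟨L₁, L₂, rfl⟩ := List.append_of_mem heL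
  have happ : L₁ ++ e :: L₂ = (L₁ ++ [e]) ++ L₂ := by simp
  rw [happ] at hcl ⊢
  refine admitted_subset_append (L₁ ++ [e]) L₂ ?_
  have ha : Admits M lev kept D (admitted M lev kept D L₁) e := by
    refine ⟨hkept, hlev, fun h => hcl (M.closure_subset_closure ?_ h)⟩
    refine Set.sdiff_subset_sdiff_left fun f hf => hf.imp_right fun hf => ⟨?_, hf.2⟩
    have := mem_and_kept_of_mem_admitted hf.1
    exact ⟨by simp [this.1], this.2⟩
  rw [admitted_concat, if_pos ha]
  exact Finset.mem_insert_self _ _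

end Greedy

/-! ### Arrivals -/

/-- Store in array `3` the elements of higher levels than the arriving one, and the selected
elements of at least its level. As array `2` holds the level plus one for selected elements and zero
for the others, its truncated difference to the level of the arriving element is nonzero exactly
for the latter. -/
def blockersProg : Prog :=
  forLoop 4 (.var 0) (.store 3 (.var 4) (.add (.sub (.get 0 (.var 4)) (.get 0 (.var 1)))
    (.sub (.get 2 (.var 4)) (.get 0 (.var 1)))))

/-- The program that handles an arrival. Array `2` holds for every selected element its level
plus one. -/
def arrivalProg : Prog :=
  .branch (.get 1 (.var 1)) (.branch (.sub (.var 11) (.get 0 (.var 1)))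
    (.seq (.assign 3 (.var 1)) (.seq blockersProg (.seq spanTest (.seq (.assign 2 (.var 5))
      (.branch (.var 5) (.store 2 (.var 1) (.add (.get 0 (.var 1)) (.lit 1))) skip)))))
    (.assign 2 (.lit 0))) (.assign 2 (.lit 0))

/-- The running time of an arrival. -/
def arrivalCost {R : Type*} [CommSemiring R] (n : R) : R := 18 * n + 30

/-- The memory holds the levels, the coins and the set of selected elements. -/
structure Represents {n : ℕ} (s : Memory) (lev : Fin n → ℕ) (kept : Fin n → Prop) (D : ℕ)
    (X : Finset (Fin n)) : Prop where
  size : s.var 0 = n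
  depth : s.var 11 = D
  level : ∀ e : Fin n, s.arr 0 e = lev e
  coin : ∀ e : Fin n, s.arr 1 e ≠ 0 ↔ kept e
  mem : ∀ e ∈ X, s.arr 2 e = lev e + 1
  notMem : ∀ e ∉ X, s.arr 2 e = 0

section

variable {n : ℕ} {E : Env n} {M : Matroid (Fin n)} {s : Memory} {lev : Fin n → ℕ}
  {kept : Fin n → Prop} {D : ℕ} {X : Finset (Fin n)}

lemma exec_blockersProg (hs : Represents s lev kept D X) {e : Fin n} (he : s.var 1 = e) :
    ∃ s', Exec E blockersProg s (4 * n + 3) s' ∧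
      supp s' 3 = {f | lev e < lev f ∨ f ∈ X ∧ lev e ≤ lev f} := by
  obtain ⟨s₁, h₁, hI⟩ := exec_forLoop (E := E) (v := 4) (b := .var 0)
    (p := .store 3 (.var 4) (.add (.sub (.get 0 (.var 4)) (.get 0 (.var 1)))
      (.sub (.get 2 (.var 4)) (.get 0 (.var 1))))) (s := s) (T := 1) n
    (fun f s' => ∀ i < f, s'.arr 3 i = (s.arr 0 i - s.arr 0 e) + (s.arr 2 i - s.arr 0 e))
    (by decide) (fun s' hf => (hf.var 0 (by decide)).trans hs.size) (by simp)
    (fun f s' hf hv hfr hI => by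
      have h0 : s'.arr 0 = s.arr 0 := hfr.arr 0 (by decide)
      have h2 : s'.arr 2 = s.arr 2 := hfr.arr 2 (by decide)
      have h1 : s'.var 1 = e := (hfr.var 1 (by decide)).trans he
      refine ⟨_, Exec.store _ _ _, fun i hi => ?_⟩
      by_cases h : i = f
      · simp [Expr.eval, hv, h, h0, h1, h2]
      · simpa [Expr.eval, hv, h] using hI i (by lia))
  refine ⟨s₁, h₁.mono (by lia), ?_⟩
  ext f
  simp only [mem_supp, hI f f.2, hs.level, Set.mem_ofPred_eq]
  by_cases hf : f ∈ X
  · rw [hs.mem f hf]; simp only [hf, true_and]; lia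
  · rw [hs.notMem f hf]; simp only [hf, false_and]; lia

lemma Represents.of_frame {p : Prog} {s' : Memory} (hs : Represents s lev kept D X)
    (hf : Frame p s s') (hv : ∀ v ∈ [0, 11], v ∉ p.vars) (ha : ∀ a ∈ [0, 1, 2], a ∉ p.arrs) :
    Represents s' lev kept D X where
  size := (hf.var 0 (hv 0 (by simp))).trans hs.size
  depth := (hf.var 11 (hv 11 (by simp))).trans hs.depth
  level e := by rw [hf.arr 0 (ha 0 (by simp))]; exact hs.level e
  coin e := by rw [hf.arr 1 (ha 1 (by simp))]; exact hs.coin e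
  mem e he := by rw [hf.arr 2 (ha 2 (by simp))]; exact hs.mem e he
  notMem e he := by rw [hf.arr 2 (ha 2 (by simp))]; exact hs.notMem e he

open Classical in
lemma exec_arrivalProg (hE : E.indep = M.Indep) (hM : M.E = Set.univ)
    (hs : Represents s lev kept D X) {e : Fin n} (he : s.var 1 = e) :
    ∃ s', Exec E arrivalProg s (arrivalCost n) s' ∧
      (s'.var 2 ≠ 0 ↔ Admits M lev kept D X e) ∧
      Represents s' lev kept D (if Admits M lev kept D X e then insert e X else X) := by
  have hreject : ¬Admits M lev kept D X e → ∀ x, (((s.setVar 2 0).var 2 ≠ 0 ↔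
      Admits M lev kept D X e) ∧ Represents (s.setVar 2 0) lev kept D
        (if Admits M lev kept D X e then insert e X else X)) ∨ x := fun h x => by
    refine .inl ⟨by simp [h], ?_⟩
    rw [if_neg h]
    exact ⟨by simpa using hs.size, by simpa using hs.depth, hs.level, hs.coin, hs.mem, hs.notMem⟩
  by_cases hk : kept e
  swap
  · refine ⟨s.setVar 2 0, (Exec.branch_neg ?_ (Exec.assign _ _)).mono
      (by simp only [arrivalCost]; lia), (hreject (fun h => hk h.1) False).resolve_right id⟩
    have := mt (hs.coin e).1 hk
    simpa [Expr.eval, he] using this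
  have hk' : (Expr.get 1 (.var 1)).eval s ≠ 0 := by simpa [Expr.eval, he] using (hs.coin e).2 hk
  by_cases hl : lev e < D
  swap
  · refine ⟨s.setVar 2 0, (Exec.branch_pos hk' (Exec.branch_neg ?_ (Exec.assign _ _))).mono
      (by simp only [arrivalCost]; lia), (hreject (fun h => hl h.2.1) False).resolve_right id⟩
    simp [Expr.eval, he, hs.depth, hs.level]; lia
  have hl' : (Expr.sub (.var 11) (.get 0 (.var 1))).eval s ≠ 0 := by
    simp [Expr.eval, he, hs.depth, hs.level]; lia
  have h₁ := Exec.assign (E := E) (s := s) 3 (.var 1)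
  set s₁ := s.setVar 3 ((Expr.var 1).eval s) with hs₁
  have hR₁ : Represents s₁ lev kept D X := hs.of_frame h₁.frame (by decide) (by decide)
  have h31 : s₁.var 3 = e := by simp [hs₁, Expr.eval, he]
  have h11 : s₁.var 1 = e := by simp [hs₁, he]
  obtain ⟨s₂, h₂, hblock⟩ := exec_blockersProg (E := E) hR₁ h11
  have hR₂ : Represents s₂ lev kept D X := hR₁.of_frame h₂.frame (by decide) (by decide)
  obtain ⟨s₃, h₃, hr⟩ := exec_spanTest (s := s₂) hE hM hR₂.size
    ((h₂.frame.var 3 (by decide)).trans h31)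
  have hR₃ : Represents s₃ lev kept D X := hR₂.of_frame h₃.frame (by decide) (by decide)
  have h13 : s₃.var 1 = e :=
    (h₃.frame.var 1 (by decide)).trans ((h₂.frame.var 1 (by decide)).trans h11)
  rw [hblock] at hr
  have h₄ := Exec.assign (E := E) (s := s₃) 2 (.var 5)
  set s₄ := s₃.setVar 2 ((Expr.var 5).eval s₃) with hs₄
  have hR₄ : Represents s₄ lev kept D X := hR₃.of_frame h₄.frame (by decide) (by decide)
  have h24 : s₄.var 2 = s₃.var 5 := by simp [hs₄, Expr.eval]
  have h54 : s₄.var 5 = s₃.var 5 := by simp [hs₄]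
  have h14 : s₄.var 1 = e := by simpa [hs₄] using h13
  by_cases hcl : e ∈ M.closure ({f | lev e < lev f ∨ f ∈ X ∧ lev e ≤ lev f} \ {e})
  · rw [if_pos hcl] at hr
    have hna : ¬Admits M lev kept D X e := fun h => h.2.2 hcl
    have h₅ := exec_skip E s₄
    refine ⟨_, (Exec.branch_pos hk' (Exec.branch_pos hl' (h₁.seq (h₂.seq (h₃.seq (h₄.seq
      (Exec.branch_neg (by simp [Expr.eval, h54, hr]) h₅))))))).mono
      (by simp only [arrivalCost]; lia), by simp [hna, h24, hr], ?_⟩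
    rw [if_neg hna]
    exact hR₄.of_frame h₅.frame (by decide) (by decide)
  · rw [if_neg hcl] at hr
    have ha : Admits M lev kept D X e := ⟨hk, hl, hcl⟩
    refine ⟨_, (Exec.branch_pos hk' (Exec.branch_pos hl' (h₁.seq (h₂.seq (h₃.seq (h₄.seq
      (Exec.branch_pos (by simp [Expr.eval, h54, hr]) (Exec.store _ _ _)))))))).mono
      (by simp only [arrivalCost]; lia), by simp [ha, h24, hr], ?_⟩
    rw [if_pos ha]
    refine ⟨hR₄.size, hR₄.depth, fun f => by simpa using hR₄.level f, fun f => by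
      simpa using hR₄.coin f, fun f hf => ?_, fun f hf => ?_⟩
    · by_cases hfe : f = e
      · subst hfe; simp [Expr.eval, h14, hR₄.level]
      · have : (f : ℕ) ≠ e := fun h => hfe (Fin.ext h)
        simpa [Expr.eval, h14, this] using hR₄.mem f ((Finset.mem_insert.1 hf).resolve_left hfe)
    · have hfe : f ≠ e := fun h => hf (h ▸ Finset.mem_insert_self _ _)
      have : (f : ℕ) ≠ e := fun h => hfe (Fin.ext h)
      simpa [Expr.eval, h14, this] using hR₄.notMem f fun h => hf (Finset.mem_insert_of_mem h)

/-- If the setup leaves the levels, the coins and the empty set in the memory, the scheme selects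
greedily along the levels. -/
lemma play_eq {A : Scheme} (hA : A.arrival = arrivalProg) (hE : E.indep = M.Indep)
    (hM : M.E = Set.univ) {T : ℕ} (hT : arrivalCost n ≤ T)
    (h0 : Represents (run E T A.setup (initial n)) lev kept D ∅) (L : List (Fin n)) :
    Represents (A.play E T L).1 lev kept D (A.play E T L).2 ∧
      (A.play E T L).2 = admitted M lev kept D L := by
  classical
  induction L using List.reverseRecOn with
  | nil => exact ⟨h0, rfl⟩
  | append_singleton L e ih =>
    obtain ⟨hR, hX⟩ := ih
    have hR' : Represents ((A.play E T L).1.setVar 1 e) lev kept D (A.play E T L).2 :=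
      ⟨by simpa using hR.size, by simpa using hR.depth, hR.level, hR.coin, hR.mem, hR.notMem⟩
    obtain ⟨s', h', h2, hR''⟩ := exec_arrivalProg hE hM hR' (e := e) (by simp)
    have hrun : run E T A.arrival ((A.play E T L).1.setVar 1 e) = s' := by
      rw [hA]; exact (h'.mono hT).run_eq
    have hplay : A.play E T (L ++ [e]) = A.handle E T (A.play E T L) e := by
      rw [Scheme.play, List.foldl_append]
      rfl
    rw [hplay, Scheme.handle, hrun, admitted_concat, ← hX]
    by_cases ha : Admits M lev kept D (A.play E T L).2 e
    · rw [if_pos ha] at hR''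
      simp only [if_pos (h2.2 ha), if_pos ha, and_true]
      exact hR''
    · rw [if_neg ha] at hR''
      simp only [if_neg (mt h2.1 ha), if_neg ha, and_true]
      exact hR''

end

/-! ### From the program to the random chain -/

section

variable {n m D K g B : ℕ} {M : Matroid (Fin n)}

lemma lead_congr {c c' : ℕ → Prop} {K : ℕ} (h : ∀ l < K, c l ↔ c' l) : lead c K = lead c' K := by
  refine eq_of_forall_le_iff fun τ => ?_
  rw [le_lead_iff, le_lead_iff]
  exact and_congr_right fun hτ => forall₂_congr fun l hl => h l (hl.trans_le hτ)

lemma chain_congr {α : Type*} {f f' : ℕ → Set α → Set α} (A : Set α) {i : ℕ}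
    (h : ∀ j < i, f j = f' j) : chain f A i = chain f' A i := by
  induction i with
  | zero => rfl
  | succ i ih => rw [chain, chain, h i (by lia), ih fun j hj => h j (by lia)]

lemma Succeeds.congr {α : Type*} {N : Matroid α} {e : α} {R A : Set α}
    {f f' : ℕ → Set α → Set α} {D : ℕ} (h : ∀ j < D, f j = f' j) (hs : Succeeds N e R f D A) :
    Succeeds N e R f' D A := by
  obtain ⟨i, hi, hs⟩ := hs
  refine ⟨i, hi, ?_⟩
  rwa [← chain_congr A fun j hj => h j (by lia), ← chain_congr A fun j hj => h j (by lia)]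

/-- The layers that the program computes are those of the random chain. -/
lemma envStep_eq (a : ℕ) (hB : n + D * layerCoins n m K g ≤ B) (ω : Outcome n (D * m) B) {i : ℕ}
    (hi : i < D) : envStep M (env M ω.2.1 ω.2.2) a g m K i =
      layers (layerStep M ((a + 1) * K)) (choices hB ω).2 i := by
  have hcoin : ∀ c : CoinIndex n D m K g,
      (env M ω.2.1 ω.2.2).coin (coinPos c) = ω.2.2 (coinEmb hB c) := fun c =>
    dif_pos ((coinPos_lt c).trans_le hB)
  funext A
  rw [layers, dif_pos hi, layerStep, layerHull, envStep]
  have hlead : lead (fun l => ∃ x : Fin g,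
      (env M ω.2.1 ω.2.2).coin (n + i * layerCoins n m K g + m * n + l * g + x) = true) K =
      delay ((choices hB ω).2 ⟨i, hi⟩).2 := by
    refine lead_congr fun l hl => ?_
    simp only [hl, exists_true_left, choices]
    refine exists_congr fun x => ?_
    rw [← hcoin]
    simp only [coinPos, ← add_assoc]
  rw [hlead, ← Nat.Iio_eq_range, ← Fin.map_valEmbedding_univ, ← hull_comp]
  refine hull_congr fun j _ => ?_
  congr 1
  ext e
  have hj : i * m + j < D * m := mul_add_lt hi j.2
  have hidx : (⟨i * m + j, hj⟩ : Fin (D * m)) = finProdFinEquiv (⟨i, hi⟩, j) :=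
    Fin.ext (by simp [finProdFinEquiv]; ring)
  have hpos : n + i * layerCoins n m K g + (j : ℕ) * n + (e : ℕ) =
      coinPos (.inr (⟨i, hi⟩, .inl (j, e)) : CoinIndex n D m K g) := by
    simp only [coinPos, ← add_assoc]
  simp only [Function.comp, keptSet, Set.mem_ofPred_eq, choices, thin, Finset.mem_coe,
    Finset.mem_filter, Fin.valEmbedding_apply, hpos, hcoin]
  refine and_congr_left fun _ => ?_
  simp only [env, hj, e.2, exists_true_left, Fin.eta, hidx]

/-- An element that leaves the chain at a layer where it cannot be blocked is selected. -/
lemma mem_admitted_of_succeeds {f : ℕ → Set (Fin n) → Set (Fin n)} {lev : Fin n → ℕ}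
    {kept : Fin n → Prop} (hlev : IsLevel f D lev) {L : List (Fin n)} {e : Fin n} (heL : e ∈ L)
    (hkept : kept e) {R : Set (Fin n)} (hR : ∀ x, x ∈ L → kept x → x ∈ R)
    (hs : Succeeds M e R f D Set.univ) : e ∈ admitted M lev kept D L := by
  obtain ⟨i, hi, h1, h2, h3⟩ := hs
  rw [(hlev e).2 i hi.le] at h1
  have h2' := h2
  rw [(hlev e).2 (i + 1) hi] at h2'
  have hie : lev e = i := by lia
  refine mem_admitted heL hkept (by lia) fun hcl => h3 ⟨h2, M.closure_subset_closure ?_ hcl⟩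
  refine Set.sdiff_subset_sdiff_left ?_
  rintro x (hx | ⟨⟨hx, hk⟩, hle⟩)
  · exact .inr (((hlev x).2 (i + 1) hi).2 (by lia))
  · exact .inl ⟨hR x hx hk, ((hlev x).2 i hi.le).2 (by lia)⟩

end

section

variable {n : ℕ} {M : Matroid (Fin n)}

/-- The contention resolution scheme. -/
def scheme (a g d κ : ℕ) : Scheme := ⟨setupProg a g d κ, arrivalProg⟩

lemma exists_represents {E : Env n} (hE : E.indep = M.Indep) (hM : M.E = Set.univ)
    (a g d κ : ℕ) {m D K T : ℕ} (hD : layerNum d (rank M) = D) (hK : blockNum κ D = K)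
    (hm : 2 * a * K = m) (hT : setupCost g n D m K ≤ T) :
    HaltsWithin E T (scheme a g d κ).setup (initial n) ∧ ∃ lev,
      IsLevel (envStep M E a g m K) D lev ∧
      Represents (run E T (scheme a g d κ).setup (initial n)) lev (fun e => E.coin e = true) D ∅ := by
  obtain ⟨s', h, h0, h11, hlev, hc, hX⟩ := exec_setupProg hE hM a g d κ hD hK hm
  have h' := h.mono (T₂ := T) (by simpa using hT)
  refine ⟨h'.haltsWithin, _, hlev, ?_⟩
  change Represents (run E T (setupProg a g d κ) (initial n)) _ _ _ _
  rw [h'.run_eq]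
  exact ⟨h0, h11, fun e => rfl, fun e => by simp [hc], by simp, fun e _ => hX e⟩

variable {a g d κ m D K T : ℕ}

lemma scheme_runsWithin (hM : M.E = Set.univ) (hD : layerNum d (rank M) = D)
    (hK : blockNum κ D = K) (hm : 2 * a * K = m) (k : ℕ) (hT : setupCost g n D m K ≤ T)
    (hT' : arrivalCost n ≤ T) : (scheme a g d κ).RunsWithin M k T := by
  intro S c
  obtain ⟨hh, lev, -, hR⟩ := exists_represents (E := env M S c) rfl hM a g d κ hD hK hm hT
  refine ⟨hh, fun L e _ => ?_⟩
  have hR := (play_eq (A := scheme a g d κ) rfl rfl hM hT' hR L).1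
  obtain ⟨s', h, -⟩ := exec_arrivalProg (E := env M S c) (M := M) rfl hM
    (s := ((scheme a g d κ).play (env M S c) T L).1.setVar 1 e) (e := e)
    ⟨by simpa using hR.size, by simpa using hR.depth, hR.level, hR.coin, hR.mem, hR.notMem⟩ (by simp)
  exact (h.mono (by simpa using hT')).haltsWithin

lemma scheme_feasible (hM : M.E = Set.univ) (hD : layerNum d (rank M) = D)
    (hK : blockNum κ D = K) (hm : 2 * a * K = m) (k : ℕ) (hT : setupCost g n D m K ≤ T)
    (hT' : arrivalCost n ≤ T) : (scheme a g d κ).Feasible M k T := by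
  intro S c L _
  obtain ⟨-, lev, -, hR⟩ := exists_represents (E := env M S c) rfl hM a g d κ hD hK hm hT
  rw [(play_eq (A := scheme a g d κ) rfl rfl hM hT' hR L).2]
  exact indep_admitted hM L

lemma coins_le_setupCost : n + D * layerCoins n m K g ≤ setupCost g n D m K := by
  have h : layerCoins n m K g ≤ layerCost g n m K + 3 := by
    simp only [layerCoins, layerCost]
    have h1 : m * n ≤ m * (10 * n + 8) := Nat.mul_le_mul_left _ (by lia)
    have h2 : K * g ≤ K * (6 * g + 13) := Nat.mul_le_mul_left _ (by lia)
    lia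
  have := Nat.mul_le_mul_left D h
  simp only [setupCost]
  lia

lemma scheme_selectable (hM : M.E = Set.univ) (hD : layerNum d (rank M) = D)
    (hK : blockNum κ D = K) (hm : 2 * a * K = m) (hK0 : 0 < K) (hg : 1 ≤ g)
    (hT : setupCost g n D m K ≤ T) (hT' : arrivalCost n ≤ T) {x : Fin n → ℝ}
    (hx : x ∈ polytope M) : (scheme a g d κ).Selectable M (D * m) T x
      (1 / 2 * (1 - ((((a + 1) * K : ℕ) + K : ℝ) / (m + 1) + 2 * (1 / 2) ^ g +
        D * (1 - (1 / 2) ^ g) ^ K + (a / (a + 1) : ℝ) ^ D * rank M))) := by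
  intro σ e he
  have hB : n + D * layerCoins n m K g ≤ coinSupply n T :=
    (coins_le_setupCost.trans hT).trans (Nat.le_mul_of_pos_right _ (by lia))
  refine le_condProb (t₀ := (a + 1) * K) hM hx he hg (by positivity) (le_of_eq ?_) hB _
    fun ω h1 h2 => ?_
  · have : (K : ℝ) ≠ 0 := by positivity
    rw [← hm]
    push_cast
    field_simp
  · have hcoin : ∀ f : Fin n, (env M ω.2.1 ω.2.2).coin f =
        ω.2.2 (coinEmb hB (.inl f)) := fun f =>
      dif_pos ((coinPos_lt (.inl f : CoinIndex n D m K g)).trans_le hB)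
    obtain ⟨-, lev, hlev, hR⟩ :=
      exists_represents (E := env M ω.2.1 ω.2.2) rfl hM a g d κ hD hK hm hT
    have hmem : ∀ f, f ∈ (choices hB ω).1 ↔ f ∈ ω.1 ∧ (env M ω.2.1 ω.2.2).coin f = true := by
      intro f
      rw [hcoin]
      exact Finset.mem_filter
    rw [Scheme.selected, (play_eq (A := scheme a g d κ) rfl rfl hM hT' hR _).2]
    refine mem_admitted_of_succeeds hlev ((σ.mem_iff ω e).2 ((hmem e).1 h1).1) ((hmem e).1 h1).2
      (fun f hf hk => (hmem f).2 ⟨(σ.mem_iff ω f).1 hf, hk⟩)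
      (h2.congr fun i hi => (envStep_eq a hB ω hi).symm)

end

/-! ### The choice of the parameters -/

/-- The number of samples: `2 * a * K` for each of the layers. -/
def sampleNum (a d κ r : ℕ) : ℕ := layerNum d r * (2 * a * blockNum κ (layerNum d r))

open Polynomial in
/-- A bound for the running time: the numbers of layers, blocks and samples are replaced by their
values for the largest possible rank, in a form that is manifestly polynomial. -/
noncomputable def timeBound (a g d κ : ℕ) : Polynomial ℕ :=
  setupCost (C g) X (C d * (X + 1)) (C (2 * a) * (C κ * (C d * (X + 1) + 1)))
    (C κ * (C d * (X + 1) + 1)) + arrivalCost X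

lemma size_le_self (n : ℕ) : n.size ≤ n := Nat.size_le.2 Nat.lt_two_pow_self

lemma le_timeBound {a g d κ n r : ℕ} (hr : r ≤ n) :
    setupCost g n (layerNum d r) (2 * a * blockNum κ (layerNum d r)) (blockNum κ (layerNum d r)) +
      arrivalCost n ≤ (timeBound a g d κ).eval n := by
  have hD : layerNum d r ≤ d * (n + 1) :=
    Nat.mul_le_mul_left _ (Nat.succ_le_succ ((size_le_self r).trans hr))
  have hK : blockNum κ (layerNum d r) ≤ κ * (d * (n + 1) + 1) :=
    Nat.mul_le_mul_left _ (Nat.succ_le_succ ((size_le_self _).trans hD))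
  have hm : 2 * a * blockNum κ (layerNum d r) ≤ 2 * a * (κ * (d * (n + 1) + 1)) :=
    Nat.mul_le_mul_left _ hK
  have heval : (timeBound a g d κ).eval n = setupCost g n (d * (n + 1))
      (2 * a * (κ * (d * (n + 1) + 1))) (κ * (d * (n + 1) + 1)) + arrivalCost n := by
    simp [timeBound, setupCost, layerCost, hullCost, arrivalCost]
  rw [heval]
  simp only [setupCost, layerCost, hullCost]
  gcongr

/-- A number of repetitions that is proportional to the binary length of `r` compensates for a
factor `r`. -/
lemma pow_size_mul_le {y η : ℝ} (hy : 0 ≤ y) (hy' : y ≤ 1 / 2) (hη : y ≤ η) (r : ℕ) :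
    y ^ (r.size + 1) * r ≤ η := by
  have hη0 : 0 ≤ η := hy.trans hη
  have h1 : (r : ℝ) ≤ 2 ^ r.size := by exact_mod_cast (Nat.lt_size_self r).le
  calc y ^ (r.size + 1) * r ≤ ((1 / 2) ^ r.size * η) * 2 ^ r.size := by
        rw [pow_succ]; gcongr
    _ = ((1 / 2) * 2) ^ r.size * η := by rw [mul_pow]; ring
    _ = η := by norm_num

/-- The selection probability for suitable constants. -/
lemma exists_parameters {ε : ℝ} (hε : 0 < ε) : ∃ a g d κ : ℕ, 1 ≤ g ∧ 1 ≤ d ∧ 1 ≤ κ ∧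
    ∀ r D K m : ℕ, layerNum d r = D → blockNum κ D = K → 2 * a * K = m →
      1 / 4 - ε ≤ 1 / 2 * (1 - ((((a + 1) * K : ℕ) + K : ℝ) / (m + 1) + 2 * (1 / 2) ^ g +
        D * (1 - (1 / 2) ^ g) ^ K + (a / (a + 1) : ℝ) ^ D * r)) := by
  have hmin : 0 < min (1 / 2) (ε / 2) := by positivity
  obtain ⟨a, ha⟩ := exists_nat_gt (2 / ε)
  have ha0 : (0 : ℝ) < a := (by positivity : 0 < 2 / ε).trans ha
  obtain ⟨g, hg⟩ := exists_pow_lt_of_lt_one (show 0 < ε / 2 by positivity)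
    (show (1 / 2 : ℝ) < 1 by norm_num)
  have hp : 0 < (1 / 2 : ℝ) ^ (g + 1) := by positivity
  have hp' : (1 / 2 : ℝ) ^ (g + 1) ≤ 1 := pow_le_one₀ (by norm_num) (by norm_num)
  have hq : (a / (a + 1) : ℝ) < 1 := by rw [div_lt_one (by positivity)]; linarith
  obtain ⟨d, hd⟩ := exists_pow_lt_of_lt_one hmin hq
  obtain ⟨κ, hκ⟩ := exists_pow_lt_of_lt_one hmin (show 1 - (1 / 2 : ℝ) ^ (g + 1) < 1 by linarith)
  rw [lt_min_iff] at hd hκ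
  refine ⟨a, g + 1, d, κ, by lia, Nat.one_le_iff_ne_zero.2 ?_, Nat.one_le_iff_ne_zero.2 ?_, ?_⟩
  · rintro rfl; norm_num at hd
  · rintro rfl; norm_num at hκ
  rintro r D K m hD hK hm
  -- the quotient is at most `(a + 2) * K / (2 * a * K) = 1 / 2 + 1 / a`
  have h1 : (((a + 1) * K : ℕ) + K : ℝ) / (m + 1) ≤ 1 / 2 + ε / 2 := by
    have haε : 2 ≤ a * ε := by rw [div_lt_iff₀ hε] at ha; exact ha.le
    rw [div_le_iff₀ (by positivity), ← hm]
    push_cast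
    have : 2 * (K : ℝ) ≤ a * ε * K := by gcongr
    nlinarith
  have h2 : 2 * (1 / 2 : ℝ) ^ (g + 1) ≤ ε / 2 := by rw [pow_succ]; linarith
  have h3 : D * (1 - (1 / 2 : ℝ) ^ (g + 1)) ^ K ≤ ε / 2 := by
    rw [← hK, blockNum, pow_mul, mul_comm]
    exact pow_size_mul_le (pow_nonneg (by linarith) _) hκ.1.le hκ.2.le D
  have h4 : (a / (a + 1) : ℝ) ^ D * r ≤ ε / 2 := by
    rw [← hD, layerNum, pow_mul]
    exact pow_size_mul_le (by positivity) hd.1.le hd.2.le r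
  linarith

/-! ### The number of samples -/

lemma size_isBigO_log : (fun r : ℕ => ((r.size + 1 : ℕ) : ℝ)) =O[atTop] fun r : ℕ => Real.log r := by
  refine IsBigO.of_bound (3 / Real.log 2) ?_
  filter_upwards [eventually_ge_atTop 2] with r hr
  have h2 : 0 < Real.log 2 := Real.log_pos (by norm_num)
  have hlog : Real.log 2 ≤ Real.log r := Real.log_le_log (by norm_num) (by exact_mod_cast hr)
  have hpos : 0 < r.size := Nat.size_pos.2 (by lia)
  have hpow : (2 : ℝ) ^ (r.size - 1) ≤ r := by
    exact_mod_cast Nat.lt_size.1 (show r.size - 1 < r.size by lia)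
  have h := Real.log_le_log (by positivity) hpow
  rw [Real.log_pow, Nat.cast_sub (by lia)] at h
  rw [Real.norm_of_nonneg (by positivity), Real.norm_of_nonneg (h2.le.trans hlog),
    div_mul_eq_mul_div, le_div_iff₀ h2]
  push_cast at h ⊢
  linarith

lemma tendsto_layerNum {d : ℕ} (hd : 1 ≤ d) : Tendsto (layerNum d) atTop atTop := by
  refine tendsto_atTop_atTop_of_monotone (fun r s h => ?_) fun b => ⟨2 ^ b, ?_⟩
  · exact Nat.mul_le_mul_left _ (Nat.succ_le_succ (Nat.size_le_size h))
  · rw [layerNum, Nat.size_pow]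
    nlinarith

lemma log_isBigO_log_log {u : ℕ → ℕ} (h : (fun r => (u r : ℝ)) =O[atTop] fun r : ℕ => Real.log r) :
    (fun r => Real.log (u r)) =O[atTop] fun r : ℕ => Real.log (Real.log r) := by
  obtain ⟨c, hc, hb⟩ := h.exists_pos
  have hlog : Tendsto (fun r : ℕ => Real.log r) atTop atTop :=
    Real.tendsto_log_atTop.comp tendsto_natCast_atTop_atTop
  have hll := Real.tendsto_log_atTop.comp hlog
  refine IsBigO.of_bound 2 ?_
  filter_upwards [hb.bound, hlog.eventually_ge_atTop 1, hll.eventually_ge_atTop (Real.log c),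
    hll.eventually_ge_atTop 0] with r h1 h2 h3 h4
  simp only [Function.comp] at h3 h4
  rw [Real.norm_of_nonneg (by positivity), Real.norm_of_nonneg (by positivity)] at h1
  rw [Real.norm_of_nonneg (Real.log_natCast_nonneg _), Real.norm_of_nonneg h4]
  rcases Nat.eq_zero_or_pos (u r) with h0 | h0
  · simp [h0, h4]
  calc Real.log (u r) ≤ Real.log (c * Real.log r) := Real.log_le_log (by exact_mod_cast h0) h1
    _ = Real.log c + Real.log (Real.log r) := Real.log_mul hc.ne' (by positivity)
    _ ≤ 2 * Real.log (Real.log r) := by linarith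

lemma sampleNum_isBigO {a d κ : ℕ} (hd : 1 ≤ d) : (fun r : ℕ => (sampleNum a d κ r : ℝ)) =O[atTop]
    fun r : ℕ => Real.log r * Real.log (Real.log r) ^ 2 := by
  have hD : (fun r : ℕ => (layerNum d r : ℝ)) =O[atTop] fun r : ℕ => Real.log r := by
    simpa only [layerNum, Nat.cast_mul] using size_isBigO_log.const_mul_left (d : ℝ)
  have hK : (fun r : ℕ => ((2 * a * blockNum κ (layerNum d r) : ℕ) : ℝ)) =O[atTop]
      fun r : ℕ => Real.log (Real.log r) := by
    have h := (size_isBigO_log.comp_tendsto (tendsto_layerNum hd)).trans (log_isBigO_log_log hD)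
    simpa only [blockNum, Nat.cast_mul, mul_assoc, Function.comp] using
      ((h.const_mul_left (κ : ℝ)).const_mul_left (a : ℝ)).const_mul_left ((2 : ℕ) : ℝ)
  have hsq : (fun r : ℕ => Real.log (Real.log r)) =O[atTop]
      fun r : ℕ => Real.log (Real.log r) ^ 2 := by
    have hll := Real.tendsto_log_atTop.comp
      (Real.tendsto_log_atTop.comp (tendsto_natCast_atTop_atTop (R := ℝ)))
    refine IsBigO.of_bound 1 ?_
    filter_upwards [hll.eventually_ge_atTop 1] with r hr
    simp only [Function.comp] at hr
    rw [Real.norm_of_nonneg (by positivity), Real.norm_of_nonneg (by positivity)]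
    nlinarith
  simpa only [sampleNum, Nat.cast_mul] using hD.mul (hK.trans hsq)

end OCRS

theorem theorem1 (ε : ℝ) (hε : 0 < ε) :
    ∃ (A : OCRS.Scheme) (time : Polynomial ℕ) (samples : ℕ → ℕ),
      (fun r : ℕ => (samples r : ℝ)) =O[atTop]
        (fun r : ℕ => Real.log r * Real.log (Real.log r) ^ 2) ∧
      ∀ (n : ℕ) (M : Matroid (Fin n)), M.E = Set.univ →
        A.RunsWithin M (samples (OCRS.rank M)) (time.eval n) ∧
        A.Feasible M (samples (OCRS.rank M)) (time.eval n) ∧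
        ∀ x ∈ OCRS.polytope M,
          A.Selectable M (samples (OCRS.rank M)) (time.eval n) x (1 / 4 - ε) := by
  obtain ⟨a, g, d, κ, hg, hd, hκ, hγ⟩ := OCRS.exists_parameters hε
  refine ⟨OCRS.scheme a g d κ, OCRS.timeBound a g d κ, OCRS.sampleNum a d κ,
    OCRS.sampleNum_isBigO hd, fun n M hM => ?_⟩
  have hT := OCRS.le_timeBound (a := a) (g := g) (d := d) (κ := κ) (OCRS.rank_le M)
  have hT₁ := (Nat.le_add_right _ _).trans hT
  have hT₂ := (Nat.le_add_left _ _).trans hT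
  refine ⟨OCRS.scheme_runsWithin hM rfl rfl rfl _ hT₁ hT₂,
    OCRS.scheme_feasible hM rfl rfl rfl _ hT₁ hT₂, fun x hx σ e he => ?_⟩
  have hK : 0 < OCRS.blockNum κ (OCRS.layerNum d (OCRS.rank M)) := Nat.mul_pos hκ (Nat.succ_pos _)
  exact (hγ _ _ _ _ rfl rfl rfl).trans
    (OCRS.scheme_selectable hM rfl rfl rfl hK hg hT₁ hT₂ hx σ e he)
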